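/- Let $r\ge 2$ be an integer and let $\phi$ be Euler's function. There is a constant $B=B(r)$, depending only on $r$, such that the following holds. Let $\mathbb F_q$ be a finite field with $q\equiv 1 \pmod r$, and let $g\ge 1$ be an integer with $2g\equiv 0\pmod{r-1}$, so that $d=\frac{2g+2r-2}{r-1}$ is an integer. Let $\mathcal F^{thin}_r(g)$ be the set of all $F=\alpha\prod_{1\le i\le r,\ (i,r)=1} f_i^{\,i}$, where $\alpha\in\mathbb F_q^*/(\mathbb F_q^*)^r$ and the $f_i\in\mathbb F_q[X]$ are monic, square-free and pairwise coprime, such that $F$ is $r$-th power free, $F$ is not an $s$-th power for any $s\mid r$ with $s\ne 1$, and $$2g+2r-2=(r-1)\sum_{(i,r)=1}\deg f_i+r-\gcd(r,\deg F).$$ Then $\mathcal F^{thin}_r(g)$ is finite and non-empty. Let $P\in\mathbb F_q[X]$ be irreducible of degree $n$; if $r=2$, assume in addition that $n\notin\{2g,\,2g+1,\,2g+2\}$. Write $\mathcal F^{thin}_r(g;P)=\{F\in\mathcal F^{thin}_r(g): (F,P)=1\}$. Then $$\left|\frac{|\mathcal F^{thin}_r(g;P)|}{|\mathcal F^{thin}_r(g)|}-\sum_{a=0}^{\lfloor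 d/n\rfloor}\left(\frac{-\phi(r)}{q^n}\right)^a\left(1-\frac{an}{d}\right)^{\phi(r)-1}\right|\le \frac{B}{g\,q^n},$$ where $0^0=1$. -/

import Mathlib

open Polynomial

namespace ThinCover

/-- The indices `1 ≤ i ≤ r` with `(i, r) = 1`. -/
def unitIdx (r : ℕ) : Finset ℕ := (Finset.Icc 1 r).filter (fun i => i.Coprime r)

/-- Polynomials that are `r`-th power free and not an `s`-th power for any `s ∣ r`, `s ≠ 1`. -/
def IsKummerPoly {K : Type*} [Field K] (r : ℕ) (F : K[X]) : Prop :=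
  (∀ H : K[X], H ^ r ∣ F → IsUnit H) ∧
    ∀ s : ℕ, s ∣ r → s ≠ 1 → ∀ H : K[X], F ≠ H ^ s

/-- The group `Kˣ / (Kˣ)^r`, in which the leading coefficients live. -/
abbrev LeadingClass (K : Type*) [Field K] (r : ℕ) : Type _ :=
  Kˣ ⧸ (powMonoidHom r : Kˣ →* Kˣ).range

/-- The factors `f i`, for `i` prime to `r`, are monic, square-free and pairwise coprime,
and `F` is the product of the `f i ^ i`. -/
def IsThinFactorization {K : Type*} [Field K] (r : ℕ) (f : ℕ → K[X]) (F : K[X]) : Prop :=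
  (∀ i ∈ unitIdx r, (f i).Monic ∧ Squarefree (f i)) ∧
    (unitIdx r : Set ℕ).Pairwise (fun i j => IsCoprime (f i) (f j)) ∧
    F = ∏ i ∈ unitIdx r, f i ^ i

/-- The thin family of genus `g`. An element `α F` is recorded as the pair of its leading
coefficient `α`, taken modulo `r`-th powers, and its monic part `F`. Being `r`-th power free and
not being an `s`-th power (`s ∣ r`) do not depend on the representative `a` of the class `α`.
The last condition is the genus formula of the curve `Y ^ r = α F(X)`. -/
def thinFamily (K : Type*) [Field K] (r g : ℕ) : Set (LeadingClass K r × K[X]) :=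
  {x | (∀ a : Kˣ, (QuotientGroup.mk a : LeadingClass K r) = x.1 →
          IsKummerPoly r (C (a : K) * x.2)) ∧
    ∃ f : ℕ → K[X], IsThinFactorization r f x.2 ∧
      2 * (g : ℤ) + 2 * r - 2 =
        (r - 1) * (∑ i ∈ unitIdx r, ((f i).natDegree : ℤ)) + r - (Nat.gcd r x.2.natDegree : ℤ)}

/-- The elements of the thin family of genus `g` that are coprime to `G`. -/
def thinFamilyCoprime (K : Type*) [Field K] (r g : ℕ) (G : K[X]) :
    Set (LeadingClass K r × K[X]) :=
  {x | x ∈ thinFamily K r g ∧ IsCoprime x.2 G}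

end ThinCover

/-! Write `φ = φ(r)`, `k = φ - 1` and `n = deg P`. By the genus formula, a member of the family is,
up to its leading class, a coloring of closed points of the projective line by residues prime to
`r`: the colored points have total degree `d`, the degree weighted by colors is divisible by `r`,
and the color at infinity is forced by the others (`genus_iff`, `thinMonic_eq_image`,
`affinePoly_injOn`). The leading class cancels in the quotient. Averaging over the `r`-th roots of
unity `ζ` turns both counts into sums of coefficients of Euler products, `colorSeries` and
`colorSeriesAvoid`.

Up to degree `d`, the Euler product at `ζ` is the product of the twisted zeta functions `1 / (1 - q
ζ^i t)` with a factor that converges beyond `|t| = 1/q`. After division by `q^m`, the coefficient of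
index `m` is therefore `A m^k / k! + O(m^(k-1))` for `ζ = 1`, with `A` bounded below
(`norm_coeff_colorSeries_one_sub_le`, `exists_eval_regSeries_one`). If `ζ^2 ≠ 1`, the ratios `ζ` and
`ζ^(-1)` differ and one power of `m` is lost (`norm_coeff_colorSeries_div_le`). If `ζ^2 = 1`, the
coefficient of index `d` is the same as for `ζ = 1`.

Forbidding `P` divides the Euler product by `1 + μ t^n`, so the new coefficients are the alternating
sums `∑ (-μ)^a v(m - a n)`. Inserting `v(m) ≈ A m^k / k!` produces the main term, and since the term
`a = 0` is exact, every error carries a factor `q^(-n)`. The normalized count is of order at least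
`d^k` for large `d`; for small `d` a sieve bounds it below uniformly in `q`
(`card_thinColorings_ge_div`). This makes the relative error `O(1/d) = O(1/g)`
(`abs_div_sub_mainSum_le`).

For `r = 2` one has `k = 0` and there is no power of `m` to save. There the series is exactly `(1 +
t)(1 - q t^2) / (1 - q t)` up to degree `d`, and its normalized coefficients are constant from index
`3` on. The excluded degrees are those for which the term `a = 1` meets an index below `3`. If `n >
d`, every `F` is coprime to `P` and both quantities equal `1`. -/

namespace ThinCover

/-! ### Monic polynomials over a finite field and the truncated Euler product. -/

section Counting
variable (K : Type*) [Field K] [Finite K]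

theorem finite_monic_natDegree (m : ℕ) : {f : K[X] | f.Monic ∧ f.natDegree = m}.Finite := by
  have e := (monicEquivDegreeLT (R := K) m).trans (degreeLTEquiv K m).toEquiv
  have : Finite {f : K[X] // f.Monic ∧ f.natDegree = m} := Finite.of_equiv _ e.symm
  exact Set.finite_coe_iff.1 this

/-- The monic polynomials of degree `m`. -/
noncomputable def monics (m : ℕ) : Finset K[X] := (finite_monic_natDegree K m).toFinset

variable {K} in
@[simp] theorem mem_monics {m : ℕ} {f : K[X]} : f ∈ monics K m ↔ f.Monic ∧ f.natDegree = m := by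
  simp [monics]

theorem card_monics (m : ℕ) : (monics K m).card = Nat.card K ^ m := by
  have e := (monicEquivDegreeLT (R := K) m).trans (degreeLTEquiv K m).toEquiv
  have h : Nat.card {f : K[X] // f.Monic ∧ f.natDegree = m} = Nat.card K ^ m := by
    rw [Nat.card_congr e, Nat.card_fun, Nat.card_fin]
  rw [monics, ← Set.ncard_eq_toFinset_card _ (finite_monic_natDegree K m), ← h]
  rfl

theorem finite_monic_irreducible_le (d : ℕ) :
    {P : K[X] | P.Monic ∧ Irreducible P ∧ P.natDegree ≤ d}.Finite := by
  refine ((Set.finite_Iic d).biUnion fun m _ => finite_monic_natDegree K m).subset fun P hP => ?_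
  exact Set.mem_biUnion hP.2.2 ⟨hP.1, rfl⟩

/-- The monic irreducible polynomials of degree at most `d`. -/
noncomputable def primesLE (d : ℕ) : Finset K[X] := (finite_monic_irreducible_le K d).toFinset

variable {K}

@[simp] theorem mem_primesLE {d : ℕ} {P : K[X]} :
    P ∈ primesLE K d ↔ P.Monic ∧ Irreducible P ∧ P.natDegree ≤ d := by
  simp [primesLE]

open Classical in
/-- The monic polynomials of degree `m` all of whose monic irreducible factors lie in `S`. -/
noncomputable def smoothMonics (S : Finset K[X]) (m : ℕ) : Finset K[X] :=
  (monics K m).filter fun f => ∀ Q : K[X], Q.Monic → Irreducible Q → Q ∣ f → Q ∈ S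

theorem mem_smoothMonics {S : Finset K[X]} {m : ℕ} {f : K[X]} :
    f ∈ smoothMonics S m ↔ (f.Monic ∧ f.natDegree = m) ∧
      ∀ Q : K[X], Q.Monic → Irreducible Q → Q ∣ f → Q ∈ S := by
  simp [smoothMonics]

theorem exists_monic_irreducible_dvd {F : Type*} [Field F] {f : F[X]}
    (h : f.natDegree ≠ 0) : ∃ Q : F[X], Q.Monic ∧ Irreducible Q ∧ Q ∣ f := by
  obtain ⟨Q, hQ⟩ := Polynomial.exists_monic_irreducible_factor f (fun hu => h (natDegree_eq_zero_of_isUnit hu))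
  exact ⟨Q, hQ.1, hQ.2.1, hQ.2.2⟩

/-- The members divisible by `P` are `P` times a member of lower degree. This is the coefficient
form of multiplying a generating function by `1 / (1 - X ^ deg P)`. -/
theorem card_smoothMonics_insert [DecidableEq K[X]] {S : Finset K[X]} {P : K[X]} (hP : P.Monic)
    (hPi : Irreducible P) (hPS : P ∉ S) (m : ℕ) :
    (smoothMonics (insert P S) m).card = (smoothMonics S m).card +
      if P.natDegree ≤ m then (smoothMonics (insert P S) (m - P.natDegree)).card else 0 := by
  classical
  rw [← Finset.card_filter_add_card_filter_not (s := smoothMonics (insert P S) m) (fun f => ¬ P ∣ f)]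
  congr 1
  · congr 1
    ext f
    simp only [Finset.mem_filter, mem_smoothMonics, Finset.mem_insert]
    constructor
    · rintro ⟨⟨h1, h2⟩, h3⟩
      refine ⟨h1, fun Q hQ hQi hQf => (h2 Q hQ hQi hQf).resolve_left ?_⟩
      rintro rfl
      exact h3 hQf
    · rintro ⟨h1, h2⟩
      exact ⟨⟨h1, fun Q hQ hQi hQf => Or.inr (h2 Q hQ hQi hQf)⟩, fun h => hPS (h2 P hP hPi h)⟩
  · simp only [not_not]
    split_ifs with hm
    · symm
      refine Finset.card_bij (fun f _ => P * f) ?_ ?_ ?_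
      · intro f hf
        simp only [Finset.mem_filter, mem_smoothMonics, Finset.mem_insert] at hf ⊢
        refine ⟨⟨⟨hP.mul hf.1.1, ?_⟩, fun Q hQ hQi hQf => ?_⟩, dvd_mul_right _ _⟩
        · rw [hP.natDegree_mul hf.1.1, hf.1.2]; omega
        · rcases hQi.prime.dvd_or_dvd hQf with h | h
          · exact Or.inl (eq_of_monic_of_associated hQ hP (hQi.associated_of_dvd hPi h))
          · exact hf.2 Q hQ hQi h
      · intro f _ g _ h
        exact mul_left_cancel₀ hP.ne_zero h
      · intro f hf
        simp only [Finset.mem_filter, mem_smoothMonics, Finset.mem_insert] at hf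
        obtain ⟨⟨⟨h1, h2⟩, h3⟩, g, rfl⟩ := hf
        have hg : g.Monic := hP.of_mul_monic_left h1
        refine ⟨g, ?_, rfl⟩
        simp only [mem_smoothMonics, Finset.mem_insert]
        refine ⟨⟨hg, ?_⟩, fun Q hQ hQi hQf => h3 Q hQ hQi (hQf.mul_left _)⟩
        rw [hP.natDegree_mul hg] at h2; omega
    · rw [Finset.card_eq_zero, Finset.filter_eq_empty_iff]
      intro f hf hPf
      rw [mem_smoothMonics] at hf
      exact hm (hf.1.2 ▸ natDegree_le_of_dvd hPf hf.1.1.ne_zero)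

theorem card_smoothMonics_empty (m : ℕ) :
    (smoothMonics (∅ : Finset K[X]) m).card = if m = 0 then 1 else 0 := by
  split_ifs with hm
  · rw [Finset.card_eq_one]
    refine ⟨1, Finset.ext fun f => ?_⟩
    rw [mem_smoothMonics, Finset.mem_singleton, hm]
    constructor
    · rintro ⟨⟨h1, h2⟩, -⟩
      exact h1.natDegree_eq_zero.mp h2
    · rintro rfl
      refine ⟨⟨monic_one, natDegree_one⟩, fun Q _ hQi hQ => absurd (isUnit_of_dvd_one hQ) hQi.not_isUnit⟩
  · rw [Finset.card_eq_zero, Finset.eq_empty_iff_forall_notMem]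
    intro f hf
    rw [mem_smoothMonics] at hf
    obtain ⟨Q, h1, h2, h3⟩ := exists_monic_irreducible_dvd (f := f) (hf.1.2 ▸ hm)
    exact absurd (hf.2 Q h1 h2 h3) (Finset.notMem_empty _)

theorem card_smoothMonics_primesLE {d m : ℕ} (h : m ≤ d) :
    (smoothMonics (primesLE K d) m).card = Nat.card K ^ m := by
  rw [← card_monics K m]
  congr 1
  ext f
  rw [mem_smoothMonics, mem_monics, and_iff_left_iff_imp]
  intro hf Q hQ hQi hQf
  exact mem_primesLE.2 ⟨hQ, hQi, (natDegree_le_of_dvd hQf hf.1.ne_zero).trans (hf.2.le.trans h)⟩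

/-- The Euler product over `S` with denominators cleared. For `S = primesLE K d` the series has
coefficients `q ^ m` up to index `d`, so a finite product stands in for the zeta function of the
affine line. -/
theorem mk_card_smoothMonics_mul (R : Type*) [CommRing R] (S : Finset K[X])
    (hS : ∀ P ∈ S, P.Monic ∧ Irreducible P) :
    PowerSeries.mk (fun m => ((smoothMonics S m).card : R)) *
      ∏ P ∈ S, (1 - PowerSeries.X ^ P.natDegree) = 1 := by
  classical
  induction S using Finset.induction_on with
  | empty =>
    ext m
    simp [card_smoothMonics_empty, PowerSeries.coeff_one]
  | insert P S hPS ih =>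
    have hP := hS P (Finset.mem_insert_self _ _)
    rw [Finset.prod_insert hPS, ← mul_assoc]
    refine Eq.trans ?_ (ih fun Q hQ => hS Q (Finset.mem_insert_of_mem hQ))
    congr 1
    ext m
    rw [mul_sub, mul_one, map_sub, PowerSeries.coeff_mul_X_pow', PowerSeries.coeff_mk,
      PowerSeries.coeff_mk, card_smoothMonics_insert hP.1 hP.2 hPS m]
    split_ifs with h <;> simp

theorem card_primesLE_filter_le (d n : ℕ) :
    ((primesLE K d).filter fun P => P.natDegree = n).card ≤ Nat.card K ^ n := by
  rw [← card_monics K n]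
  refine Finset.card_le_card fun P hP => ?_
  simp only [Finset.mem_filter, mem_primesLE] at hP
  exact mem_monics.2 ⟨hP.1.1, hP.2⟩

/-- For `n ≥ 2` no multiple of `X` is irreducible. Discarding these multiples is what makes the sum
in `sum_primesLE_inv_sq_le` telescope. -/
theorem card_primesLE_filter_le_sub (d n : ℕ) (hn : 2 ≤ n) :
    ((primesLE K d).filter fun P => P.natDegree = n).card + Nat.card K ^ (n - 1) ≤
      Nat.card K ^ n := by
  classical
  rw [← card_monics K n, ← card_monics K (n - 1),
    ← Finset.card_image_of_injective (monics K (n - 1)) (mul_right_injective₀ (X_ne_zero (R := K))),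
    ← Finset.card_union_of_disjoint]
  · refine Finset.card_le_card fun P hP => ?_
    simp only [Finset.mem_union, Finset.mem_filter, mem_primesLE, Finset.mem_image, mem_monics] at hP
    rw [mem_monics]
    rcases hP with hP | ⟨g, hg, rfl⟩
    · exact ⟨hP.1.1, hP.2⟩
    · refine ⟨monic_X.mul hg.1, ?_⟩
      rw [monic_X.natDegree_mul hg.1, natDegree_X, hg.2]; omega
  · rw [Finset.disjoint_left]
    intro P hP hP'
    simp only [Finset.mem_filter, mem_primesLE, Finset.mem_image, mem_monics] at hP hP'
    obtain ⟨g, hg, rfl⟩ := hP'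
    rcases hP.1.2.1.isUnit_or_isUnit rfl with h | h
    · exact not_isUnit_X h
    · have := natDegree_eq_zero_of_isUnit h
      omega

/-- A sum over monic irreducible polynomials that depends only on degrees. -/
theorem sum_primesLE_eq (d : ℕ) (f : ℕ → ℝ) :
    ∑ P ∈ primesLE K d, f P.natDegree = ∑ n ∈ Finset.Icc 1 d,
      (((primesLE K d).filter fun P => P.natDegree = n).card : ℝ) * f n := by
  rw [← Finset.sum_fiberwise_of_maps_to (g := fun P : K[X] => P.natDegree) (t := Finset.Icc 1 d)]
  · refine Finset.sum_congr rfl fun n _ => ?_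
    rw [Finset.sum_congr rfl fun P hP => by rw [(Finset.mem_filter.1 hP).2], Finset.sum_const,
      nsmul_eq_mul]
  · intro P hP
    rw [mem_primesLE] at hP
    exact Finset.mem_Icc.2 ⟨hP.2.1.natDegree_pos, hP.2.2⟩

theorem card_monics_filter_dvd_le (m : ℕ) {D : K[X]} (hD : D.Monic) [DecidablePred (D ∣ ·)] :
    (((monics K m).filter (D ∣ ·)).card : ℝ) ≤ (Nat.card K : ℝ) ^ m / (Nat.card K : ℝ) ^ D.natDegree := by
  classical
  have hq : (0 : ℝ) < Nat.card K := by exact_mod_cast Nat.card_pos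
  rw [le_div_iff₀ (by positivity)]
  by_cases h : D.natDegree ≤ m
  · have : ((monics K m).filter (D ∣ ·)).card ≤ (monics K (m - D.natDegree)).card := by
      refine Finset.card_le_card_of_surjOn (fun f => D * f) fun f hf => ?_
      simp only [Finset.coe_filter, Set.mem_ofPred_eq, mem_monics] at hf
      obtain ⟨⟨h1, h2⟩, g, rfl⟩ := hf
      have hg : g.Monic := hD.of_mul_monic_left h1
      refine ⟨g, ?_, rfl⟩
      rw [Finset.mem_coe, mem_monics]
      rw [hD.natDegree_mul hg] at h2
      exact ⟨hg, by omega⟩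
    rw [card_monics] at this
    calc _ ≤ ((Nat.card K ^ (m - D.natDegree) : ℕ) : ℝ) * (Nat.card K : ℝ) ^ D.natDegree := by
          gcongr
      _ = _ := by push_cast; rw [← pow_add, Nat.sub_add_cancel h]
  · rw [Finset.filter_false_of_mem]
    · simp
    · intro f hf hDf
      rw [mem_monics] at hf
      exact h (hf.2 ▸ natDegree_le_of_dvd hDf hf.1.ne_zero)

end Counting

/-! ### A submultiplicative norm on complex polynomials. -/

section WeightedNorm

/-- The weighted `ℓ¹` norm `∑ ‖p_k‖ ρ ^ k` of a complex polynomial. -/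
noncomputable def wnorm (ρ : ℝ) (p : ℂ[X]) : ℝ := p.sum fun k a => ‖a‖ * ρ ^ k

theorem wnorm_eq_sum_range (ρ : ℝ) (p : ℂ[X]) {L : ℕ} (hL : p.natDegree < L) :
    wnorm ρ p = ∑ k ∈ Finset.range L, ‖p.coeff k‖ * ρ ^ k :=
  Polynomial.sum_over_range' p (fun n => by simp) L hL

theorem wnorm_nonneg {ρ : ℝ} (hρ : 0 ≤ ρ) (p : ℂ[X]) : 0 ≤ wnorm ρ p :=
  Finset.sum_nonneg fun _ _ => by positivity

theorem wnorm_add_le {ρ : ℝ} (hρ : 0 ≤ ρ) (p s : ℂ[X]) :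
    wnorm ρ (p + s) ≤ wnorm ρ p + wnorm ρ s := by
  have h1 : (p + s).natDegree < p.natDegree + s.natDegree + 1 :=
    Nat.lt_succ_of_le ((natDegree_add_le p s).trans (by omega))
  rw [wnorm_eq_sum_range ρ _ h1, wnorm_eq_sum_range ρ p (L := p.natDegree + s.natDegree + 1) (by omega),
    wnorm_eq_sum_range ρ s (L := p.natDegree + s.natDegree + 1) (by omega), ← Finset.sum_add_distrib]
  refine Finset.sum_le_sum fun k _ => ?_
  rw [coeff_add, ← add_mul]
  gcongr
  exact norm_add_le _ _

theorem wnorm_C_mul_X_pow (ρ : ℝ) (a : ℂ) (n : ℕ) : wnorm ρ (C a * X ^ n) = ‖a‖ * ρ ^ n := by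
  rw [wnorm, C_mul_X_pow_eq_monomial, sum_monomial_index]
  simp

theorem wnorm_one (ρ : ℝ) : wnorm ρ 1 = 1 := by
  simpa using wnorm_C_mul_X_pow ρ 1 0

theorem wnorm_zero (ρ : ℝ) : wnorm ρ 0 = 0 := by simp [wnorm]

theorem wnorm_sum_le {ρ : ℝ} (hρ : 0 ≤ ρ) {ι : Type*} (s : Finset ι) (p : ι → ℂ[X]) :
    wnorm ρ (∑ i ∈ s, p i) ≤ ∑ i ∈ s, wnorm ρ (p i) :=
  Finset.le_sum_of_subadditive (wnorm ρ) (wnorm_zero ρ).le (wnorm_add_le hρ) s p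

theorem wnorm_monomial_mul (ρ : ℝ) (a : ℂ) (n : ℕ) (p : ℂ[X]) :
    wnorm ρ (C a * X ^ n * p) = ‖a‖ * ρ ^ n * wnorm ρ p := by
  have h : (C a * X ^ n * p).natDegree < n + (p.natDegree + 1) :=
    Nat.lt_of_le_of_lt (natDegree_mul_le.trans (add_le_add_left (natDegree_C_mul_X_pow_le a n) _))
      (by omega)
  rw [wnorm_eq_sum_range ρ _ h, wnorm_eq_sum_range ρ p (Nat.lt_succ_self _), Finset.sum_range_add,
    Finset.mul_sum, Finset.sum_eq_zero, zero_add]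
  · refine Finset.sum_congr rfl fun k _ => ?_
    rw [mul_assoc, coeff_C_mul, coeff_X_pow_mul', if_pos (by omega), Nat.add_sub_cancel_left, norm_mul,
      pow_add]
    ring
  · intro k hk
    rw [mul_assoc, coeff_C_mul, coeff_X_pow_mul', if_neg (by simpa using hk)]
    simp

theorem wnorm_mul_le {ρ : ℝ} (hρ : 0 ≤ ρ) (p s : ℂ[X]) :
    wnorm ρ (p * s) ≤ wnorm ρ p * wnorm ρ s := by
  conv_lhs => rw [p.as_sum_range_C_mul_X_pow, Finset.sum_mul]
  refine (wnorm_sum_le hρ _ _).trans (le_of_eq ?_)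
  simp only [wnorm_monomial_mul]
  rw [← Finset.sum_mul, ← wnorm_eq_sum_range ρ p (Nat.lt_succ_self _)]

theorem wnorm_prod_le {ρ : ℝ} (hρ : 0 ≤ ρ) {ι : Type*} (s : Finset ι) (p : ι → ℂ[X]) :
    wnorm ρ (∏ i ∈ s, p i) ≤ ∏ i ∈ s, wnorm ρ (p i) := by
  classical
  induction s using Finset.induction_on with
  | empty => simp [wnorm_one]
  | insert a s ha ih =>
    rw [Finset.prod_insert ha, Finset.prod_insert ha]
    exact (wnorm_mul_le hρ _ _).trans (mul_le_mul_of_nonneg_left ih (wnorm_nonneg hρ _))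

theorem wnorm_expand_le {ρ : ℝ} (hρ : 0 ≤ ρ) (n : ℕ) (p : ℂ[X]) :
    wnorm ρ (expand ℂ n p) ≤ wnorm (ρ ^ n) p := by
  conv_lhs => rw [p.as_sum_range_C_mul_X_pow, map_sum]
  refine (wnorm_sum_le hρ _ _).trans (le_of_eq ?_)
  rw [wnorm_eq_sum_range _ p (Nat.lt_succ_self _)]
  refine Finset.sum_congr rfl fun k _ => ?_
  rw [map_mul, map_pow, expand_C, expand_X, ← pow_mul, wnorm_C_mul_X_pow, pow_mul]

theorem sum_range_norm_coeff_le {ρ : ℝ} (hρ : 0 ≤ ρ) (p : ℂ[X]) (L : ℕ) :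
    ∑ k ∈ Finset.range L, ‖p.coeff k‖ * ρ ^ k ≤ wnorm ρ p := by
  rw [wnorm_eq_sum_range ρ p (L := L + p.natDegree + 1) (by omega)]
  refine Finset.sum_le_sum_of_subset_of_nonneg (Finset.range_mono (by omega)) fun _ _ _ => by positivity

/-- Without a linear term every positive exponent that occurs is at least `2`, and `x ^ j ≤ x ^ 2`
for these. -/
theorem wnorm_le_one_add_sq_mul {x : ℝ} (hx : 0 ≤ x) (hx1 : x ≤ 1) (p : ℂ[X])
    (h0 : p.coeff 0 = 1) (h1 : p.coeff 1 = 0) : wnorm x p ≤ 1 + x ^ 2 * wnorm 1 p := by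
  rw [wnorm_eq_sum_range x p (L := p.natDegree + 1 + 1) (by omega),
    wnorm_eq_sum_range 1 p (L := p.natDegree + 1 + 1) (by omega), Finset.sum_range_succ',
    Finset.sum_range_succ', Finset.sum_range_succ' _ (p.natDegree + 1), Finset.sum_range_succ', h0, h1]
  simp only [one_pow, mul_one, norm_one, norm_zero, zero_mul, pow_zero, add_zero]
  rw [add_comm]
  gcongr
  rw [mul_add, Finset.mul_sum]
  refine le_trans (Finset.sum_le_sum fun k _ => ?_) (le_add_of_nonneg_right (by positivity))
  rw [mul_comm]
  refine mul_le_mul_of_nonneg_right (pow_le_pow_of_le_one hx hx1 (by omega)) (norm_nonneg _)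

end WeightedNorm

/-! ### Local Euler factors. -/

section LocalFactors

/-- The factor `1 + ∑ i ∈ U, (ζ ^ i t) ^ n` of the generating function attached to a point of
degree `n`. -/
noncomputable def locFactor (U : Finset ℕ) (ζ : ℂ) (n : ℕ) : ℂ[X] :=
  1 + C (∑ i ∈ U, ζ ^ (i * n)) * X ^ n

/-- The polynomial `(1 + ∑ a_i y) ∏ (1 - a_i y)` with `a_i = ζ ^ (i n)`. -/
noncomputable def regFactor (U : Finset ℕ) (ζ : ℂ) (n : ℕ) : ℂ[X] :=
  (1 + C (∑ i ∈ U, ζ ^ (i * n)) * X) * ∏ i ∈ U, (1 - C (ζ ^ (i * n)) * X)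

theorem coeff_prod_one_sub_C_mul_X (U : Finset ℕ) (a : ℕ → ℂ) :
    (∏ i ∈ U, (1 - C (a i) * X)).coeff 0 = 1 ∧
      (∏ i ∈ U, (1 - C (a i) * X)).coeff 1 = - ∑ i ∈ U, a i := by
  induction U using Finset.induction_on with
  | empty => simp [coeff_one]
  | insert i U hi ih =>
    rw [Finset.prod_insert hi, Finset.sum_insert hi, sub_mul, one_mul, mul_assoc]
    constructor
    · simp [ih.1]
    · rw [coeff_sub, coeff_C_mul, coeff_X_mul, ih.1, ih.2]; ring

/-- The factors `1 - a_i y` cancel the linear term. Local factors of the form `1 + O(y ^ 2)` have a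
product that stays bounded beyond radius `1/q`. -/
theorem coeff_regFactor (U : Finset ℕ) (ζ : ℂ) (n : ℕ) :
    (regFactor U ζ n).coeff 0 = 1 ∧ (regFactor U ζ n).coeff 1 = 0 := by
  obtain ⟨h0, h1⟩ := coeff_prod_one_sub_C_mul_X U fun i => ζ ^ (i * n)
  rw [regFactor, add_mul, one_mul, mul_assoc]
  constructor
  · rw [coeff_add, coeff_C_mul, mul_coeff_zero, coeff_X_zero, h0]; ring
  · rw [coeff_add, coeff_C_mul, coeff_X_mul, h0, h1]; ring

theorem wnorm_regFactor_le (U : Finset ℕ) {ζ : ℂ} (hζ : ‖ζ‖ = 1) (n : ℕ) {x : ℝ} (hx : 0 ≤ x)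
    (hx1 : x ≤ 1) :
    wnorm x (regFactor U ζ n) ≤ 1 + (1 + U.card) * 2 ^ U.card * x ^ 2 := by
  refine (wnorm_le_one_add_sq_mul hx hx1 _ (coeff_regFactor U ζ n).1 (coeff_regFactor U ζ n).2).trans ?_
  rw [mul_comm (x ^ 2)]
  gcongr
  refine (wnorm_mul_le zero_le_one _ _).trans ?_
  gcongr
  · exact wnorm_nonneg zero_le_one _
  · refine (wnorm_add_le zero_le_one _ _).trans ?_
    have h := wnorm_C_mul_X_pow 1 (∑ i ∈ U, ζ ^ (i * n)) 1
    rw [pow_one, one_pow, mul_one] at h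
    rw [wnorm_one, h]
    gcongr
    refine (norm_sum_le _ _).trans ?_
    simp [hζ]
  · refine (wnorm_prod_le zero_le_one _ _).trans ?_
    rw [← Finset.prod_const]
    refine Finset.prod_le_prod (fun _ _ => wnorm_nonneg zero_le_one _) fun i _ => ?_
    have h := wnorm_C_mul_X_pow 1 (-ζ ^ (i * n)) 1
    rw [pow_one, one_pow, mul_one, norm_neg, norm_pow, hζ, one_pow, map_neg, neg_mul] at h
    rw [sub_eq_add_neg]
    refine (wnorm_add_le zero_le_one _ _).trans ?_
    rw [wnorm_one, h]; norm_num

end LocalFactors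

/-! ### The Euler product as a regular factor times twisted zeta functions. -/

section GlobalFactor
variable {ι : Type*} [Fintype ι]

/-- A finite family of points with degrees `δ` that has, up to degree `d`, the zeta function
`1 / (1 - q t)` of the affine line. -/
structure IsLineUpTo (δ : ι → ℕ) (q d : ℕ) : Prop where
  pos : ∀ Q, 1 ≤ δ Q
  le : ∀ Q, δ Q ≤ d
  card_le : ∀ n, (Finset.univ.filter fun Q => δ Q = n).card ≤ q ^ n
  zeta : ∃ A : PowerSeries ℂ, A * ∏ Q, (1 - PowerSeries.X ^ δ Q) = 1 ∧
    ∀ m ≤ d, PowerSeries.coeff m A = (q : ℂ) ^ m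

theorem IsLineUpTo.sum_pow_le {δ : ι → ℕ} {q d : ℕ} (h : IsLineUpTo δ q d) {y : ℝ} (hy : 0 ≤ y) :
    ∑ Q, y ^ δ Q ≤ ∑ n ∈ Finset.Icc 1 d, (q * y) ^ n := by
  classical
  rw [← Finset.sum_fiberwise_of_maps_to (g := δ) (t := Finset.Icc 1 d)
    fun Q _ => Finset.mem_Icc.2 ⟨h.pos Q, h.le Q⟩]
  refine Finset.sum_le_sum fun n _ => ?_
  rw [Finset.sum_congr rfl fun P hP => by rw [(Finset.mem_filter.1 hP).2], Finset.sum_const,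
      nsmul_eq_mul, mul_pow]
  gcongr
  exact_mod_cast h.card_le n

theorem sum_Icc_pow_le {y : ℝ} (hy : 0 ≤ y) (hy1 : y < 1) (d : ℕ) :
    ∑ n ∈ Finset.Icc 1 d, y ^ n ≤ y / (1 - y) := by
  have h1 : 0 < 1 - y := by linarith
  induction d with
  | zero => simp; positivity
  | succ d ih =>
    have : ∀ d, ∑ n ∈ Finset.Icc 1 d, y ^ n = (y - y ^ (d + 1)) / (1 - y) := by
      intro d
      induction d with
      | zero => simp
      | succ d ih =>
        rw [Finset.sum_Icc_succ_top (by omega), ih]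
        field_simp
        ring
    rw [this]
    gcongr
    have := pow_nonneg hy (d + 1 + 1)
    linarith

variable (U : Finset ℕ) (ζ : ℂ) (δ : ι → ℕ)

/-- The generating function of the colorings of the points and of a further point of degree `1`. -/
noncomputable def colorSeries : ℂ[X] := locFactor U ζ 1 * ∏ Q, locFactor U ζ (δ Q)

/-- The quotient of `colorSeries` by the product of the twisted zeta functions. -/
noncomputable def regSeries : ℂ[X] := locFactor U ζ 1 * ∏ Q, expand ℂ (δ Q) (regFactor U ζ (δ Q))

theorem expand_regFactor (n : ℕ) :
    expand ℂ n (regFactor U ζ n) =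
      locFactor U ζ n * ∏ i ∈ U, (1 - C (ζ ^ i) ^ n * X ^ n) := by
  rw [regFactor, locFactor, map_mul, map_add, map_one, map_mul, expand_C, expand_X, map_prod]
  congr 1
  refine Finset.prod_congr rfl fun i _ => ?_
  rw [map_sub, map_one, map_mul, expand_C, expand_X, pow_mul, map_pow]

theorem regSeries_eq :
    regSeries U ζ δ = colorSeries U ζ δ * ∏ i ∈ U, ∏ Q, (1 - C (ζ ^ i) ^ δ Q * X ^ δ Q) := by
  rw [regSeries, colorSeries, Finset.prod_comm, mul_assoc, ← Finset.prod_mul_distrib]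
  simp only [expand_regFactor]

variable {ζ δ}

/-- Rescaling `A` by `ζ ^ i` gives the twisted zeta function, which is inverse to the product of the
factors `1 - (ζ ^ i X) ^ δ Q`. -/
theorem colorSeries_eq_mul {A : PowerSeries ℂ} (hA : A * ∏ Q, (1 - PowerSeries.X ^ δ Q) = 1) :
    (colorSeries U ζ δ : PowerSeries ℂ) =
      (regSeries U ζ δ : PowerSeries ℂ) * ∏ i ∈ U, PowerSeries.rescale (ζ ^ i) A := by
  rw [regSeries_eq, Polynomial.coe_mul, mul_assoc]
  have key : ((∏ i ∈ U, ∏ Q, (1 - C (ζ ^ i) ^ δ Q * X ^ δ Q) : ℂ[X]) : PowerSeries ℂ) *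
      ∏ i ∈ U, PowerSeries.rescale (ζ ^ i) A = 1 := by
    rw [← Polynomial.coeToPowerSeries.ringHom_apply, map_prod, ← Finset.prod_mul_distrib]
    refine Finset.prod_eq_one fun i _ => ?_
    have h := congrArg (PowerSeries.rescale (ζ ^ i)) hA
    rw [map_mul, map_prod, map_one, mul_comm] at h
    rw [← h, map_prod]
    congr 1
    refine Finset.prod_congr rfl fun Q _ => ?_
    rw [map_sub, map_sub, map_one, map_one, map_pow (PowerSeries.rescale _), PowerSeries.rescale_X, mul_pow,
      Polynomial.coeToPowerSeries.ringHom_apply, Polynomial.coe_mul, Polynomial.coe_pow,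
      Polynomial.coe_pow, Polynomial.coe_C, Polynomial.coe_X]
  rw [key, mul_one]

/-- The product of the geometric series of ratios `ζ ^ i`. -/
noncomputable def geomProd (U : Finset ℕ) (ζ : ℂ) : PowerSeries ℂ :=
  ∏ i ∈ U, PowerSeries.mk fun m => (ζ ^ i) ^ m

theorem coeff_mul_congr {R : Type*} [CommSemiring R] {d : ℕ} {f f' g g' : PowerSeries R}
    (hf : ∀ m ≤ d, PowerSeries.coeff m f = PowerSeries.coeff m f')
    (hg : ∀ m ≤ d, PowerSeries.coeff m g = PowerSeries.coeff m g') :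
    ∀ m ≤ d, PowerSeries.coeff m (f * g) = PowerSeries.coeff m (f' * g') := by
  intro m hm
  rw [PowerSeries.coeff_mul, PowerSeries.coeff_mul]
  refine Finset.sum_congr rfl fun p hp => ?_
  have := Finset.HasAntidiagonal.mem_antidiagonal.1 hp
  rw [hf _ (by omega), hg _ (by omega)]

theorem coeff_prod_congr {R α : Type*} [CommSemiring R] {d : ℕ} (s : Finset α)
    {f f' : α → PowerSeries R}
    (hf : ∀ i ∈ s, ∀ m ≤ d, PowerSeries.coeff m (f i) = PowerSeries.coeff m (f' i)) :
    ∀ m ≤ d, PowerSeries.coeff m (∏ i ∈ s, f i) = PowerSeries.coeff m (∏ i ∈ s, f' i) := by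
  classical
  induction s using Finset.induction_on with
  | empty => simp
  | insert a s ha ih =>
    rw [Finset.prod_insert ha, Finset.prod_insert ha]
    exact coeff_mul_congr (hf a (Finset.mem_insert_self _ _))
      (ih fun i hi => hf i (Finset.mem_insert_of_mem hi))

/-- Only coefficients of `A` of index at most `d` enter, so restricting to points of degree at most
`d` costs nothing. Normalizing by `q ^ m` leaves geometric series whose ratios `ζ ^ i` no longer
involve `q`. -/
theorem coeff_colorSeries_div {q d : ℕ} (hq : q ≠ 0) (h : IsLineUpTo δ q d) {m : ℕ} (hm : m ≤ d) :
    (colorSeries U ζ δ).coeff m / (q : ℂ) ^ m = ∑ j ∈ Finset.range (m + 1),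
      (regSeries U ζ δ).coeff j / (q : ℂ) ^ j * PowerSeries.coeff (m - j) (geomProd U ζ) := by
  obtain ⟨A, hA, hAq⟩ := h.zeta
  have hq' : (q : ℂ) ≠ 0 := by exact_mod_cast hq
  have h1 : ∀ l ≤ d, PowerSeries.coeff l (∏ i ∈ U, PowerSeries.rescale (ζ ^ i) A) =
      (q : ℂ) ^ l * PowerSeries.coeff l (geomProd U ζ) := by
    intro l hl
    rw [← PowerSeries.coeff_rescale, geomProd, map_prod (PowerSeries.rescale _)]
    refine coeff_prod_congr U (fun i _ n hn => ?_) l hl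
    rw [PowerSeries.coeff_rescale, PowerSeries.coeff_rescale, PowerSeries.coeff_mk, hAq n hn, mul_comm]
  rw [← Polynomial.coeff_coe, colorSeries_eq_mul U hA, PowerSeries.coeff_mul,
    Finset.Nat.sum_antidiagonal_eq_sum_range_succ_mk, Finset.sum_div]
  refine Finset.sum_congr rfl fun j hj => ?_
  have hj' : j ≤ m := Nat.lt_succ_iff.1 (Finset.mem_range.1 hj)
  dsimp only
  rw [h1 _ (by omega), Polynomial.coeff_coe, ← Nat.add_sub_cancel' hj', pow_add,
    Nat.add_sub_cancel_left]
  field_simp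

/-- A bound for the norm of `regSeries`. -/
noncomputable def regBound (k : ℕ) : ℝ := (1 + k) * Real.exp (3 * ((1 + k) * 2 ^ k))

theorem regBound_pos (k : ℕ) : 0 < regBound k := by unfold regBound; positivity

/-- The radius `ρ = 3/(2q)` lies beyond `1/q`, yet `∑ ρ ^ (2 δ Q)` is bounded because there are at
most `q ^ n` points of degree `n` and `q ρ ^ 2 < 1`. -/
theorem wnorm_regSeries_le {q d : ℕ} (hq : 3 ≤ q) (h : IsLineUpTo δ q d) (hζ : ‖ζ‖ = 1) :
    wnorm (3 / 2 / q) (regSeries U ζ δ) ≤ regBound U.card := by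
  have hq' : (3 : ℝ) ≤ q := by exact_mod_cast hq
  set ρ : ℝ := 3 / 2 / q with hρ
  have hρ0 : 0 ≤ ρ := by positivity
  have hρ1 : ρ ≤ 1 := by rw [hρ, div_le_one (by positivity)]; linarith
  refine (wnorm_mul_le hρ0 _ _).trans ?_
  unfold regBound
  gcongr
  · exact wnorm_nonneg hρ0 _
  · refine (wnorm_add_le hρ0 _ _).trans ?_
    rw [wnorm_one, wnorm_C_mul_X_pow, pow_one]
    gcongr
    have : ‖∑ i ∈ U, ζ ^ (i * 1)‖ ≤ U.card := by
      refine (norm_sum_le _ _).trans ?_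
      simp [hζ]
    exact (mul_le_of_le_one_right (norm_nonneg _) hρ1).trans this
  · refine (wnorm_prod_le hρ0 _ _).trans ?_
    set c : ℝ := (1 + U.card) * 2 ^ U.card
    have hc : 0 ≤ c := by positivity
    calc ∏ Q, wnorm ρ (expand ℂ (δ Q) (regFactor U ζ (δ Q)))
        ≤ ∏ Q, Real.exp (c * (ρ ^ 2) ^ δ Q) := by
          refine Finset.prod_le_prod (fun _ _ => wnorm_nonneg hρ0 _) fun Q _ => ?_
          refine (wnorm_expand_le hρ0 _ _).trans ((wnorm_regFactor_le U hζ _ (by positivity)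
            (pow_le_one₀ hρ0 hρ1)).trans ?_)
          rw [← pow_mul, mul_comm (δ Q), pow_mul, add_comm]
          exact Real.add_one_le_exp _
      _ = Real.exp (c * ∑ Q, (ρ ^ 2) ^ δ Q) := by rw [Finset.mul_sum, Real.exp_sum]
      _ ≤ Real.exp (3 * c) := by
          rw [Real.exp_le_exp, mul_comm]
          refine mul_le_mul_of_nonneg_right ?_ hc
          refine (h.sum_pow_le (by positivity)).trans ?_
          -- Here `q ρ ^ 2 = 9/(4q)` and `q ≥ 3`. The geometric series of ratio `3/4` sums to `3`,
          -- which is the `3` in `regBound`.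
          have h34 : q * ρ ^ 2 ≤ 3 / 4 := by
            rw [hρ, div_pow, sq (q : ℝ), mul_div_assoc', div_le_div_iff₀ (by positivity) (by positivity)]
            nlinarith
          have h0 : (0 : ℝ) ≤ q * ρ ^ 2 := by positivity
          refine (sum_Icc_pow_le h0 (by linarith) d).trans ?_
          rw [div_le_iff₀ (by linarith)]
          linarith

/-- The room between `1/q` and `3/(2q)` pays for the weight `j + 1`, by Bernoulli's inequality. That
weight absorbs the shift from `m` to `m - j` in `abs_factorial_mul_choose_sub_pow_le`. -/
theorem sum_norm_coeff_regSeries_le {q d : ℕ} (hq : 3 ≤ q) (h : IsLineUpTo δ q d) (hζ : ‖ζ‖ = 1)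
    (L : ℕ) : ∑ j ∈ Finset.range L, ‖(regSeries U ζ δ).coeff j / (q : ℂ) ^ j‖ * (j + 1) ≤
      2 * regBound U.card := by
  have hq' : (0 : ℝ) < q := by exact_mod_cast (by omega : 0 < q)
  refine le_trans ?_ (mul_le_mul_of_nonneg_left ((sum_range_norm_coeff_le (by positivity) _ L).trans
    (wnorm_regSeries_le U hq h hζ)) zero_le_two)
  rw [Finset.mul_sum]
  refine Finset.sum_le_sum fun j _ => ?_
  rw [norm_div, norm_pow, Complex.norm_natCast, div_pow]
  have hb := one_add_mul_le_pow (a := (1 / 2 : ℝ)) (by norm_num) j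
  norm_num at hb
  have : (j : ℝ) + 1 ≤ 2 * (3 / 2) ^ j := by linarith
  calc _ ≤ ‖(regSeries U ζ δ).coeff j‖ / (q : ℝ) ^ j * (2 * (3 / 2) ^ j) := by gcongr
    _ = _ := by ring

end GlobalFactor

/-! ### Coefficients of products of geometric series. -/

section GeometricProducts

theorem coeff_geomProd_one (U : Finset ℕ) {k : ℕ} (hU : U.card = k + 1) (m : ℕ) :
    PowerSeries.coeff m (geomProd U 1) = ((k + m).choose k : ℂ) := by
  have h : geomProd U 1 = PowerSeries.mk 1 ^ (k + 1) := by
    rw [geomProd, ← hU, ← Finset.prod_const]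
    refine Finset.prod_congr rfl fun i _ => ?_
    ext m
    simp
  rw [h, PowerSeries.mk_one_pow_eq_mk_choose_add, PowerSeries.coeff_mk]

theorem norm_sum_pow_le_of_pow_eq_one {z : ℂ} {r : ℕ} (hr : 0 < r) (hz : z ^ r = 1) (hz1 : z ≠ 1)
    (L : ℕ) : ‖∑ j ∈ Finset.range L, z ^ j‖ ≤ r := by
  have hn : ‖z‖ = 1 := Complex.norm_eq_one_of_pow_eq_one hz hr.ne'
  have h0 : ∑ j ∈ Finset.range r, z ^ j = 0 := by
    rw [geom_sum_eq hz1, hz, sub_self, zero_div]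
  induction L using Nat.strong_induction_on with
  | _ L ih =>
    rcases le_or_gt r L with h | h
    · obtain ⟨L, rfl⟩ := Nat.exists_eq_add_of_le h
      rw [Finset.sum_range_add, h0, zero_add]
      simp only [pow_add, hz, one_mul]
      exact ih L (by omega)
    · refine (norm_sum_le _ _).trans ?_
      simp only [norm_pow, hn, one_pow, Finset.sum_const, Finset.card_range, nsmul_eq_mul, mul_one]
      exact_mod_cast h.le

/-- Each further geometric series of unimodular ratio sums at most `m + 1` earlier coefficients, so
it costs one factor `m + 1`. -/
theorem norm_coeff_prod_geom_mul_le {ζ : ℂ} (hζ : ‖ζ‖ = 1) {f : PowerSeries ℂ} {c : ℝ} (hc : 0 ≤ c)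
    (hf : ∀ m, ‖PowerSeries.coeff m f‖ ≤ c) (U : Finset ℕ) (m : ℕ) :
    ‖PowerSeries.coeff m ((∏ i ∈ U, PowerSeries.mk fun m => (ζ ^ i) ^ m) * f)‖ ≤
      c * (m + 1) ^ U.card := by
  induction U using Finset.induction_on generalizing m with
  | empty => simpa using hf m
  | insert i U hi ih =>
    rw [Finset.prod_insert hi, mul_assoc, PowerSeries.coeff_mul,
      Finset.Nat.sum_antidiagonal_eq_sum_range_succ_mk]
    refine (norm_sum_le _ _).trans ((Finset.sum_le_card_nsmul _ _ (c * (m + 1) ^ U.card)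
      fun j hj => ?_).trans (le_of_eq ?_))
    · rw [norm_mul, PowerSeries.coeff_mk, norm_pow, norm_pow, hζ, one_pow, one_pow, one_mul]
      refine (ih _).trans ?_
      gcongr
      exact Nat.sub_le _ _
    · rw [Finset.card_range, nsmul_eq_mul, Finset.card_insert_of_notMem hi]
      push_cast
      ring

/-- Two geometric series of distinct ratios multiply to a series with bounded coefficients, since
the sums of powers of a nontrivial `r`-th root of unity are bounded. The exponent is therefore one
less than at `ζ = 1`. -/
theorem norm_coeff_geomProd_le {U : Finset ℕ} {r a b : ℕ} (ha : a ∈ U) (hb : b ∈ U) (hab : a ≠ b)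
    (hr : 0 < r) {ζ : ℂ} (hζ : ζ ^ r = 1) (hne : ζ ^ a ≠ ζ ^ b) (m : ℕ) :
    ‖PowerSeries.coeff m (geomProd U ζ)‖ ≤ r * (m + 1) ^ (U.card - 2) := by
  have hn : ‖ζ‖ = 1 := Complex.norm_eq_one_of_pow_eq_one hζ hr.ne'
  have hζ0 : ζ ≠ 0 := by rintro rfl; simp at hn
  have hb' : b ∈ U.erase a := Finset.mem_erase.2 ⟨hab.symm, hb⟩
  have hcard : ((U.erase a).erase b).card = U.card - 2 := by
    rw [Finset.card_erase_of_mem hb', Finset.card_erase_of_mem ha]; omega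
  rw [geomProd, ← Finset.mul_prod_erase U _ ha, ← Finset.mul_prod_erase _ _ hb', ← mul_assoc, mul_comm,
    ← hcard]
  refine norm_coeff_prod_geom_mul_le hn (Nat.cast_nonneg r) (fun m => ?_) _ m
  rw [PowerSeries.coeff_mul, Finset.Nat.sum_antidiagonal_eq_sum_range_succ_mk]
  have hz : (ζ ^ a / ζ ^ b) ^ r = 1 := by
    rw [div_pow, ← pow_mul, ← pow_mul, mul_comm a, mul_comm b, pow_mul, pow_mul, hζ, one_pow, one_pow,
      div_one]
  have hz1 : ζ ^ a / ζ ^ b ≠ 1 := fun h => hne ((div_eq_one_iff_eq (pow_ne_zero _ hζ0)).1 h)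
  have : ∑ j ∈ Finset.range m.succ, PowerSeries.coeff j (PowerSeries.mk fun m => (ζ ^ a) ^ m) *
      PowerSeries.coeff (m - j) (PowerSeries.mk fun m => (ζ ^ b) ^ m) =
      (ζ ^ b) ^ m * ∑ j ∈ Finset.range (m + 1), (ζ ^ a / ζ ^ b) ^ j := by
    rw [Finset.mul_sum]
    refine Finset.sum_congr rfl fun j hj => ?_
    have hj' : j ≤ m := Nat.lt_succ_iff.1 (Finset.mem_range.1 hj)
    rw [PowerSeries.coeff_mk, PowerSeries.coeff_mk]
    conv_rhs => rw [← Nat.add_sub_cancel' hj', pow_add]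
    rw [div_pow]
    field_simp
  rw [this, norm_mul, norm_pow, norm_pow, hn, one_pow, one_pow, one_mul]
  exact norm_sum_pow_le_of_pow_eq_one hr hz hz1 _

end GeometricProducts

/-! ### Asymptotics of the normalized coefficients, uniform in `q`. -/

section Asymptotics
variable {ι : Type*} [Fintype ι] {δ : ι → ℕ} {q d : ℕ}

theorem norm_coeff_colorSeries_div_le (hq : 3 ≤ q) (h : IsLineUpTo δ q d) {U : Finset ℕ} {r a b : ℕ}
    (ha : a ∈ U) (hb : b ∈ U) (hab : a ≠ b) (hr : 0 < r) {ζ : ℂ} (hζ : ζ ^ r = 1)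
    (hne : ζ ^ a ≠ ζ ^ b) {m : ℕ} (hm : m ≤ d) :
    ‖(colorSeries U ζ δ).coeff m / (q : ℂ) ^ m‖ ≤
      2 * regBound U.card * r * (m + 1) ^ (U.card - 2) := by
  have hn : ‖ζ‖ = 1 := Complex.norm_eq_one_of_pow_eq_one hζ hr.ne'
  rw [coeff_colorSeries_div U (by omega) h hm, mul_assoc]
  refine (norm_sum_le _ _).trans (le_trans ?_ (mul_le_mul_of_nonneg_right
    (sum_norm_coeff_regSeries_le U hq h hn (m + 1)) (by positivity)))
  rw [Finset.sum_mul]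
  refine Finset.sum_le_sum fun j _ => ?_
  rw [norm_mul]
  have h1 : ‖PowerSeries.coeff (m - j) (geomProd U ζ)‖ ≤ r * (m + 1) ^ (U.card - 2) := by
    refine (norm_coeff_geomProd_le ha hb hab hr hζ hne _).trans ?_
    gcongr
    exact Nat.sub_le _ _
  refine mul_le_mul ?_ h1 (norm_nonneg _) (by positivity)
  exact le_mul_of_one_le_right (norm_nonneg _) (by linarith [(Nat.cast_nonneg j : (0 : ℝ) ≤ j)])

/-- For `j ≤ m` the first term is a product of `k` consecutive integers starting at `m - j + 1`. It
lies between `(m - j) ^ k` and `(m + k) ^ k`, and each of these is close to `m ^ k`. For `j > m` one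
uses `m ^ k ≤ j m ^ (k - 1)`. -/
theorem abs_factorial_mul_choose_sub_pow_le {k : ℕ} (hk : 1 ≤ k) (m j : ℕ) :
    |(if j ≤ m then (k.factorial : ℝ) * ((k + (m - j)).choose k : ℝ) else 0) - (m : ℝ) ^ k| ≤
      (k : ℝ) ^ 2 * (k + 1) ^ (k - 1) * (j + 1) * (m + 1) ^ (k - 1) := by
  have hk' : (1 : ℝ) ≤ k := by exact_mod_cast hk
  have hm0 : (0 : ℝ) ≤ m := Nat.cast_nonneg m
  have hj0 : (0 : ℝ) ≤ j := Nat.cast_nonneg j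
  have hkk : (1 : ℝ) ≤ (k + 1) ^ (k - 1) := one_le_pow₀ (by linarith)
  have hlow : (j : ℝ) * k * m ^ (k - 1) ≤
      (k : ℝ) ^ 2 * (k + 1) ^ (k - 1) * (j + 1) * (m + 1) ^ (k - 1) := by
    have h1 : (m : ℝ) ^ (k - 1) ≤ (m + 1) ^ (k - 1) := by gcongr; linarith
    have h2 : (j : ℝ) * k ≤ (k : ℝ) ^ 2 * (k + 1) ^ (k - 1) * (j + 1) := by
      calc (j : ℝ) * k = k * 1 * 1 * j := by ring
        _ ≤ k * k * (k + 1) ^ (k - 1) * (j + 1) := by gcongr; linarith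
        _ = _ := by ring
    gcongr
  split_ifs with hjm
  · have hc : (k.factorial : ℝ) * ((k + (m - j)).choose k : ℝ) = ((m - j + 1).ascFactorial k : ℝ) := by
      rw [Nat.ascFactorial_eq_factorial_mul_choose', Nat.cast_mul]
      congr 3; omega
    rw [hc, abs_le]
    have hl : ((m - j : ℕ) : ℝ) ^ k ≤ ((m - j + 1).ascFactorial k : ℝ) := by
      have := Nat.pow_succ_le_ascFactorial (m - j + 1) k
      calc ((m - j : ℕ) : ℝ) ^ k ≤ ((m - j + 1 : ℕ) : ℝ) ^ k := by gcongr; omega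
        _ ≤ _ := by exact_mod_cast this
    have hu : ((m - j + 1).ascFactorial k : ℝ) ≤ ((m + k : ℕ) : ℝ) ^ k := by
      have := Nat.ascFactorial_le_pow_add (m - j) k
      calc ((m - j + 1).ascFactorial k : ℝ) ≤ ((m - j + k : ℕ) : ℝ) ^ k := by exact_mod_cast this
        _ ≤ _ := by gcongr; omega
    constructor
    · have := abs_pow_sub_pow_le (m : ℝ) ((m - j : ℕ) : ℝ) k
      have hle : ((m - j : ℕ) : ℝ) ≤ m := by exact_mod_cast Nat.sub_le m j
      rw [abs_of_nonneg hm0, abs_of_nonneg (a := ((m - j : ℕ) : ℝ)) (Nat.cast_nonneg _),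
        max_eq_left hle, Nat.cast_sub hjm, sub_sub_cancel, abs_of_nonneg hj0, ← Nat.cast_sub hjm] at this
      linarith [le_abs_self ((m : ℝ) ^ k - ((m - j : ℕ) : ℝ) ^ k)]
    · have := abs_pow_sub_pow_le ((m + k : ℕ) : ℝ) (m : ℝ) k
      have hle : (m : ℝ) ≤ ((m + k : ℕ) : ℝ) := by exact_mod_cast Nat.le_add_right m k
      rw [abs_of_nonneg hm0, abs_of_nonneg (a := ((m + k : ℕ) : ℝ)) (Nat.cast_nonneg _),
        max_eq_left hle] at this
      have h3 : |((m + k : ℕ) : ℝ) - m| = k := by push_cast; rw [add_sub_cancel_left, abs_of_nonneg (by linarith)]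
      rw [h3] at this
      have h4 : ((m + k : ℕ) : ℝ) ^ (k - 1) ≤ (k + 1) ^ (k - 1) * (m + 1) ^ (k - 1) := by
        rw [← mul_pow]
        gcongr
        push_cast
        nlinarith
      have h5 : (k : ℝ) * k * ((m + k : ℕ) : ℝ) ^ (k - 1) ≤
          k * k * ((k + 1) ^ (k - 1) * (m + 1) ^ (k - 1)) := by gcongr
      have h6 : (k : ℝ) * k * ((k + 1) ^ (k - 1) * (m + 1) ^ (k - 1)) ≤
          (k : ℝ) ^ 2 * (k + 1) ^ (k - 1) * (j + 1) * (m + 1) ^ (k - 1) := by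
        have : 0 ≤ (k : ℝ) * k * ((k + 1) ^ (k - 1) * (m + 1) ^ (k - 1)) := by positivity
        nlinarith
      linarith [le_abs_self (((m + k : ℕ) : ℝ) ^ k - (m : ℝ) ^ k)]
  · rw [zero_sub, abs_neg, abs_of_nonneg (by positivity)]
    refine le_trans ?_ hlow
    have hmj : (m : ℝ) ≤ j := by exact_mod_cast (by omega : m ≤ j)
    obtain ⟨k, rfl⟩ := Nat.exists_eq_add_of_le' hk
    rw [Nat.add_sub_cancel, pow_succ']
    gcongr
    calc (m : ℝ) ≤ j := hmj
      _ ≤ j * ((k + 1 : ℕ) : ℝ) := le_mul_of_one_le_right hj0 hk'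

/-- The constant in the error term of `norm_coeff_colorSeries_one_sub_le`. -/
noncomputable def mainBound (k : ℕ) : ℝ := (k : ℝ) ^ 2 * (k + 1) ^ (k - 1) * (2 * regBound (k + 1))

theorem norm_coeff_colorSeries_one_sub_le (hq : 3 ≤ q) (h : IsLineUpTo δ q d) {U : Finset ℕ} {k : ℕ}
    (hk : 1 ≤ k) (hU : U.card = k + 1) {m : ℕ} (hm : m ≤ d) :
    ‖(k.factorial : ℂ) * ((colorSeries U 1 δ).coeff m / (q : ℂ) ^ m) -
        (regSeries U 1 δ).eval (1 / (q : ℂ)) * (m : ℂ) ^ k‖ ≤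
      mainBound k * (m + 1) ^ (k - 1) := by
  set p := regSeries U 1 δ with hp
  -- `L` exceeds both `m` and the degree of `p`. One range then serves the convolution, extended by
  -- zero through `G`, and the full evaluation at `1/q`.
  set L := m + 1 + (p.natDegree + 1) with hL
  set G : ℕ → ℝ := fun j => if j ≤ m then (k.factorial : ℝ) * ((k + (m - j)).choose k : ℝ) else 0 with hG
  have h1 : (k.factorial : ℂ) * ((colorSeries U 1 δ).coeff m / (q : ℂ) ^ m) =
      ∑ j ∈ Finset.range L, p.coeff j / (q : ℂ) ^ j * (G j : ℂ) := by
    rw [coeff_colorSeries_div U (by omega) h hm, hL, Finset.sum_range_add _ (m + 1),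
      Finset.sum_eq_zero (s := Finset.range (p.natDegree + 1)), add_zero, Finset.mul_sum]
    · refine Finset.sum_congr rfl fun j hj => ?_
      have hj' : j ≤ m := Nat.lt_succ_iff.1 (Finset.mem_range.1 hj)
      rw [coeff_geomProd_one U hU, hG]
      simp only [if_pos hj']
      push_cast
      ring
    · intro j _
      rw [hG]
      simp only [if_neg (show ¬ m + 1 + j ≤ m by omega)]
      simp
  have h2 : p.eval (1 / (q : ℂ)) = ∑ j ∈ Finset.range L, p.coeff j / (q : ℂ) ^ j := by
    rw [Polynomial.eval_eq_sum_range' (n := L) (by omega)]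
    exact Finset.sum_congr rfl fun j _ => by rw [one_div, inv_pow, div_eq_mul_inv]
  rw [h1, h2, Finset.sum_mul, ← Finset.sum_sub_distrib]
  refine (norm_sum_le _ _).trans ?_
  have h3 := sum_norm_coeff_regSeries_le U hq h (ζ := 1) (by simp) L
  rw [hU] at h3
  refine le_trans ?_ (le_trans (mul_le_mul_of_nonneg_left h3
    (show (0 : ℝ) ≤ (k : ℝ) ^ 2 * (k + 1) ^ (k - 1) * (m + 1) ^ (k - 1) by positivity)) (le_of_eq ?_))
  · rw [Finset.mul_sum]
    refine Finset.sum_le_sum fun j _ => ?_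
    rw [← mul_sub, norm_mul, ← hp]
    have h4 : ‖(G j : ℂ) - (m : ℂ) ^ k‖ ≤
        (k : ℝ) ^ 2 * (k + 1) ^ (k - 1) * (j + 1) * (m + 1) ^ (k - 1) := by
      have := abs_factorial_mul_choose_sub_pow_le hk m j
      rw [← Real.norm_eq_abs, ← Complex.norm_real] at this
      push_cast at this
      simpa [hG] using this
    refine (mul_le_mul_of_nonneg_left h4 (norm_nonneg _)).trans (le_of_eq ?_)
    ring
  · rw [mainBound]; ring

theorem one_sub_ge_exp {y s : ℝ} (hy : 0 ≤ y) (hys : y ≤ s) (hs : s < 1) :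
    Real.exp (-(y / (1 - s))) ≤ 1 - y := by
  have h1 : 0 < 1 - y := by linarith
  have h2 : y / (1 - y) ≤ y / (1 - s) := by
    have : 0 < 1 - s := by linarith
    gcongr
  calc Real.exp (-(y / (1 - s))) ≤ Real.exp (-(y / (1 - y))) := by gcongr
    _ = (Real.exp (y / (1 - y)))⁻¹ := Real.exp_neg _
    _ ≤ (y / (1 - y) + 1)⁻¹ := by
        have : 0 ≤ y / (1 - y) := div_nonneg hy h1.le
        gcongr
        exact Real.add_one_le_exp _
    _ = 1 - y := by field_simp; ring

/-- With `x = q ^ (-δ Q)` and `φ = U.card`, Bernoulli gives `(1 + φ x)(1 - x) ^ φ ≥ 1 - φ ^ 2 x ^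
2`. Since `φ x ≤ θ < 1` this is at least an exponential in `-x ^ 2`, and the sum of the `x ^ 2` over
all points is at most `1`. -/
theorem exists_eval_regSeries_one (hq : 3 ≤ q) (h : IsLineUpTo δ q d) {U : Finset ℕ} {θ : ℝ}
    (hθ : θ < 1) (hUq : (U.card : ℝ) ≤ θ * q) :
    ∃ A : ℝ, Real.exp (-((U.card : ℝ) ^ 2 / (1 - θ ^ 2))) ≤ A ∧
      (regSeries U 1 δ).eval (1 / (q : ℂ)) = (A : ℂ) := by
  have hq' : (3 : ℝ) ≤ q := by exact_mod_cast hq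
  have hθ0 : 0 ≤ θ := by
    by_contra! hneg
    have : (0 : ℝ) ≤ U.card := Nat.cast_nonneg _
    nlinarith
  set φ : ℝ := (U.card : ℝ) with hφ
  have hφ0 : 0 ≤ φ := Nat.cast_nonneg _
  have hθ2 : θ ^ 2 < 1 := by nlinarith
  refine ⟨(1 + φ * (1 / q) ^ 1) * ∏ Q, ((1 + φ * (1 / (q : ℝ)) ^ δ Q) *
    (1 - (1 / (q : ℝ)) ^ δ Q) ^ U.card), ?_, ?_⟩
  · have h1 : (1 : ℝ) ≤ 1 + φ * (1 / q) ^ 1 := by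
      have : 0 ≤ φ * (1 / (q : ℝ)) ^ 1 := by positivity
      linarith
    have hx : ∀ Q, (1 / (q : ℝ)) ^ δ Q ≤ 1 / q := fun Q => by
      refine (pow_le_pow_of_le_one (by positivity) ?_ (h.pos Q)).trans (pow_one _).le
      rw [div_le_one (by positivity)]; linarith
    have hφx : ∀ Q, φ * (1 / (q : ℝ)) ^ δ Q ≤ θ := fun Q => by
      calc φ * (1 / (q : ℝ)) ^ δ Q ≤ φ * (1 / q) := by gcongr; exact hx Q
        _ ≤ θ := by rw [mul_one_div, div_le_iff₀ (by positivity)]; exact hUq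
    have h2 : ∀ Q, Real.exp (-(φ ^ 2 * ((1 / (q : ℝ)) ^ 2) ^ δ Q / (1 - θ ^ 2))) ≤
        (1 + φ * (1 / (q : ℝ)) ^ δ Q) * (1 - (1 / (q : ℝ)) ^ δ Q) ^ U.card := fun Q => by
      set x := (1 / (q : ℝ)) ^ δ Q with hxdef
      have hx0 : 0 ≤ x := by positivity
      have hx1 : x ≤ 1 := (hx Q).trans (by rw [div_le_one (by positivity)]; linarith)
      have hb := one_add_mul_le_pow (a := -x) (by linarith) U.card
      rw [← pow_mul, mul_comm 2, pow_mul, ← hxdef]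
      have hsq : φ ^ 2 * x ^ 2 ≤ θ ^ 2 := by
        rw [← mul_pow]; exact pow_le_pow_left₀ (by positivity) (hφx Q) 2
      refine (one_sub_ge_exp (by positivity) hsq hθ2).trans ?_
      calc 1 - φ ^ 2 * x ^ 2 = (1 + φ * x) * (1 + φ * -x) := by ring
        _ ≤ (1 + φ * x) * (1 + -x) ^ U.card := by gcongr
        _ = _ := by rw [← sub_eq_add_neg]
    calc Real.exp (-(φ ^ 2 / (1 - θ ^ 2)))
        ≤ Real.exp (∑ Q, -(φ ^ 2 * ((1 / (q : ℝ)) ^ 2) ^ δ Q / (1 - θ ^ 2))) := by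
          rw [Real.exp_le_exp, Finset.sum_neg_distrib, ← Finset.sum_div, ← Finset.mul_sum, neg_le_neg_iff]
          have hs := h.sum_pow_le (y := (1 / (q : ℝ)) ^ 2) (by positivity)
          have hqq : (q : ℝ) * (1 / (q : ℝ)) ^ 2 = 1 / q := by field_simp
          rw [hqq] at hs
          have hq1 : 1 / (q : ℝ) ≤ 1 / 3 := by gcongr
          have hq0 : 0 ≤ 1 / (q : ℝ) := by positivity
          have hs2 := hs.trans (sum_Icc_pow_le hq0 (by linarith) d)
          have hs3 : 1 / (q : ℝ) / (1 - 1 / q) ≤ 1 := by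
            rw [div_le_one (by linarith)]; linarith
          have hd : 0 < 1 - θ ^ 2 := by linarith
          gcongr
          exact mul_le_of_le_one_right (by positivity) (hs2.trans hs3)
      _ = ∏ Q, Real.exp (-(φ ^ 2 * ((1 / (q : ℝ)) ^ 2) ^ δ Q / (1 - θ ^ 2))) := Real.exp_sum _ _
      _ ≤ ∏ Q, ((1 + φ * (1 / (q : ℝ)) ^ δ Q) * (1 - (1 / (q : ℝ)) ^ δ Q) ^ U.card) :=
          Finset.prod_le_prod (fun _ _ => (Real.exp_pos _).le) fun Q _ => h2 Q
      _ ≤ _ := by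
          refine le_mul_of_one_le_left ?_ h1
          exact Finset.prod_nonneg fun Q _ => (Real.exp_pos _).le.trans (h2 Q)
  · rw [regSeries, eval_mul, Polynomial.eval_prod, locFactor, hφ]
    simp only [expand_eval, regFactor, one_pow]
    push_cast
    simp

end Asymptotics

/-! ### Removing one Euler factor. -/

section Recursion
variable {v w : ℕ → ℂ} {n d : ℕ}

theorem norm_le_of_eq_add_shift {μ : ℂ} {θ : ℝ} {E : ℕ → ℝ} (hn : 1 ≤ n) (hθ : θ < 1) (hμ : ‖μ‖ ≤ θ)
    (hrec : ∀ m ≤ d, v m = w m + if n ≤ m then μ * w (m - n) else 0)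
    (hE : Monotone E) (hE0 : ∀ m, 0 ≤ E m) (hv : ∀ m ≤ d, ‖v m‖ ≤ E m) :
    ∀ m ≤ d, ‖w m‖ ≤ E m / (1 - θ) := by
  have h1 : 0 < 1 - θ := by linarith
  have hθ0 : 0 ≤ θ := (norm_nonneg μ).trans hμ
  intro m
  induction m using Nat.strong_induction_on with
  | _ m ih =>
    intro hm
    rw [le_div_iff₀ h1]
    have hw : w m = v m - if n ≤ m then μ * w (m - n) else 0 := by rw [hrec m hm]; ring
    have h2 : ‖if n ≤ m then μ * w (m - n) else 0‖ ≤ θ * (E m / (1 - θ)) := by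
      split_ifs with h
      · rw [norm_mul]
        refine mul_le_mul hμ ((ih (m - n) (by omega) (by omega)).trans ?_) (norm_nonneg _) hθ0
        gcongr
        exact hE (Nat.sub_le _ _)
      · rw [norm_zero]
        have := hE0 m
        positivity
    have h3 : ‖w m‖ ≤ E m + θ * (E m / (1 - θ)) := by
      rw [hw]
      exact (norm_sub_le _ _).trans (add_le_add (hv m hm) h2)
    calc ‖w m‖ * (1 - θ) ≤ (E m + θ * (E m / (1 - θ))) * (1 - θ) := by gcongr
      _ = E m := by field_simp; ring

/-- This is the expansion of `1 / (1 + μ t ^ n)` acting on the generating function of `v`. -/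
theorem eq_sum_of_eq_add_shift {μ : ℂ} (hn : 1 ≤ n)
    (hrec : ∀ m ≤ d, v m = w m + if n ≤ m then μ * w (m - n) else 0) :
    ∀ m ≤ d, w m = ∑ a ∈ Finset.range (m / n + 1), (-μ) ^ a * v (m - a * n) := by
  intro m
  induction m using Nat.strong_induction_on with
  | _ m ih =>
    intro hm
    rw [Finset.sum_range_succ', pow_zero, one_mul, zero_mul, Nat.sub_zero, hrec m hm]
    split_ifs with h
    · rw [ih (m - n) (by omega) (by omega), Finset.mul_sum, Nat.div_eq_sub_div (by omega) h,
        add_left_comm, ← Finset.sum_add_distrib, Finset.sum_eq_zero, add_zero]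
      intro a _
      rw [show m - (a + 1) * n = m - n - a * n by rw [Nat.sub_sub]; ring_nf]
      ring
    · rw [Nat.div_eq_of_lt (by omega), Finset.sum_range_zero, zero_add, add_zero]

/-- The main term `∑ (-x) ^ a (1 - a n / d) ^ k`. -/
noncomputable def mainSum (x : ℝ) (n d k : ℕ) : ℝ :=
  ∑ a ∈ Finset.range (d / n + 1), (-x) ^ a * (1 - (a : ℝ) * (n : ℝ) / (d : ℝ)) ^ k

theorem sum_range_pow_succ_le {x θ : ℝ} (hx : 0 ≤ x) (hxθ : x ≤ θ) (hθ : θ < 1) (L : ℕ) :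
    ∑ a ∈ Finset.range L, x ^ (a + 1) ≤ x / (1 - θ) := by
  have h1 : 0 < 1 - θ := by linarith
  have h2 : 0 < 1 - x := by linarith
  calc ∑ a ∈ Finset.range L, x ^ (a + 1) = x * ∑ a ∈ Finset.range L, x ^ a := by
        rw [Finset.mul_sum]; exact Finset.sum_congr rfl fun a _ => pow_succ' _ _
    _ ≤ x * (1 / (1 - x)) := by
        gcongr
        rw [geom_sum_eq (by linarith), ← neg_div_neg_eq, neg_sub, neg_sub]
        gcongr
        have := pow_nonneg hx L
        linarith
    _ ≤ x / (1 - θ) := by rw [mul_one_div]; gcongr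

theorem one_sub_div_mem {a : ℕ} (ha : a ∈ Finset.range (d / n + 1)) :
    0 ≤ 1 - (a : ℝ) * (n : ℝ) / (d : ℝ) ∧ 1 - (a : ℝ) * (n : ℝ) / (d : ℝ) ≤ 1 := by
  have h1 : a * n ≤ d :=
    (Nat.mul_le_mul_right n (Nat.lt_succ_iff.1 (Finset.mem_range.1 ha))).trans (Nat.div_mul_le_self d n)
  have h2 : (a : ℝ) * n ≤ d := by exact_mod_cast h1
  have h3 : (a : ℝ) * n / d ≤ 1 := div_le_one_of_le₀ h2 (Nat.cast_nonneg _)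
  have h4 : 0 ≤ (a : ℝ) * n / d := by positivity
  constructor <;> linarith

theorem abs_mainSum_sub_one_le {x θ : ℝ} (hx : 0 ≤ x) (hxθ : x ≤ θ) (hθ : θ < 1) (n d k : ℕ) :
    |mainSum x n d k - 1| ≤ x / (1 - θ) := by
  rw [mainSum, Finset.sum_range_succ']
  simp only [pow_zero, Nat.cast_zero, zero_mul, zero_div, sub_zero, one_pow, one_mul,
    add_sub_cancel_right]
  refine (Finset.abs_sum_le_sum_abs _ _).trans
    (le_trans (Finset.sum_le_sum fun a ha => ?_) (sum_range_pow_succ_le hx hxθ hθ (d / n)))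
  rw [abs_mul, abs_pow, abs_neg, abs_of_nonneg hx, abs_pow]
  have h := one_sub_div_mem (a := a + 1) (n := n) (d := d)
    (by simp only [Finset.mem_range] at ha ⊢; omega)
  exact mul_le_of_le_one_right (by positivity)
    (pow_le_one₀ (abs_nonneg _) (abs_le.2 ⟨by linarith [h.1], h.2⟩))

/-- In the term of index `a`, the main parts `A m ^ k` with `m = d - a n` and `A d ^ k (1 - a n / d)
^ k` are equal and cancel. The term `a = 0` vanishes identically, so the remaining errors sum to a
multiple of `x`. -/
theorem norm_sub_mul_mainSum_le {x θ C : ℝ} {A : ℂ} {k : ℕ} (hn : 1 ≤ n) (hd : 1 ≤ d) (hx : 0 ≤ x)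
    (hxθ : x ≤ θ) (hθ : θ < 1) (hC : 0 ≤ C)
    (hrec : ∀ m ≤ d, v m = w m + if n ≤ m then (x : ℂ) * w (m - n) else 0)
    (hv : ∀ m ≤ d, ‖v m - A * (m : ℂ) ^ k‖ ≤ C * (m + 1) ^ (k - 1)) :
    ‖w d - v d * mainSum x n d k‖ ≤ 2 * C * (d + 1) ^ (k - 1) * (x / (1 - θ)) := by
  have hd0 : (d : ℂ) ≠ 0 := by exact_mod_cast (by omega : d ≠ 0)
  rw [eq_sum_of_eq_add_shift hn hrec d le_rfl, mainSum, Complex.ofReal_sum, Finset.mul_sum,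
    ← Finset.sum_sub_distrib, Finset.sum_range_succ']
  simp only [pow_zero, zero_mul, Nat.sub_zero, one_mul, Nat.cast_zero, zero_div, sub_zero, one_pow,
    Complex.ofReal_one, mul_one, sub_self, add_zero]
  refine (norm_sum_le _ _).trans (le_trans ?_ (mul_le_mul_of_nonneg_left
    (sum_range_pow_succ_le hx hxθ hθ (d / n)) (by positivity)))
  rw [Finset.mul_sum]
  refine Finset.sum_le_sum fun a ha => ?_
  have ha' : a + 1 ∈ Finset.range (d / n + 1) := by simp only [Finset.mem_range] at ha ⊢; omega
  have h := one_sub_div_mem (d := d) (n := n) ha'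
  have had : (a + 1) * n ≤ d :=
    (Nat.mul_le_mul_right n (Nat.lt_succ_iff.1 (Finset.mem_range.1 ha'))).trans (Nat.div_mul_le_self d n)
  set m := d - (a + 1) * n with hm
  set t : ℝ := 1 - ((a + 1 : ℕ) : ℝ) * (n : ℝ) / (d : ℝ) with ht
  have hmt : (m : ℂ) = d * (t : ℂ) := by
    rw [hm, ht]
    push_cast [Nat.cast_sub had]
    field_simp
  have heq : (-(x : ℂ)) ^ (a + 1) * v m - v d * (((-x) ^ (a + 1) * t ^ k : ℝ) : ℂ) =
      (-(x : ℂ)) ^ (a + 1) * ((v m - A * (m : ℂ) ^ k) - (v d - A * (d : ℂ) ^ k) * (t : ℂ) ^ k) := by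
    rw [hmt]; push_cast; ring
  rw [heq, norm_mul, norm_pow, norm_neg, Complex.norm_real, Real.norm_of_nonneg hx, mul_comm]
  gcongr
  refine (norm_sub_le _ _).trans ?_
  rw [norm_mul, norm_pow, Complex.norm_real, Real.norm_of_nonneg h.1]
  have h1 : ‖v m - A * (m : ℂ) ^ k‖ ≤ C * (d + 1) ^ (k - 1) := by
    refine (hv m (Nat.sub_le _ _)).trans ?_
    gcongr
    exact Nat.sub_le _ _
  have h2 := mul_le_of_le_one_right (norm_nonneg (v d - A * (d : ℂ) ^ k)) (pow_le_one₀ (n := k) h.1 h.2)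
  linarith [hv d le_rfl]

end Recursion

/-! ### From coefficient estimates to the ratio of counts. -/

/-- The constant in `abs_div_sub_mainSum_le`. -/
noncomputable def ratioBound (k : ℕ) (θ D A₀ c : ℝ) : ℝ :=
  2 * D / (1 - θ) * (2 ^ k / A₀ + (2 ^ k * D / A₀ + 1) ^ k / c)

/-- For `d ≥ 2 ^ k D / A₀` the main term dominates and gives `N` of order `d ^ k`. Below that
threshold `d` is bounded and `N ≥ c` suffices. -/
theorem mul_pow_le_of_lower_bounds {k d : ℕ} {D A₀ c N : ℝ} (hk : 1 ≤ k) (hd : 1 ≤ d) (hD : 0 ≤ D)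
    (hA : 0 < A₀) (hc : 0 < c) (hN : A₀ * (d : ℝ) ^ k - D * (d + 1) ^ (k - 1) ≤ N) (hcN : c ≤ N) :
    (d : ℝ) * (d + 1) ^ (k - 1) ≤ (2 ^ k / A₀ + (2 ^ k * D / A₀ + 1) ^ k / c) * N := by
  obtain ⟨k, rfl⟩ := Nat.exists_eq_add_of_le' hk
  rw [Nat.add_sub_cancel] at *
  have hd' : (1 : ℝ) ≤ d := by exact_mod_cast hd
  have hN0 : 0 < N := by linarith
  rcases le_or_gt (2 ^ (k + 1) * D / A₀) d with h | h
  · have h1 : 2 ^ (k + 1) * D ≤ d * A₀ := by rwa [div_le_iff₀ hA] at h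
    have h2 : ((d : ℝ) + 1) ^ k ≤ 2 ^ k * (d : ℝ) ^ k := by
      rw [← mul_pow]; gcongr; linarith
    have h3 : A₀ * d * (d + 1) ^ k ≤ 2 ^ (k + 1) * N := by
      have h4 : A₀ * d * (d + 1) ^ k ≤ A₀ * d * (2 ^ k * (d : ℝ) ^ k) := by gcongr
      have h5 : 2 ^ (k + 1) * D * (d + 1) ^ k ≤ d * A₀ * (d + 1) ^ k := by gcongr
      have h6 : (2 : ℝ) ^ (k + 1) * (A₀ * (d : ℝ) ^ (k + 1) - D * (d + 1) ^ k) ≤ 2 ^ (k + 1) * N := by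
        gcongr
      have h7 : (2 : ℝ) ^ (k + 1) * (A₀ * (d : ℝ) ^ (k + 1) - D * (d + 1) ^ k) =
          2 * (A₀ * d * (2 ^ k * (d : ℝ) ^ k)) - 2 ^ (k + 1) * D * (d + 1) ^ k := by ring
      linarith
    calc (d : ℝ) * (d + 1) ^ k = A₀ * d * (d + 1) ^ k / A₀ := by field_simp
      _ ≤ 2 ^ (k + 1) * N / A₀ := by gcongr
      _ = 2 ^ (k + 1) / A₀ * N := by ring
      _ ≤ _ := by
        gcongr
        exact le_add_of_nonneg_right (by positivity)
  · calc (d : ℝ) * (d + 1) ^ k ≤ (d + 1) ^ (k + 1) := by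
          rw [pow_succ']; gcongr; linarith
      _ ≤ (2 ^ (k + 1) * D / A₀ + 1) ^ (k + 1) := by gcongr
      _ ≤ (2 ^ (k + 1) * D / A₀ + 1) ^ (k + 1) / c * N := by
          rw [div_mul_eq_mul_div, le_div_iff₀ hc]; gcongr
      _ ≤ _ := by
        gcongr
        exact le_add_of_nonneg_left (by positivity)

/-- Every `ζ` contributes to `N' - N S` at most a constant times `x d ^ (k - 1)`, while `N` is at
least a constant times `d ^ k`. The bound `c ≤ N` covers the range where the main term does not yet
dominate. -/
theorem abs_div_sub_mainSum_le {Z : Finset ℂ} {v w : ℂ → ℕ → ℂ} {μ : ℂ → ℂ} {n d k : ℕ}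
    {x θ C₁ C₂ A A₀ c N N' : ℝ} (hn : 1 ≤ n) (hd : n ≤ d) (hk : 1 ≤ k) (hx : 0 ≤ x) (hxθ : x ≤ θ)
    (hθ : θ < 1) (hC₁ : 0 ≤ C₁) (hC₂ : 0 ≤ C₂) (hA₀ : 0 < A₀) (hA : A₀ ≤ A) (hc : 0 < c)
    (hZ : (1 : ℂ) ∈ Z)
    (hrec : ∀ ζ ∈ Z, ∀ m ≤ d, v ζ m = w ζ m + if n ≤ m then μ ζ * w ζ (m - n) else 0)
    (hμ : ∀ ζ ∈ Z, ‖μ ζ‖ ≤ x) (hμ1 : μ 1 = x)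
    (hsq : ∀ ζ ∈ Z, ζ ^ 2 = 1 → v ζ d = v 1 d ∧ w ζ d = w 1 d)
    (hsmall : ∀ ζ ∈ Z, ζ ^ 2 ≠ 1 → ∀ m ≤ d, ‖v ζ m‖ ≤ C₁ * (m + 1) ^ (k - 1))
    (hmain : ∀ m ≤ d, ‖v 1 m - (A : ℂ) * (m : ℂ) ^ k‖ ≤ C₂ * (m + 1) ^ (k - 1))
    (hN : (N : ℂ) = ∑ ζ ∈ Z, v ζ d) (hN' : (N' : ℂ) = ∑ ζ ∈ Z, w ζ d) (hcN : c ≤ N) :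
    |N' / N - mainSum x n d k| ≤ ratioBound k θ (Z.card * (C₁ + C₂)) A₀ c * x / d := by
  classical
  have hd1 : 1 ≤ d := hn.trans hd
  have h1θ : 0 < 1 - θ := by linarith
  set S := mainSum x n d k with hS
  set D : ℝ := Z.card * (C₁ + C₂) with hD
  have hD0 : 0 ≤ D := by positivity
  have hN0 : 0 < N := hc.trans_le hcN
  set T : ℝ := (d + 1) ^ (k - 1) with hT
  have hT0 : 0 ≤ T := by positivity
  have hdiff : ∀ ζ ∈ Z, ‖w ζ d - v ζ d * S‖ ≤ 2 * (C₁ + C₂) * T * (x / (1 - θ)) := by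
    intro ζ hζ
    have hx1 : 0 ≤ x / (1 - θ) := by positivity
    by_cases h : ζ ^ 2 = 1
    · rw [(hsq ζ hζ h).1, (hsq ζ hζ h).2]
      have hrec1 := hrec 1 hZ
      rw [hμ1] at hrec1
      refine (norm_sub_mul_mainSum_le hn hd1 hx hxθ hθ hC₂ hrec1 hmain).trans ?_
      gcongr
      linarith
    · have hv := hsmall ζ hζ h
      have hw := norm_le_of_eq_add_shift (E := fun m : ℕ => C₁ * ((m : ℝ) + 1) ^ (k - 1)) hn hθ
        ((hμ ζ hζ).trans hxθ) (hrec ζ hζ) (fun a b hab => by dsimp only; gcongr)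
        (fun m => by positivity) hv (d - n) (Nat.sub_le _ _)
      have hr := hrec ζ hζ d le_rfl
      rw [if_pos hd] at hr
      -- When `ζ ^ 2 ≠ 1` the coefficients are already small and only a factor `x` is wanted. The
      -- first summand gets it from `μ`, the second from `S - 1`.
      have heq : w ζ d - v ζ d * S = -(μ ζ * w ζ (d - n)) - v ζ d * ((S - 1 : ℝ) : ℂ) := by
        push_cast; rw [hr]; ring
      have h2 : ‖w ζ (d - n)‖ ≤ C₁ * T / (1 - θ) := by
        refine hw.trans ?_
        rw [hT]
        gcongr
        exact Nat.sub_le _ _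
      have h3 : ‖((S - 1 : ℝ) : ℂ)‖ ≤ x / (1 - θ) := by
        rw [Complex.norm_real]; exact abs_mainSum_sub_one_le hx hxθ hθ n d k
      rw [heq]
      refine (norm_sub_le _ _).trans ?_
      rw [norm_neg, norm_mul, norm_mul]
      calc _ ≤ x * (C₁ * T / (1 - θ)) + C₁ * T * (x / (1 - θ)) :=
            add_le_add (mul_le_mul (hμ ζ hζ) h2 (norm_nonneg _) hx)
              (mul_le_mul (hv d le_rfl) h3 (norm_nonneg _) (by positivity))
        _ = 2 * C₁ * T * (x / (1 - θ)) := by ring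
        _ ≤ _ := by gcongr; linarith
  have hnum : |N' - N * S| ≤ 2 * D * T * (x / (1 - θ)) := by
    rw [← Real.norm_eq_abs, ← Complex.norm_real]
    push_cast
    rw [hN, hN', Finset.sum_mul, ← Finset.sum_sub_distrib]
    refine (norm_sum_le _ _).trans ((Finset.sum_le_card_nsmul _ _ _ hdiff).trans (le_of_eq ?_))
    rw [nsmul_eq_mul, hD]; ring
  -- Each `ζ` with `ζ ^ 2 = 1` contributes the same positive main term. There is at least one,
  -- namely `1`.
  have hlow : A₀ * (d : ℝ) ^ k - D * T ≤ N := by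
    have h1 : ∀ ζ ∈ Z, ‖v ζ d - if ζ ^ 2 = 1 then (A : ℂ) * (d : ℂ) ^ k else 0‖ ≤ (C₁ + C₂) * T := by
      intro ζ hζ
      split_ifs with h
      · rw [(hsq ζ hζ h).1]
        exact (hmain d le_rfl).trans (by gcongr; linarith)
      · rw [sub_zero]
        exact (hsmall ζ hζ h d le_rfl).trans (by gcongr; linarith)
    have h2 : ‖((N - (Z.filter fun ζ => ζ ^ 2 = 1).card * (A * (d : ℝ) ^ k) : ℝ) : ℂ)‖ ≤ D * T := by
      push_cast
      rw [hN]
      have : ((Z.filter fun ζ => ζ ^ 2 = 1).card : ℂ) * (A * (d : ℂ) ^ k) =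
          ∑ ζ ∈ Z, if ζ ^ 2 = 1 then (A : ℂ) * (d : ℂ) ^ k else 0 := by
        rw [← Finset.sum_filter, Finset.sum_const, nsmul_eq_mul]
      rw [this, ← Finset.sum_sub_distrib]
      refine (norm_sum_le _ _).trans ((Finset.sum_le_card_nsmul _ _ _ h1).trans (le_of_eq ?_))
      rw [nsmul_eq_mul, hD]; ring
    rw [Complex.norm_real] at h2
    have h3 := (abs_le.1 h2).1
    have h4 : (1 : ℝ) ≤ (Z.filter fun ζ => ζ ^ 2 = 1).card := by
      have : 0 < (Z.filter fun ζ => ζ ^ 2 = 1).card :=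
        Finset.card_pos.2 ⟨1, Finset.mem_filter.2 ⟨hZ, one_pow 2⟩⟩
      exact_mod_cast this
    have h5 : A₀ * (d : ℝ) ^ k ≤ (Z.filter fun ζ => ζ ^ 2 = 1).card * (A * (d : ℝ) ^ k) := by
      calc A₀ * (d : ℝ) ^ k ≤ A * (d : ℝ) ^ k := by gcongr
        _ ≤ _ := le_mul_of_one_le_left (mul_nonneg (hA₀.le.trans hA) (by positivity)) h4
    linarith
  have hkey := mul_pow_le_of_lower_bounds hk hd1 hD0 hA₀ hc hlow hcN
  have hd0 : (0 : ℝ) < d := by exact_mod_cast hd1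
  rw [show N' / N - S = (N' - N * S) / N by field_simp, abs_div, abs_of_pos hN0,
    div_le_div_iff₀ hN0 hd0, ratioBound]
  calc |N' - N * S| * d ≤ 2 * D * T * (x / (1 - θ)) * d := by gcongr
    _ = 2 * D / (1 - θ) * x * (d * T) := by ring
    _ ≤ 2 * D / (1 - θ) * x * ((2 ^ k / A₀ + (2 ^ k * D / A₀ + 1) ^ k / c) * N) := by gcongr
    _ = _ := by ring

/-! ### Colorings and the filter by roots of unity. -/

section Colorings
variable {ι : Type*} [Fintype ι]

/-- The total degree of the points that receive a nonzero color. -/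
def colorDeg (δ : ι → ℕ) (c : ι → ℕ) : ℕ := ∑ Q, if c Q = 0 then 0 else δ Q

/-- The sum of the degrees of the points, weighted by their colors. -/
def colorWt (δ : ι → ℕ) (c : ι → ℕ) : ℕ := ∑ Q, c Q * δ Q

theorem coeff_prod_sum_colors [DecidableEq ι] (δ : ι → ℕ) (t : ι → Finset ℕ) (ζ : ℂ) (d : ℕ) :
    (∏ Q, ∑ k ∈ t Q, C (ζ ^ (k * δ Q)) * X ^ (if k = 0 then 0 else δ Q) : ℂ[X]).coeff d =
      ∑ c ∈ (Fintype.piFinset t).filter (fun c => colorDeg δ c = d), ζ ^ colorWt δ c := by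
  rw [Finset.prod_univ_sum, Polynomial.finsetSum_coeff, Finset.sum_filter]
  refine Finset.sum_congr rfl fun c _ => ?_
  rw [Finset.prod_mul_distrib, Finset.prod_pow_eq_pow_sum, ← map_prod, Finset.prod_pow_eq_pow_sum,
    coeff_C_mul_X_pow]
  simp only [colorDeg, colorWt, eq_comm]

theorem sum_colors_eq_locFactor {U : Finset ℕ} (hU : 0 ∉ U) (ζ : ℂ) (n : ℕ) :
    (∑ k ∈ insert 0 U, C (ζ ^ (k * n)) * X ^ (if k = 0 then 0 else n) : ℂ[X]) = locFactor U ζ n := by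
  rw [Finset.sum_insert hU, locFactor, map_sum, Finset.sum_mul]
  congr 1
  · simp
  · refine Finset.sum_congr rfl fun k hk => ?_
    rw [if_neg (by rintro rfl; exact hU hk)]

theorem sum_nthRootsFinset_pow {r : ℕ} (hr : 0 < r) (w : ℕ) :
    ∑ ζ ∈ nthRootsFinset r (1 : ℂ), ζ ^ w = if r ∣ w then (r : ℂ) else 0 := by
  have hω := Complex.isPrimitiveRoot_exp r hr.ne'
  set ω := Complex.exp (2 * Real.pi * Complex.I / r)
  have himg : nthRootsFinset r (1 : ℂ) = (Finset.range r).image (ω ^ ·) := by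
    symm
    refine Finset.eq_of_subset_of_card_le ?_ ?_
    · intro z hz
      obtain ⟨j, -, rfl⟩ := Finset.mem_image.1 hz
      rw [mem_nthRootsFinset hr, ← pow_mul, mul_comm, pow_mul, hω.pow_eq_one, one_pow]
    · rw [hω.card_nthRootsFinset, Finset.card_image_of_injOn, Finset.card_range]
      intro a ha b hb hab
      exact hω.pow_inj (Finset.mem_range.1 ha) (Finset.mem_range.1 hb) hab
  rw [himg, Finset.sum_image fun a ha b hb hab =>
    hω.pow_inj (Finset.mem_range.1 ha) (Finset.mem_range.1 hb) hab]
  simp only [← pow_mul, mul_comm _ w]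
  simp only [pow_mul]
  split_ifs with h
  · rw [(hω.pow_eq_one_iff_dvd w).2 h]; simp
  · rw [geom_sum_eq (fun h1 => h ((hω.pow_eq_one_iff_dvd w).1 h1)), ← pow_mul, mul_comm w, pow_mul,
      hω.pow_eq_one, one_pow, sub_self, zero_div]

/-- The sum of `ζ ^ w` over the `r`-th roots of unity detects `r ∣ w`, applied to the weight of each
coloring. -/
theorem card_filter_colors [DecidableEq ι] (δ : ι → ℕ) (t : ι → Finset ℕ) {r : ℕ} (hr : 0 < r) (d : ℕ) :
    (r : ℂ) * (((Fintype.piFinset t).filter fun c => colorDeg δ c = d ∧ r ∣ colorWt δ c).card : ℂ) =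
      ∑ ζ ∈ nthRootsFinset r (1 : ℂ),
        (∏ Q, ∑ k ∈ t Q, C (ζ ^ (k * δ Q)) * X ^ (if k = 0 then 0 else δ Q) : ℂ[X]).coeff d := by
  simp only [coeff_prod_sum_colors]
  rw [Finset.sum_comm]
  simp only [sum_nthRootsFinset_pow hr]
  rw [← Finset.sum_filter, Finset.filter_filter, Finset.sum_const, nsmul_eq_mul, mul_comm]

/-- If every nonzero color acts on `ζ` as the exponent `1`, then `ζ` to the weight of a coloring
equals `ζ` to its total degree, that is `ζ ^ d = 1`. -/
theorem coeff_prod_sum_colors_of_sq_eq_one [DecidableEq ι] (δ : ι → ℕ) {t : ι → Finset ℕ} {ζ : ℂ}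
    {d : ℕ} (ht : ∀ Q, ∀ k ∈ t Q, k ≠ 0 → ζ ^ k = ζ) (hd : ζ ^ d = 1) :
    (∏ Q, ∑ k ∈ t Q, C (ζ ^ (k * δ Q)) * X ^ (if k = 0 then 0 else δ Q) : ℂ[X]).coeff d =
      (∏ Q, ∑ k ∈ t Q, C ((1 : ℂ) ^ (k * δ Q)) * X ^ (if k = 0 then 0 else δ Q) : ℂ[X]).coeff d := by
  rw [coeff_prod_sum_colors, coeff_prod_sum_colors]
  refine Finset.sum_congr rfl fun c hc => ?_
  obtain ⟨hc, hcd⟩ := Finset.mem_filter.1 hc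
  rw [Fintype.mem_piFinset] at hc
  rw [one_pow, ← hd, ← hcd, colorWt, colorDeg, ← Finset.prod_pow_eq_pow_sum,
    ← Finset.prod_pow_eq_pow_sum]
  refine Finset.prod_congr rfl fun Q _ => ?_
  split_ifs with h
  · rw [h, zero_mul]
  · rw [pow_mul, ht Q _ (hc Q) h]

/-- The degrees of the points of `ι` and of a further point of degree `1`. -/
def withInfty (δ : ι → ℕ) : Option ι → ℕ := fun Q => Q.elim 1 δ

/-- The colorings of total degree `d` and weight divisible by `r`, with colors in `insert 0 U`. -/
def thinColorings [DecidableEq ι] (U : Finset ℕ) (δ : ι → ℕ) (r d : ℕ) : Finset (Option ι → ℕ) :=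
  (Fintype.piFinset fun _ : Option ι => insert 0 U).filter
    fun c => colorDeg (withInfty δ) c = d ∧ r ∣ colorWt (withInfty δ) c

/-- The generating function of the colorings in which the point `P` receives the color `0`. -/
noncomputable def colorSeriesAvoid [DecidableEq ι] (U : Finset ℕ) (ζ : ℂ) (δ : ι → ℕ) (P : ι) : ℂ[X] :=
  locFactor U ζ 1 * ∏ Q, if Q = P then 1 else locFactor U ζ (δ Q)

theorem colorSeries_eq_avoid_mul [DecidableEq ι] (U : Finset ℕ) (ζ : ℂ) (δ : ι → ℕ) (P : ι) :
    colorSeries U ζ δ = colorSeriesAvoid U ζ δ P * locFactor U ζ (δ P) := by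
  rw [colorSeries, colorSeriesAvoid, mul_assoc]
  congr 1
  rw [← Finset.mul_prod_erase _ _ (Finset.mem_univ P), ← Finset.mul_prod_erase _ _ (Finset.mem_univ P),
    if_pos rfl, one_mul, mul_comm]
  congr 1
  exact Finset.prod_congr rfl fun Q hQ => (if_neg (Finset.ne_of_mem_erase hQ)).symm

theorem coeff_colorSeries_eq [DecidableEq ι] (U : Finset ℕ) (ζ : ℂ) (δ : ι → ℕ) (P : ι) (m : ℕ) :
    (colorSeries U ζ δ).coeff m = (colorSeriesAvoid U ζ δ P).coeff m +
      if δ P ≤ m then (∑ i ∈ U, ζ ^ (i * δ P)) * (colorSeriesAvoid U ζ δ P).coeff (m - δ P) else 0 := by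
  rw [colorSeries_eq_avoid_mul U ζ δ P, locFactor, mul_add, mul_one, coeff_add,
    mul_left_comm, coeff_C_mul, coeff_mul_X_pow']
  split_ifs <;> simp

theorem colorSeries_eq_prod {U : Finset ℕ} (hU : 0 ∉ U) (ζ : ℂ) (δ : ι → ℕ) :
    colorSeries U ζ δ = ∏ Q : Option ι, ∑ k ∈ insert 0 U,
      C (ζ ^ (k * withInfty δ Q)) * X ^ (if k = 0 then 0 else withInfty δ Q) := by
  simp only [sum_colors_eq_locFactor hU]
  rw [Fintype.prod_option]
  rfl

theorem colorSeriesAvoid_eq_prod [DecidableEq ι] {U : Finset ℕ} (hU : 0 ∉ U) (ζ : ℂ) (δ : ι → ℕ)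
    (P : ι) :
    colorSeriesAvoid U ζ δ P = ∏ Q : Option ι, ∑ k ∈ (if Q = some P then {0} else insert 0 U),
      C (ζ ^ (k * withInfty δ Q)) * X ^ (if k = 0 then 0 else withInfty δ Q) := by
  rw [Fintype.prod_option, colorSeriesAvoid]
  congr 1
  · rw [if_neg (by simp), sum_colors_eq_locFactor hU]; rfl
  · refine Finset.prod_congr rfl fun Q _ => ?_
    by_cases h : Q = P
    · simp [h]
    · rw [if_neg h, if_neg (by simpa using h), sum_colors_eq_locFactor hU]; rfl

theorem card_thinColorings [DecidableEq ι] {U : Finset ℕ} (hU : 0 ∉ U) (δ : ι → ℕ) {r : ℕ} (hr : 0 < r)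
    (d : ℕ) : (r : ℂ) * ((thinColorings U δ r d).card : ℂ) =
      ∑ ζ ∈ nthRootsFinset r (1 : ℂ), (colorSeries U ζ δ).coeff d := by
  simp only [colorSeries_eq_prod hU]
  exact card_filter_colors _ _ hr d

theorem card_thinColorings_avoid [DecidableEq ι] {U : Finset ℕ} (hU : 0 ∉ U) (δ : ι → ℕ) {r : ℕ}
    (hr : 0 < r) (d : ℕ) (P : ι) :
    (r : ℂ) * (((thinColorings U δ r d).filter fun c => c (some P) = 0).card : ℂ) =
      ∑ ζ ∈ nthRootsFinset r (1 : ℂ), (colorSeriesAvoid U ζ δ P).coeff d := by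
  simp only [colorSeriesAvoid_eq_prod hU]
  rw [← card_filter_colors _ _ hr d]
  congr 3
  ext c
  simp only [thinColorings, Finset.mem_filter, Fintype.mem_piFinset]
  constructor
  · rintro ⟨⟨h1, h2⟩, h3⟩
    refine ⟨fun Q => ?_, h2⟩
    split_ifs with h
    · rw [h, h3]; simp
    · exact h1 Q
  · rintro ⟨h1, h2⟩
    refine ⟨⟨fun Q => ?_, h2⟩, by simpa using h1 (some P)⟩
    have := h1 Q
    split_ifs at this with h
    · rw [Finset.mem_singleton.1 this]; exact Finset.mem_insert_self _ _
    · exact this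

theorem coeff_colorSeries_of_sq_eq_one [DecidableEq ι] {U : Finset ℕ} (hU : 0 ∉ U) (δ : ι → ℕ) {ζ : ℂ}
    {d : ℕ} (hζ : ∀ k ∈ U, ζ ^ k = ζ) (hd : ζ ^ d = 1) :
    (colorSeries U ζ δ).coeff d = (colorSeries U 1 δ).coeff d := by
  rw [colorSeries_eq_prod hU, colorSeries_eq_prod hU]
  exact coeff_prod_sum_colors_of_sq_eq_one _
    (fun Q k hk hk0 => hζ k ((Finset.mem_insert.1 hk).resolve_left hk0)) hd

theorem coeff_colorSeriesAvoid_of_sq_eq_one [DecidableEq ι] {U : Finset ℕ} (hU : 0 ∉ U) (δ : ι → ℕ)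
    {ζ : ℂ} {d : ℕ} (hζ : ∀ k ∈ U, ζ ^ k = ζ) (hd : ζ ^ d = 1) (P : ι) :
    (colorSeriesAvoid U ζ δ P).coeff d = (colorSeriesAvoid U 1 δ P).coeff d := by
  rw [colorSeriesAvoid_eq_prod hU, colorSeriesAvoid_eq_prod hU]
  refine coeff_prod_sum_colors_of_sq_eq_one _ (fun Q k hk hk0 => ?_) hd
  split_ifs at hk with h
  · exact absurd (Finset.mem_singleton.1 hk) hk0
  · exact hζ k ((Finset.mem_insert.1 hk).resolve_left hk0)

end Colorings

/-! ### Monic polynomials as colorings of closed points. -/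

section PolynomialColorings
variable {K : Type*} [Field K] [Finite K] {d : ℕ}

/-- The closed points of degree at most `d` of the affine line. -/
abbrev Points (K : Type*) [Field K] [Finite K] (d : ℕ) : Type _ := {P : K[X] // P ∈ primesLE K d}

/-- The degree of a point. -/
noncomputable def ptDeg (P : Points K d) : ℕ := P.1.natDegree

theorem Points.monic (P : Points K d) : P.1.Monic := (mem_primesLE.1 P.2).1

theorem Points.irreducible (P : Points K d) : Irreducible P.1 := (mem_primesLE.1 P.2).2.1

theorem Points.eq_of_dvd {P Q : Points K d} (h : P.1 ∣ Q.1) : P = Q :=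
  Subtype.ext (eq_of_monic_of_associated P.monic Q.monic (P.irreducible.associated_of_dvd Q.irreducible h))

theorem isLineUpTo_ptDeg : IsLineUpTo (ptDeg (K := K) (d := d)) (Nat.card K) d where
  pos P := P.irreducible.natDegree_pos
  le P := (mem_primesLE.1 P.2).2.2
  card_le n := by
    refine le_trans (le_of_eq ?_) (card_primesLE_filter_le (K := K) d n)
    rw [← Finset.card_map (Function.Embedding.subtype _)]
    congr 1
    ext P
    simp only [Finset.mem_map, Finset.mem_filter, ptDeg, Function.Embedding.subtype_apply]
    constructor
    · rintro ⟨Q, h, rfl⟩; exact ⟨Q.2, (Finset.mem_filter.1 h).2⟩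
    · rintro ⟨h1, h2⟩; exact ⟨⟨P, h1⟩, Finset.mem_filter.2 ⟨Finset.mem_univ _, h2⟩, rfl⟩
  zeta := by
    refine ⟨PowerSeries.mk fun m => ((smoothMonics (primesLE K d) m).card : ℂ), ?_, fun m hm => ?_⟩
    · refine Eq.trans ?_ (mk_card_smoothMonics_mul ℂ (primesLE K d) fun P hP =>
        ⟨(mem_primesLE.1 hP).1, (mem_primesLE.1 hP).2.1⟩)
      rw [← Finset.prod_coe_sort (primesLE K d) fun P => (1 - PowerSeries.X ^ P.natDegree : PowerSeries ℂ)]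
      rfl
    · rw [PowerSeries.coeff_mk, card_smoothMonics_primesLE hm]; push_cast; rfl

/-- The polynomial whose multiplicity at each point is the color of the point. -/
noncomputable def colorPoly (c : Points K d → ℕ) : K[X] := ∏ P, P.1 ^ c P

theorem monic_colorPoly (c : Points K d → ℕ) : (colorPoly c).Monic :=
  monic_prod_of_monic _ _ fun P _ => P.monic.pow _

theorem natDegree_colorPoly (c : Points K d → ℕ) : (colorPoly c).natDegree = colorWt ptDeg c := by
  rw [colorPoly, natDegree_prod_of_monic _ _ fun P _ => P.monic.pow _]
  exact Finset.sum_congr rfl fun P _ => natDegree_pow _ _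

theorem emultiplicity_colorPoly (c : Points K d → ℕ) (Q : Points K d) :
    emultiplicity Q.1 (colorPoly c) = c Q := by
  classical
  rw [colorPoly, Finset.emultiplicity_prod Q.irreducible.prime, Finset.sum_eq_single Q]
  · exact emultiplicity_pow_self Q.irreducible.ne_zero Q.irreducible.not_isUnit _
  · intro P _ hP
    rw [emultiplicity_pow Q.irreducible.prime, emultiplicity_eq_zero.2 fun h => hP (Points.eq_of_dvd h).symm,
      mul_zero]
  · simp

theorem pow_dvd_colorPoly_iff (c : Points K d → ℕ) (Q : Points K d) (k : ℕ) :
    Q.1 ^ k ∣ colorPoly c ↔ k ≤ c Q := by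
  rw [pow_dvd_iff_le_emultiplicity, emultiplicity_colorPoly, Nat.cast_le]

theorem dvd_colorPoly_iff (c : Points K d → ℕ) (Q : Points K d) : Q.1 ∣ colorPoly c ↔ c Q ≠ 0 := by
  rw [← pow_one Q.1, pow_dvd_colorPoly_iff, Nat.one_le_iff_ne_zero]

theorem colorPoly_injective : Function.Injective (colorPoly (K := K) (d := d)) := by
  intro c c' h
  ext Q
  have h1 := emultiplicity_colorPoly c Q
  rw [h, emultiplicity_colorPoly] at h1
  exact_mod_cast h1.symm

theorem isCoprime_colorPoly_iff (c : Points K d → ℕ) (Q : Points K d) :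
    IsCoprime (colorPoly c) Q.1 ↔ c Q = 0 := by
  rw [isCoprime_comm, Q.irreducible.coprime_iff_not_dvd, dvd_colorPoly_iff, not_not]

open Classical in
/-- A monic square-free polynomial is the product of the points that divide it. -/
theorem eq_colorPoly_of_squarefree {f : K[X]} (hf : f.Monic) (hsq : Squarefree f) (hd : f.natDegree ≤ d) :
    f = colorPoly fun P : Points K d => if P.1 ∣ f then 1 else 0 := by
  set c : Points K d → ℕ := fun P => if P.1 ∣ f then 1 else 0 with hc
  have hdvd : colorPoly c ∣ f := by
    refine Finset.prod_dvd_of_coprime ?_ ?_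
    · intro P _ Q _ hPQ
      refine IsCoprime.pow ((P.irreducible.coprime_iff_not_dvd).2 fun h => hPQ (Points.eq_of_dvd h))
    · intro P _
      rw [hc]
      dsimp only
      split_ifs with h
      · rwa [pow_one]
      · rw [pow_zero]; exact one_dvd _
  obtain ⟨h, hh⟩ := hdvd
  have hm : h.Monic := (monic_colorPoly c).of_mul_monic_left (hh ▸ hf)
  have h0 : h.natDegree = 0 := by
    by_contra hne
    obtain ⟨Q, hQ, hQi, hQh⟩ := exists_monic_irreducible_dvd hne
    have hQf : Q ∣ f := hh ▸ hQh.mul_left _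
    have hmem : Q ∈ primesLE K d :=
      mem_primesLE.2 ⟨hQ, hQi, (natDegree_le_of_dvd hQf hf.ne_zero).trans hd⟩
    have hQc : Q ∣ colorPoly c := by
      refine (dvd_colorPoly_iff c ⟨Q, hmem⟩).2 ?_
      simp [hc, hQf]
    exact hQi.not_isUnit (hsq Q (hh ▸ mul_dvd_mul hQc hQh))
  rw [hm.natDegree_eq_zero.1 h0, mul_one] at hh
  exact hh

end PolynomialColorings

/-! ### Thin factorizations as colorings by residues prime to `r`. -/

section ThinFactorizations
variable {K : Type*} [Field K] [Finite K] {r d : ℕ}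

theorem mem_unitIdx {r i : ℕ} : i ∈ unitIdx r ↔ (1 ≤ i ∧ i ≤ r) ∧ i.Coprime r := by
  simp [unitIdx]

theorem zero_notMem_unitIdx (r : ℕ) : 0 ∉ unitIdx r := fun h => by
  have := (mem_unitIdx.1 h).1.1
  omega

theorem lt_of_mem_unitIdx {r i : ℕ} (hr : 2 ≤ r) (hi : i ∈ unitIdx r) : i < r := by
  obtain ⟨⟨-, h2⟩, h3⟩ := mem_unitIdx.1 hi
  refine lt_of_le_of_ne h2 ?_
  rintro rfl
  rw [Nat.coprime_self] at h3
  omega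

theorem card_unitIdx {r : ℕ} (hr : 2 ≤ r) : (unitIdx r).card = Nat.totient r := by
  rw [Nat.totient_eq_card_coprime]
  congr 1
  refine Finset.ext fun i => ?_
  simp only [mem_unitIdx, Finset.mem_filter, Finset.mem_range]
  constructor
  · intro h
    exact ⟨lt_of_mem_unitIdx hr (mem_unitIdx.2 h), h.2.symm⟩
  · rintro ⟨h1, h2⟩
    refine ⟨⟨Nat.one_le_iff_ne_zero.2 ?_, h1.le⟩, h2.symm⟩
    rintro rfl
    rw [Nat.coprime_zero_right] at h2
    omega

open Classical in
/-- The coloring attached to a thin factorization. -/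
noncomputable def factorColor (r : ℕ) (f : ℕ → K[X]) (P : Points K d) : ℕ :=
  ∑ i ∈ unitIdx r, if P.1 ∣ f i then i else 0

theorem IsThinFactorization.factorColor_eq {f : ℕ → K[X]} {F : K[X]} (h : IsThinFactorization r f F)
    {P : Points K d} {i : ℕ} (hi : i ∈ unitIdx r) (hP : P.1 ∣ f i) : factorColor r f P = i := by
  classical
  rw [factorColor, Finset.sum_eq_single i, if_pos hP]
  · intro j hj hji
    rw [if_neg]
    intro hPj
    exact P.irreducible.not_isUnit ((h.2.1 hj hi hji).isUnit_of_dvd' hPj hP)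
  · exact fun h => absurd hi h

theorem IsThinFactorization.factorColor_eq_iff {f : ℕ → K[X]} {F : K[X]}
    (h : IsThinFactorization r f F) {P : Points K d} {i : ℕ} (hi : i ∈ unitIdx r) :
    factorColor r f P = i ↔ P.1 ∣ f i := by
  classical
  refine ⟨fun hc => ?_, h.factorColor_eq hi⟩
  by_contra hP
  have hi0 : i ≠ 0 := by rintro rfl; exact zero_notMem_unitIdx r hi
  obtain ⟨j, hj, hne⟩ := Finset.exists_ne_zero_of_sum_ne_zero (hc ▸ hi0 : factorColor r f P ≠ 0)
  rw [ne_eq, ite_eq_right_iff, Classical.not_imp] at hne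
  have := h.factorColor_eq hj hne.1
  rw [hc] at this
  exact hP (this ▸ hne.1)

theorem IsThinFactorization.factorColor_mem {f : ℕ → K[X]} {F : K[X]} (h : IsThinFactorization r f F)
    (P : Points K d) : factorColor r f P ∈ insert 0 (unitIdx r) := by
  classical
  by_cases h0 : factorColor r f P = 0
  · rw [h0]; exact Finset.mem_insert_self _ _
  · obtain ⟨j, hj, hne⟩ := Finset.exists_ne_zero_of_sum_ne_zero h0
    rw [ne_eq, ite_eq_right_iff, Classical.not_imp] at hne
    rw [h.factorColor_eq hj hne.1]
    exact Finset.mem_insert_of_mem hj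

theorem IsThinFactorization.eq_colorPoly {f : ℕ → K[X]} {F : K[X]} (h : IsThinFactorization r f F)
    (hd : ∀ i ∈ unitIdx r, (f i).natDegree ≤ d) : F = colorPoly (d := d) (factorColor r f) := by
  classical
  rw [h.2.2, colorPoly]
  have h1 : ∀ i ∈ unitIdx r, f i ^ i = ∏ P : Points K d, P.1 ^ (if P.1 ∣ f i then i else 0) := by
    intro i hi
    conv_lhs => rw [eq_colorPoly_of_squarefree (h.1 i hi).1 (h.1 i hi).2 (hd i hi), colorPoly,
      ← Finset.prod_pow]
    refine Finset.prod_congr rfl fun P _ => ?_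
    rw [← pow_mul]
    split_ifs <;> simp
  rw [Finset.prod_congr rfl h1, Finset.prod_comm]
  exact Finset.prod_congr rfl fun P _ => Finset.prod_pow_eq_pow_sum _ _ _

theorem IsThinFactorization.sum_natDegree {f : ℕ → K[X]} {F : K[X]} (h : IsThinFactorization r f F)
    (hd : ∀ i ∈ unitIdx r, (f i).natDegree ≤ d) :
    ∑ i ∈ unitIdx r, (f i).natDegree = colorDeg ptDeg (factorColor (d := d) r f) := by
  classical
  have h1 : ∀ i ∈ unitIdx r, (f i).natDegree = ∑ P : Points K d, if P.1 ∣ f i then ptDeg P else 0 := by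
    intro i hi
    conv_lhs => rw [eq_colorPoly_of_squarefree (h.1 i hi).1 (h.1 i hi).2 (hd i hi), natDegree_colorPoly,
      colorWt]
    refine Finset.sum_congr rfl fun P _ => ?_
    split_ifs <;> simp
  rw [Finset.sum_congr rfl h1, Finset.sum_comm, colorDeg]
  refine Finset.sum_congr rfl fun P _ => ?_
  by_cases h0 : factorColor r f P = 0
  · rw [if_pos h0]
    refine Finset.sum_eq_zero fun i hi => if_neg fun hP => ?_
    rw [h.factorColor_eq hi hP] at h0
    exact zero_notMem_unitIdx r (h0 ▸ hi)
  · rw [if_neg h0]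
    have hm := (Finset.mem_insert.1 (h.factorColor_mem P)).resolve_left h0
    rw [Finset.sum_eq_single _ _ (fun hn => absurd hm hn), if_pos ((h.factorColor_eq_iff hm).1 rfl)]
    intro i hi hne
    rw [if_neg fun hP => hne (h.factorColor_eq hi hP).symm]

open Classical in
theorem isThinFactorization_colorPoly {c : Points K d → ℕ} (hc : ∀ P, c P ∈ insert 0 (unitIdx r)) :
    IsThinFactorization r (fun i => colorPoly fun P => if c P = i then 1 else 0) (colorPoly c) := by
  refine ⟨fun i _ => ⟨monic_colorPoly _, ?_⟩, ?_, ?_⟩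
  · refine Finset.squarefree_prod_of_pairwise_isCoprime ?_ fun P _ => ?_
    · intro P _ Q _ hPQ
      exact (IsCoprime.pow ((P.irreducible.coprime_iff_not_dvd).2 fun h =>
        hPQ (Points.eq_of_dvd h))).isRelPrime
    · dsimp only
      split_ifs
      · rw [pow_one]; exact P.irreducible.squarefree
      · rw [pow_zero]; exact squarefree_one
  · intro i _ j _ hij
    refine IsCoprime.prod_left fun P _ => IsCoprime.prod_right fun Q _ => ?_
    dsimp only
    by_cases hP : c P = i
    · by_cases hQ : c Q = j
      · refine IsCoprime.pow ((P.irreducible.coprime_iff_not_dvd).2 fun h => hij ?_)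
        rw [← hP, ← hQ, Points.eq_of_dvd h]
      · rw [if_neg hQ, pow_zero]; exact isCoprime_one_right
    · rw [if_neg hP, pow_zero]; exact isCoprime_one_left
  · simp only [colorPoly, ← Finset.prod_pow, ← pow_mul]
    rw [Finset.prod_comm]
    refine Finset.prod_congr rfl fun P _ => ?_
    rw [Finset.prod_pow_eq_pow_sum]
    congr 1
    simp only [ite_mul, one_mul, zero_mul]
    rw [Finset.sum_ite_eq]
    split_ifs with h
    · rfl
    · exact (Finset.mem_insert.1 (hc P)).resolve_right h

end ThinFactorizations

/-! ### The Kummer conditions. -/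

section Kummer
variable {K : Type*} [Field K] [Finite K] {r d : ℕ}

theorem exists_point_eq_of_dvd_colorPoly {c : Points K d → ℕ} {Q : K[X]} (hQ : Q.Monic)
    (hQi : Irreducible Q) (h : Q ∣ colorPoly c) : ∃ P : Points K d, P.1 = Q := by
  obtain ⟨P, -, hP⟩ := (hQi.prime.dvd_finsetProd_iff _).1 h
  exact ⟨P, eq_of_monic_of_associated P.monic hQ
    (hQi.associated_of_dvd P.irreducible (hQi.prime.dvd_of_dvd_pow hP)).symm⟩

/-- All multiplicities are below `r`, so no `r`-th power of a nonunit divides. At a colored point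
the multiplicity is prime to `r`, so it is not a multiple of any `s ∣ r` with `s ≠ 1`. -/
theorem isKummerPoly_C_mul_colorPoly (hr : 2 ≤ r) {c : Points K d → ℕ}
    (hc : ∀ P, c P ∈ insert 0 (unitIdx r)) {P : Points K d} (hP : c P ≠ 0) (a : Kˣ) :
    IsKummerPoly r (C (a : K) * colorPoly c) := by
  have ha : IsUnit (C (a : K)) := isUnit_C.2 a.isUnit
  constructor
  · intro H hH
    by_contra hHu
    obtain ⟨Q, hQ, hQi, hQH⟩ := Polynomial.exists_monic_irreducible_factor H hHu
    have hQr : Q ^ r ∣ colorPoly c := (IsUnit.dvd_mul_left ha).1 ((pow_dvd_pow_of_dvd hQH r).trans hH)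
    obtain ⟨R, rfl⟩ := exists_point_eq_of_dvd_colorPoly hQ hQi ((dvd_pow_self Q (by omega)).trans hQr)
    rw [pow_dvd_colorPoly_iff] at hQr
    rcases Finset.mem_insert.1 (hc R) with h | h
    · omega
    · have := lt_of_mem_unitIdx hr h
      omega
  · intro s hs hs1 H hH
    have hmem := (Finset.mem_insert.1 (hc P)).resolve_left hP
    have hm := emultiplicity_colorPoly c P
    have h1 : emultiplicity P.1 (H ^ s) = c P := by
      rw [← hH, ← hm, emultiplicity_mul P.irreducible.prime,
        emultiplicity_eq_zero.2 fun h => P.irreducible.not_isUnit (isUnit_of_dvd_unit h ha), zero_add]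
    rw [emultiplicity_pow P.irreducible.prime] at h1
    have hH0 : H ≠ 0 := by
      rintro rfl
      rw [zero_pow (by rintro rfl; rw [zero_dvd_iff] at hs; omega)] at hH
      exact (mul_ne_zero ha.ne_zero (monic_colorPoly c).ne_zero) hH
    have hfin : FiniteMultiplicity P.1 H := FiniteMultiplicity.of_prime_left P.irreducible.prime hH0
    rw [hfin.emultiplicity_eq_multiplicity] at h1
    have h2 : s * multiplicity P.1 H = c P := by exact_mod_cast h1
    have h3 : s ∣ Nat.gcd (c P) r := Nat.dvd_gcd ⟨_, h2.symm⟩ hs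
    rw [(mem_unitIdx.1 hmem).2] at h3
    exact hs1 (Nat.dvd_one.1 h3)

end Kummer

/-! ### The thin family as a set of colorings. -/

section Family
variable {r g d : ℕ}

/-- The equation reads `(r - 1)(d - D) = r - gcd(r, w)` with right side between `0` and `r - 1`, so
`d - D` is `0` or `1`. In the second case infinity is ramified and supplies the missing degree. -/
theorem genus_iff (hr : 2 ≤ r) (hd : (r - 1) * d = 2 * g + 2 * r - 2) (D w : ℕ) :
    (2 * (g : ℤ) + 2 * r - 2 = (r - 1) * (D : ℤ) + r - (Nat.gcd r w : ℤ)) ↔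
      (D = d ∧ r ∣ w) ∨ (D + 1 = d ∧ Nat.gcd r w = 1) := by
  have h1 : ((r : ℤ) - 1) * d = 2 * g + 2 * r - 2 := by
    have := congrArg (Nat.cast : ℕ → ℤ) hd
    rw [Nat.cast_mul, Nat.cast_sub (by omega), Nat.cast_sub (by omega)] at this
    push_cast at this
    linarith
  have hg1 : Nat.gcd r w ≤ r := Nat.gcd_le_left w (by omega)
  have hg0 : 0 < Nat.gcd r w := Nat.gcd_pos_of_pos_left w (by omega)
  have hdv : r ∣ w ↔ Nat.gcd r w = r := Nat.gcd_eq_left_iff_dvd.symm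
  rw [← h1, hdv]
  generalize Nat.gcd r w = e at *
  have hr' : (2 : ℤ) ≤ r := by exact_mod_cast hr
  constructor
  · intro h
    have h2 : ((r : ℤ) - 1) * ((d : ℤ) - D) = r - e := by linarith
    have h3 : 0 ≤ (d : ℤ) - D := by
      by_contra! hneg
      have : (r : ℤ) - e < 0 := by rw [← h2]; exact mul_neg_of_pos_of_neg (by linarith) hneg
      omega
    have h4 : (d : ℤ) - D ≤ 1 := by
      by_contra! h5
      have : ((r : ℤ) - 1) * 2 ≤ (r - 1) * ((d : ℤ) - D) :=
        mul_le_mul_of_nonneg_left (by omega) (by linarith)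
      omega
    rcases (by omega : (d : ℤ) - D = 0 ∨ (d : ℤ) - D = 1) with h5 | h5
    · rw [h5, mul_zero] at h2
      left; omega
    · rw [h5, mul_one] at h2
      right; omega
  · rintro (⟨rfl, h⟩ | ⟨rfl, h⟩)
    · rw [h]; ring
    · rw [h]; push_cast; ring

theorem three_le_of_genus (hr : 2 ≤ r) (hg : 1 ≤ g) (hd : (r - 1) * d = 2 * g + 2 * r - 2) : 3 ≤ d := by
  by_contra! h
  have : (r - 1) * d ≤ (r - 1) * 2 := Nat.mul_le_mul_left _ (by omega)
  omega

variable (K : Type*) [Field K]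

/-- The monic parts of the elements of the thin family. -/
def thinMonic (r g : ℕ) : Set K[X] :=
  {F | ∃ f : ℕ → K[X], IsThinFactorization r f F ∧
    2 * (g : ℤ) + 2 * r - 2 =
      (r - 1) * (∑ i ∈ unitIdx r, ((f i).natDegree : ℤ)) + r - (Nat.gcd r F.natDegree : ℤ)}

variable [Finite K] {K}

theorem colorDeg_withInfty (δ : Points K d → ℕ) (c : Option (Points K d) → ℕ) :
    colorDeg (withInfty δ) c = (if c none = 0 then 0 else 1) + colorDeg δ fun P => c (some P) := by
  rw [colorDeg, Fintype.sum_option]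
  rfl

theorem colorWt_withInfty (δ : Points K d → ℕ) (c : Option (Points K d) → ℕ) :
    colorWt (withInfty δ) c = c none + colorWt δ fun P => c (some P) := by
  rw [colorWt, Fintype.sum_option]
  simp only [withInfty, Option.elim_none, mul_one]
  rfl

open Classical in
theorem mem_thinColorings {U : Finset ℕ} {δ : Points K d → ℕ} {c : Option (Points K d) → ℕ} :
    c ∈ thinColorings U δ r d ↔ (∀ Q, c Q ∈ insert 0 U) ∧
      colorDeg (withInfty δ) c = d ∧ r ∣ colorWt (withInfty δ) c := by
  rw [thinColorings, Finset.mem_filter, Fintype.mem_piFinset]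

/-- The polynomial attached to a coloring of the points and of the point at infinity. -/
noncomputable def affinePoly (c : Option (Points K d) → ℕ) : K[X] := colorPoly fun P => c (some P)

theorem exists_unitIdx_dvd_add (hr : 2 ≤ r) {w : ℕ} (hw : Nat.gcd r w = 1) :
    ∃ k ∈ unitIdx r, r ∣ k + w := by
  have hlt : w % r < r := Nat.mod_lt _ (by omega)
  have hg : Nat.gcd (w % r) r = 1 := by rw [← Nat.gcd_rec, hw]
  have hne : w % r ≠ 0 := by intro h0; rw [h0, Nat.gcd_zero_left] at hg; omega
  refine ⟨r - w % r, mem_unitIdx.2 ⟨⟨by omega, by omega⟩, ?_⟩, ?_⟩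
  · rw [Nat.coprime_comm, Nat.Coprime, Nat.gcd_self_sub_right hlt.le, Nat.gcd_comm, hg]
  · refine ⟨1 + w / r, ?_⟩
    have := Nat.mod_add_div w r
    rw [mul_add]
    omega

theorem coprime_of_dvd_add {k w : ℕ} (hk : k ∈ unitIdx r) (h : r ∣ k + w) : Nat.gcd r w = 1 := by
  have h1 : Nat.gcd r w ∣ k :=
    (Nat.dvd_add_left (Nat.gcd_dvd_right r w)).1 ((Nat.gcd_dvd_left r w).trans h)
  have h2 := Nat.dvd_gcd h1 (Nat.gcd_dvd_left r w)
  rw [(mem_unitIdx.1 hk).2] at h2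
  exact Nat.dvd_one.1 h2

open Classical in
theorem IsThinFactorization.exists_coloring (hr : 2 ≤ r) {f : ℕ → K[X]} {F : K[X]}
    (h : IsThinFactorization r f F)
    (hD : (∑ i ∈ unitIdx r, (f i).natDegree = d ∧ r ∣ F.natDegree) ∨
      (∑ i ∈ unitIdx r, (f i).natDegree + 1 = d ∧ Nat.gcd r F.natDegree = 1)) :
    ∃ c ∈ thinColorings (unitIdx r) (ptDeg (K := K) (d := d)) r d,
      affinePoly c = F ∧ ∀ P, c (some P) = factorColor r f P := by
  have hle : ∀ i ∈ unitIdx r, (f i).natDegree ≤ d := by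
    intro i hi
    have := Finset.single_le_sum (f := fun i => (f i).natDegree) (fun _ _ => Nat.zero_le _) hi
    omega
  have hF := h.eq_colorPoly hle
  have hdeg := h.sum_natDegree hle
  have hw : F.natDegree = colorWt ptDeg (factorColor (d := d) r f) := by
    conv_lhs => rw [hF, natDegree_colorPoly]
  have key : ∀ k ∈ insert 0 (unitIdx r), (if k = 0 then 0 else 1) +
      ∑ i ∈ unitIdx r, (f i).natDegree = d → r ∣ k + F.natDegree →
      ∃ c ∈ thinColorings (unitIdx r) (ptDeg (K := K) (d := d)) r d,
        affinePoly c = F ∧ ∀ P, c (some P) = factorColor r f P := by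
    intro k hk hkD hkr
    refine ⟨fun Q => Q.elim k (factorColor r f), mem_thinColorings.2 ⟨?_, ?_, ?_⟩, hF.symm, fun P => rfl⟩
    · rintro (_ | P)
      · exact hk
      · exact h.factorColor_mem P
    · rw [hdeg] at hkD
      rw [colorDeg_withInfty]
      exact hkD
    · rw [colorWt_withInfty]
      rw [hw] at hkr
      exact hkr
  rcases hD with ⟨h1, h2⟩ | ⟨h1, h2⟩
  · exact key 0 (Finset.mem_insert_self _ _) (by simpa using h1) (by simpa using h2)
  · obtain ⟨k, hk, hkr⟩ := exists_unitIdx_dvd_add hr h2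
    refine key k (Finset.mem_insert_of_mem hk) ?_ hkr
    rw [if_neg (by rintro rfl; exact zero_notMem_unitIdx r hk), ← h1, add_comm]

open Classical in
-- The two cases of `genus_iff` are the color `0` and a nonzero color at infinity. The nonzero color
-- exists exactly when `deg F` is prime to `r`, as the negative of `deg F` modulo `r`.
theorem thinMonic_eq_image (hr : 2 ≤ r) (hd : (r - 1) * d = 2 * g + 2 * r - 2) :
    thinMonic K r g = affinePoly '' (thinColorings (unitIdx r) (ptDeg (K := K) (d := d)) r d : Set (Option (Points K d) → ℕ)) := by
  ext F
  constructor
  · rintro ⟨f, hf, hgen⟩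
    rw [← Nat.cast_sum, genus_iff hr hd] at hgen
    obtain ⟨c, hc, hcF, -⟩ := hf.exists_coloring hr hgen
    exact ⟨c, hc, hcF⟩
  · rintro ⟨c, hc, rfl⟩
    rw [Finset.mem_coe, mem_thinColorings, colorDeg_withInfty, colorWt_withInfty] at hc
    obtain ⟨hcU, hcD, hcr⟩ := hc
    have hcU' : ∀ P : Points K d, c (some P) ∈ insert 0 (unitIdx r) := fun P => hcU _
    have hf := isThinFactorization_colorPoly hcU'
    refine ⟨_, hf, ?_⟩
    rw [← Nat.cast_sum, genus_iff hr hd]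
    have hle : ∀ i ∈ unitIdx r,
        (colorPoly fun P : Points K d => if c (some P) = i then 1 else 0).natDegree ≤ d := by
      intro i hi
      have hi0 : i ≠ 0 := by rintro rfl; exact zero_notMem_unitIdx r hi
      rw [natDegree_colorPoly]
      refine le_trans (Finset.sum_le_sum fun P _ => ?_) (le_of_le_of_eq (Nat.le_add_left _ _) hcD)
      by_cases h : c (some P) = i
      · simp [h, hi0]
      · simp [h]
    have hcol : factorColor r (fun i => colorPoly fun P : Points K d => if c (some P) = i then 1 else 0) =
        fun P => c (some P) := colorPoly_injective (hf.eq_colorPoly hle).symm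
    rw [hf.sum_natDegree hle, hcol, affinePoly, natDegree_colorPoly]
    by_cases h0 : c none = 0
    · rw [if_pos h0, zero_add] at hcD
      rw [h0, zero_add] at hcr
      exact Or.inl ⟨hcD, hcr⟩
    · rw [if_neg h0] at hcD
      exact Or.inr ⟨by omega, coprime_of_dvd_add ((Finset.mem_insert.1 (hcU none)).resolve_left h0) hcr⟩

theorem eq_of_mem_insert_unitIdx (hr : 2 ≤ r) {k k' w : ℕ} (hk : k ∈ insert 0 (unitIdx r))
    (hk' : k' ∈ insert 0 (unitIdx r)) (h : r ∣ k + w) (h' : r ∣ k' + w) : k = k' := by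
  have hlt : ∀ k ∈ insert 0 (unitIdx r), k < r := by
    intro k hk
    rcases Finset.mem_insert.1 hk with rfl | hk
    · omega
    · exact lt_of_mem_unitIdx hr hk
  have h1 : k + w ≡ k' + w [MOD r] := by
    rw [Nat.ModEq, Nat.mod_eq_zero_of_dvd h, Nat.mod_eq_zero_of_dvd h']
  exact (Nat.ModEq.add_right_cancel' w h1).eq_of_lt_of_lt (hlt k hk) (hlt k' hk')

open Classical in
-- The polynomial determines the colors of the affine points. Divisibility of the weight by `r` then
-- fixes the color at infinity modulo `r`, and colors are below `r`.
theorem affinePoly_injOn (hr : 2 ≤ r) :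
    Set.InjOn affinePoly (thinColorings (unitIdx r) (ptDeg (K := K) (d := d)) r d : Set (Option (Points K d) → ℕ)) := by
  intro c hc c' hc' h
  rw [Finset.mem_coe, mem_thinColorings, colorWt_withInfty] at hc hc'
  have h1 : (fun P => c (some P)) = fun P => c' (some P) := colorPoly_injective h
  funext Q
  rcases Q with _ | P
  · refine eq_of_mem_insert_unitIdx hr (hc.1 _) (hc'.1 _) hc.2.2 ?_
    rw [h1]
    exact hc'.2.2
  · exact congrFun h1 P

open Classical in
-- The Kummer condition is automatic: `d ≥ 3` and infinity accounts for at most `1`, so some affine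
-- point is colored.
theorem thinFamily_eq_prod (hr : 2 ≤ r) (hg : 1 ≤ g) (hd : (r - 1) * d = 2 * g + 2 * r - 2) :
    thinFamily K r g = Set.univ ×ˢ thinMonic K r g := by
  ext ⟨x, F⟩
  refine ⟨fun h => ⟨Set.mem_univ _, h.2⟩, fun h => ⟨fun a _ => ?_, h.2⟩⟩
  have hF : F ∈ thinMonic K r g := h.2
  rw [thinMonic_eq_image hr hd] at hF
  obtain ⟨c, hc, rfl⟩ := hF
  rw [Finset.mem_coe, mem_thinColorings, colorDeg_withInfty] at hc
  have hd3 := three_le_of_genus hr hg hd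
  have hne : colorDeg ptDeg (fun P : Points K d => c (some P)) ≠ 0 := by
    intro h0
    have := hc.2.1
    rw [h0] at this
    split_ifs at this <;> omega
  obtain ⟨P, -, hP⟩ := Finset.exists_ne_zero_of_sum_ne_zero hne
  rw [ne_eq, ite_eq_left_iff, Classical.not_imp] at hP
  exact isKummerPoly_C_mul_colorPoly hr (fun P => hc.1 _) hP.1 a

theorem thinFamilyCoprime_eq_prod (hr : 2 ≤ r) (hg : 1 ≤ g) (hd : (r - 1) * d = 2 * g + 2 * r - 2)
    (G : K[X]) :
    thinFamilyCoprime K r g G = Set.univ ×ˢ {F | F ∈ thinMonic K r g ∧ IsCoprime F G} := by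
  ext x
  rw [thinFamilyCoprime, Set.mem_ofPred_eq, thinFamily_eq_prod hr hg hd]
  simp only [Set.mem_prod, Set.mem_univ, true_and, Set.mem_ofPred_eq]

open Classical in
theorem ncard_thinFamily (hr : 2 ≤ r) (hg : 1 ≤ g) (hd : (r - 1) * d = 2 * g + 2 * r - 2) :
    (thinFamily K r g).ncard = Nat.card (LeadingClass K r) *
      (thinColorings (unitIdx r) (ptDeg (K := K) (d := d)) r d).card := by
  rw [thinFamily_eq_prod hr hg hd, Set.ncard_prod, Set.ncard_univ, thinMonic_eq_image hr hd,
    (affinePoly_injOn hr).ncard_image, Set.ncard_coe_finset]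

open Classical in
theorem ncard_thinFamilyCoprime (hr : 2 ≤ r) (hg : 1 ≤ g) (hd : (r - 1) * d = 2 * g + 2 * r - 2)
    {G : K[X]} (P : Points K d) (hG : Associated G P.1) :
    (thinFamilyCoprime K r g G).ncard = Nat.card (LeadingClass K r) *
      ((thinColorings (unitIdx r) (ptDeg (K := K) (d := d)) r d).filter
        fun c => c (some P) = 0).card := by
  rw [thinFamilyCoprime_eq_prod hr hg hd, Set.ncard_prod, Set.ncard_univ, ← Set.ncard_coe_finset,
    ← ((affinePoly_injOn hr).mono (Finset.coe_subset.2 (Finset.filter_subset _ _))).ncard_image]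
  congr 2
  ext F
  rw [thinMonic_eq_image hr hd]
  have hco : ∀ c : Option (Points K d) → ℕ, IsCoprime (affinePoly c) G ↔ c (some P) = 0 := by
    intro c
    obtain ⟨u, hu⟩ := hG
    rw [← isCoprime_colorPoly_iff (fun P => c (some P)) P, ← hu, isCoprime_mul_unit_right_right u.isUnit]
    rfl
  simp only [Set.mem_ofPred_eq, Set.mem_image, Finset.mem_coe, Finset.mem_filter]
  constructor
  · rintro ⟨⟨c, hc, rfl⟩, h⟩
    exact ⟨c, ⟨hc, (hco c).1 h⟩, rfl⟩
  · rintro ⟨c, ⟨hc, h⟩, rfl⟩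
    exact ⟨⟨c, hc, rfl⟩, (hco c).2 h⟩

theorem finite_thinFamily (hr : 2 ≤ r) (hg : 1 ≤ g) (hd : (r - 1) * d = 2 * g + 2 * r - 2) :
    (thinFamily K r g).Finite := by
  classical
  rw [thinFamily_eq_prod hr hg hd, thinMonic_eq_image hr hd]
  exact Set.finite_univ.prod ((Finset.finite_toSet _).image _)

theorem thinFamilyCoprime_eq_of_lt (hr : 2 ≤ r) (hg : 1 ≤ g) (hd : (r - 1) * d = 2 * g + 2 * r - 2)
    {P : K[X]} (hP : Irreducible P) (hlt : d < P.natDegree) :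
    thinFamilyCoprime K r g P = thinFamily K r g := by
  classical
  rw [thinFamilyCoprime_eq_prod hr hg hd, thinFamily_eq_prod hr hg hd]
  congr 1
  refine Set.ext fun F => ⟨fun h => h.1, fun h => ⟨h, ?_⟩⟩
  rw [thinMonic_eq_image hr hd] at h
  obtain ⟨c, -, rfl⟩ := h
  refine IsCoprime.prod_left fun Q _ => IsCoprime.pow_left ?_
  rw [isCoprime_comm, hP.coprime_iff_not_dvd]
  intro hdvd
  have h1 := natDegree_le_of_dvd hdvd Q.irreducible.ne_zero
  have h2 := (mem_primesLE.1 Q.2).2.2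
  omega

end Family

/-! ### A sieve lower bound for the family, uniform in `q`. -/

section LowerBound
variable {K : Type*} [Field K] [Finite K] {r d : ℕ}

/-- Degree `1` contributes at most `1/q`. Degree `n ≥ 2` contributes at most `q ^ (-n) - q ^
(-n-1)`, which telescopes. -/
theorem sum_primesLE_inv_sq_le (hq : 2 ≤ Nat.card K) (d : ℕ) :
    ∑ P ∈ primesLE K d, 1 / ((Nat.card K : ℝ) ^ P.natDegree) ^ 2 ≤
      1 / (Nat.card K : ℝ) + 1 / (Nat.card K : ℝ) ^ 2 := by
  set q : ℝ := (Nat.card K : ℝ) with hqdef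
  have hq' : (2 : ℝ) ≤ q := by rw [hqdef]; exact_mod_cast hq
  rw [sum_primesLE_eq (K := K) d fun n => 1 / (q ^ n) ^ 2]
  have key : ∀ d : ℕ, ∑ n ∈ Finset.Icc 1 (d + 1),
      (((primesLE K (d + 1)).filter fun P => P.natDegree = n).card : ℝ) * (1 / (q ^ n) ^ 2) ≤
        1 / q + (1 / q ^ 2 - 1 / q ^ (d + 2)) := by
    intro D
    have h : ∀ n ∈ Finset.Icc 1 (D + 1),
        (((primesLE K (D + 1)).filter fun P => P.natDegree = n).card : ℝ) * (1 / (q ^ n) ^ 2) ≤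
          (if n = 1 then q else q ^ n - q ^ (n - 1)) * (1 / (q ^ n) ^ 2) := by
      intro n hn
      refine mul_le_mul_of_nonneg_right ?_ (by positivity)
      split_ifs with h1
      · have := card_primesLE_filter_le (K := K) (D + 1) n
        rw [h1, pow_one] at this
        rw [h1, hqdef]
        exact_mod_cast this
      · have h2 := card_primesLE_filter_le_sub (K := K) (D + 1) n
          (by have := (Finset.mem_Icc.1 hn).1; omega)
        have h3 : (((primesLE K (D + 1)).filter fun P => P.natDegree = n).card : ℝ) + q ^ (n - 1) ≤
            q ^ n := by rw [hqdef]; exact_mod_cast h2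
        linarith
    refine (Finset.sum_le_sum h).trans (le_of_eq ?_)
    clear h
    induction D with
    | zero => simp; field_simp
    | succ D ih =>
      rw [Finset.sum_Icc_succ_top (by omega), ih, if_neg (by omega)]
      have : D + 1 + 1 - 1 = D + 1 := by omega
      rw [this]
      field_simp
      ring
  rcases d with _ | d
  · simp; positivity
  · refine (key d).trans ?_
    have : 0 ≤ 1 / q ^ (d + 2) := by positivity
    linarith

open Classical in
/-- The tuples of monic polynomials of degrees `e i`, for `i` prime to `r`. -/
noncomputable def monicTuples (K : Type*) [Field K] [Finite K] (r : ℕ) (e : ℕ → ℕ) :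
    Finset (unitIdx r → K[X]) := Fintype.piFinset fun i => monics K (e i)

open Classical in
-- The sum of two indicators treats together `Q` dividing entries `i ≠ j` and `Q ^ 2` dividing entry
-- `i = j`. The density is at most `q ^ (-2 deg Q)` in both cases.
theorem card_tuples_filter_dvd_le (e : ℕ → ℕ) (i j : unitIdx r) {Q : K[X]} (hQ : Q.Monic) :
    ((Fintype.piFinset fun k : unitIdx r => (monics K (e k)).filter
      (Q ^ ((if k = i then 1 else 0) + (if k = j then 1 else 0)) ∣ ·)).card : ℝ) ≤
      (Nat.card K : ℝ) ^ (∑ k ∈ unitIdx r, e k) * (1 / ((Nat.card K : ℝ) ^ Q.natDegree) ^ 2) := by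
  rw [Fintype.card_piFinset, Nat.cast_prod]
  have h : ∀ k : unitIdx r, (((monics K (e k)).filter
      (Q ^ ((if k = i then 1 else 0) + (if k = j then 1 else 0)) ∣ ·)).card : ℝ) ≤
      (Nat.card K : ℝ) ^ e k / (Nat.card K : ℝ) ^
        (Q ^ ((if k = i then 1 else 0) + (if k = j then 1 else 0))).natDegree :=
    fun k => card_monics_filter_dvd_le (e k) (hQ.pow _)
  refine (Finset.prod_le_prod (fun _ _ => Nat.cast_nonneg _) fun k _ => h k).trans (le_of_eq ?_)
  rw [Finset.prod_div_distrib, Finset.prod_pow_eq_pow_sum, Finset.prod_pow_eq_pow_sum,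
    Finset.sum_coe_sort (unitIdx r) e, ← pow_mul, mul_one_div]
  congr 2
  simp only [natDegree_pow, ← Finset.sum_mul, Finset.sum_add_distrib, Finset.sum_ite_eq',
    Finset.mem_univ, if_true]
  ring

/-- The extension of a tuple by `1`. -/
noncomputable def extendTuple {K : Type*} [Field K] {r : ℕ} (x : unitIdx r → K[X]) (i : ℕ) : K[X] :=
  if h : i ∈ unitIdx r then x ⟨i, h⟩ else 1

theorem extendTuple_apply {K : Type*} [Field K] {r : ℕ} (x : unitIdx r → K[X]) {i : ℕ} (hi : i ∈ unitIdx r) :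
    extendTuple x i = x ⟨i, hi⟩ := dif_pos hi

open Classical in
-- The conditions on `e` place these tuples in the case where infinity has color `0`. The coloring
-- recovers each entry `i` as the product of the points of color `i`.
theorem card_goodTuples_le (hr : 2 ≤ r) (e : ℕ → ℕ) (hsum : ∑ k ∈ unitIdx r, e k = d)
    (hwt : r ∣ ∑ k ∈ unitIdx r, k * e k) :
    ((monicTuples K r e).filter fun x => (∀ i, Squarefree (x i)) ∧
      Pairwise fun i j => IsCoprime (x i) (x j)).card ≤
      (thinColorings (unitIdx r) (ptDeg (K := K) (d := d)) r d).card := by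
  have hthin : ∀ x ∈ (monicTuples K r e).filter fun x => (∀ i, Squarefree (x i)) ∧
      Pairwise fun i j => IsCoprime (x i) (x j),
      IsThinFactorization r (extendTuple x) (∏ i ∈ unitIdx r, extendTuple x i ^ i) ∧
        ∀ i ∈ unitIdx r, (extendTuple x i).natDegree = e i := by
    intro x hx
    obtain ⟨hx1, hx2, hx3⟩ := Finset.mem_filter.1 hx
    rw [monicTuples, Fintype.mem_piFinset] at hx1
    refine ⟨⟨fun i hi => ?_, fun i hi j hj hij => ?_, rfl⟩, fun i hi => ?_⟩
    · rw [extendTuple_apply x hi]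
      exact ⟨(mem_monics.1 (hx1 _)).1, hx2 _⟩
    · dsimp only
      rw [extendTuple_apply x hi, extendTuple_apply x hj]
      exact hx3 fun h => hij (congrArg Subtype.val h)
    · rw [extendTuple_apply x hi]
      exact (mem_monics.1 (hx1 ⟨i, hi⟩)).2
  have hle : ∀ i ∈ unitIdx r, e i ≤ d := fun i hi =>
    hsum ▸ Finset.single_le_sum (fun _ _ => Nat.zero_le _) hi
  have hex : ∀ x ∈ (monicTuples K r e).filter fun x => (∀ i, Squarefree (x i)) ∧
      Pairwise fun i j => IsCoprime (x i) (x j),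
      ∃ c ∈ thinColorings (unitIdx r) (ptDeg (K := K) (d := d)) r d,
        ∀ P, c (some P) = factorColor r (extendTuple x) P := by
    intro x hx
    obtain ⟨h, hdeg⟩ := hthin x hx
    obtain ⟨c, hc, -, hcP⟩ := h.exists_coloring (d := d) hr (Or.inl ⟨by
      rw [← hsum]; exact Finset.sum_congr rfl hdeg, by
      rw [natDegree_prod_of_monic _ _ fun i hi => (h.1 i hi).1.pow i]
      convert hwt using 1
      exact Finset.sum_congr rfl fun i hi => by rw [natDegree_pow, hdeg i hi]⟩)
    exact ⟨c, hc, hcP⟩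
  choose! col hcol hcolP using hex
  refine Finset.card_le_card_of_injOn col hcol fun x hx y hy hxy => ?_
  obtain ⟨h, hdeg⟩ := hthin x hx
  obtain ⟨h', hdeg'⟩ := hthin y hy
  funext ⟨i, hi⟩
  rw [← extendTuple_apply x hi, ← extendTuple_apply y hi,
    eq_colorPoly_of_squarefree (h.1 i hi).1 (h.1 i hi).2 ((hdeg i hi).le.trans (hle i hi)),
    eq_colorPoly_of_squarefree (h'.1 i hi).1 (h'.1 i hi).2 ((hdeg' i hi).le.trans (hle i hi))]
  congr 1
  funext P
  have hP : factorColor r (extendTuple x) P = factorColor r (extendTuple y) P := by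
    rw [← hcolP x hx, ← hcolP y hy, hxy]
  have hiff : P.1 ∣ extendTuple x i ↔ P.1 ∣ extendTuple y i := by
    rw [← h.factorColor_eq_iff hi, ← h'.factorColor_eq_iff hi, hP]
  simp only [hiff]

open Classical in
-- A union bound over primes `Q` and over `B`, which must contain the index pairs at which a common
-- prime, or a repeated one when the indices agree, can occur. Entries of degree at most `1` are
-- square-free and need no diagonal pair.
theorem card_thinColorings_ge (hr : 2 ≤ r) (hq : 2 ≤ Nat.card K) (e : ℕ → ℕ)
    (hsum : ∑ k ∈ unitIdx r, e k = d) (hwt : r ∣ ∑ k ∈ unitIdx r, k * e k) (B : Finset (ℕ × ℕ))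
    (hB1 : ∀ i ∈ unitIdx r, 2 ≤ e i → (i, i) ∈ B)
    (hB2 : ∀ i ∈ unitIdx r, ∀ j ∈ unitIdx r, i < j → e i ≠ 0 → e j ≠ 0 → (i, j) ∈ B) :
    (Nat.card K : ℝ) ^ d * (1 - B.card * (1 / (Nat.card K : ℝ) + 1 / (Nat.card K : ℝ) ^ 2)) ≤
      (thinColorings (unitIdx r) (ptDeg (K := K) (d := d)) r d).card := by
  have hle : ∀ i ∈ unitIdx r, e i ≤ d := fun i hi =>
    hsum ▸ Finset.single_le_sum (fun _ _ => Nat.zero_le _) hi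
  set q : ℝ := (Nat.card K : ℝ) with hqdef
  set good := (monicTuples K r e).filter fun x => (∀ i, Squarefree (x i)) ∧
      Pairwise fun i j => IsCoprime (x i) (x j) with hgood
  set B' : Finset (unitIdx r × unitIdx r) := Finset.univ.filter fun p => (p.1.1, p.2.1) ∈ B with hB'
  have hB'card : B'.card ≤ B.card := by
    refine Finset.card_le_card_of_injOn (fun p => (p.1.1, p.2.1)) (fun p hp => ?_) ?_
    · exact (Finset.mem_filter.1 hp).2
    · intro p _ p' _ h
      simp only [Prod.mk.injEq] at h
      exact Prod.ext (Subtype.ext h.1) (Subtype.ext h.2)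
  set bad : unitIdx r × unitIdx r → K[X] → Finset (unitIdx r → K[X]) := fun p Q =>
    Fintype.piFinset fun k : unitIdx r => (monics K (e k)).filter
      (Q ^ ((if k = p.1 then 1 else 0) + (if k = p.2 then 1 else 0)) ∣ ·) with hbad
  have hcover : monicTuples K r e ⊆ good ∪ B'.biUnion fun p => (primesLE K d).biUnion (bad p) := by
    intro x hx
    have hx' := hx
    rw [monicTuples, Fintype.mem_piFinset] at hx'
    have hmem : ∀ (i j : unitIdx r) (Q : K[X]), Q.Monic → Irreducible Q → (i.1, j.1) ∈ B →
        (∀ k, Q ^ ((if k = i then 1 else 0) + (if k = j then 1 else 0)) ∣ x k) → Q ∣ x i →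
        x ∈ good ∪ B'.biUnion fun p => (primesLE K d).biUnion (bad p) := by
      intro i j Q hQ hQi hij hdvd hQx
      refine Finset.mem_union_right _ (Finset.mem_biUnion.2 ⟨(i, j), ?_, Finset.mem_biUnion.2 ⟨Q, ?_, ?_⟩⟩)
      · exact Finset.mem_filter.2 ⟨Finset.mem_univ _, hij⟩
      · obtain ⟨h1, h2⟩ := mem_monics.1 (hx' i)
        exact mem_primesLE.2 ⟨hQ, hQi, (natDegree_le_of_dvd hQx h1.ne_zero).trans (h2 ▸ hle i i.2)⟩
      · rw [hbad, Fintype.mem_piFinset]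
        exact fun k => Finset.mem_filter.2 ⟨hx' k, hdvd k⟩
    by_cases hsq : ∀ i, Squarefree (x i)
    · by_cases hco : Pairwise fun i j => IsCoprime (x i) (x j)
      · exact Finset.mem_union_left _ (Finset.mem_filter.2 ⟨hx, hsq, hco⟩)
      · have hlt : ∃ i j : unitIdx r, i.1 < j.1 ∧ ¬ IsCoprime (x i) (x j) := by
          rw [Pairwise] at hco
          push Not at hco
          obtain ⟨i, j, hij, hn⟩ := hco
          rcases lt_or_gt_of_ne (fun h => hij (Subtype.ext h) : i.1 ≠ j.1) with h | h
          · exact ⟨i, j, h, hn⟩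
          · exact ⟨j, i, h, fun hc => hn hc.symm⟩
        obtain ⟨i, j, hij, hn⟩ := hlt
        rw [← EuclideanDomain.gcd_isUnit_iff] at hn
        obtain ⟨Q, hQ, hQi, hQg⟩ := Polynomial.exists_monic_irreducible_factor _ hn
        have hQ1 := hQg.trans (EuclideanDomain.gcd_dvd_left _ _)
        have hQ2 := hQg.trans (EuclideanDomain.gcd_dvd_right _ _)
        have hpos : ∀ k, Q ∣ x k → e k ≠ 0 := by
          intro k hk
          obtain ⟨h1, h2⟩ := mem_monics.1 (hx' k)
          have h3 := natDegree_le_of_dvd hk h1.ne_zero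
          have h4 := hQi.natDegree_pos
          omega
        refine hmem i j Q hQ hQi (hB2 i i.2 j j.2 hij (hpos i hQ1) (hpos j hQ2)) (fun k => ?_) hQ1
        by_cases hki : k = i
        · rw [if_pos hki, if_neg (fun h => hij.ne (by rw [← hki, h])), add_zero, pow_one, hki]
          exact hQ1
        · rw [if_neg hki, zero_add]
          split_ifs with hkj
          · rw [pow_one, hkj]; exact hQ2
          · rw [pow_zero]; exact one_dvd _
    · push Not at hsq
      obtain ⟨i, hi⟩ := hsq
      obtain ⟨h1, h2⟩ := mem_monics.1 (hx' i)
      rw [squarefree_iff_no_irreducibles h1.ne_zero] at hi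
      push Not at hi
      obtain ⟨R, hR, hRx⟩ := hi
      obtain ⟨Q, hQ, hQi, hQR⟩ := Polynomial.exists_monic_irreducible_factor R hR.not_isUnit
      have hQQ : Q ^ 2 ∣ x i := by rw [sq]; exact (mul_dvd_mul hQR hQR).trans hRx
      have h3 := natDegree_le_of_dvd hQQ h1.ne_zero
      have h4 := hQi.natDegree_pos
      rw [natDegree_pow, h2] at h3
      refine hmem i i Q hQ hQi (hB1 i i.2 (by omega)) (fun k => ?_) ((dvd_pow_self Q two_ne_zero).trans hQQ)
      split_ifs with hki
      · rw [hki]; exact hQQ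
      · rw [add_zero, pow_zero]; exact one_dvd _
  have hcard : (q ^ d : ℝ) = (monicTuples K r e).card := by
    rw [monicTuples, Fintype.card_piFinset]
    simp only [card_monics]
    rw [Finset.prod_pow_eq_pow_sum, Finset.sum_coe_sort (unitIdx r) e, hsum]
    push_cast
    rfl
  have hbadcard : (((B'.biUnion fun p => (primesLE K d).biUnion (bad p)).card : ℕ) : ℝ) ≤
      B.card * (q ^ d * (1 / q + 1 / q ^ 2)) := by
    have h1 : ∀ p ∈ B', ((((primesLE K d).biUnion (bad p)).card : ℕ) : ℝ) ≤
        q ^ d * (1 / q + 1 / q ^ 2) := by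
      intro p _
      calc ((((primesLE K d).biUnion (bad p)).card : ℕ) : ℝ)
          ≤ ∑ Q ∈ primesLE K d, ((bad p Q).card : ℝ) := by exact_mod_cast Finset.card_biUnion_le
        _ ≤ ∑ Q ∈ primesLE K d, q ^ d * (1 / (q ^ Q.natDegree) ^ 2) := by
            refine Finset.sum_le_sum fun Q hQ => ?_
            rw [← hsum]
            exact card_tuples_filter_dvd_le e p.1 p.2 (mem_primesLE.1 hQ).1
        _ ≤ _ := by
            rw [← Finset.mul_sum]
            exact mul_le_mul_of_nonneg_left (sum_primesLE_inv_sq_le hq d) (by positivity)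
    calc (((B'.biUnion fun p => (primesLE K d).biUnion (bad p)).card : ℕ) : ℝ)
        ≤ ∑ p ∈ B', ((((primesLE K d).biUnion (bad p)).card : ℕ) : ℝ) := by
          exact_mod_cast Finset.card_biUnion_le
      _ ≤ B'.card • (q ^ d * (1 / q + 1 / q ^ 2)) := Finset.sum_le_card_nsmul _ _ _ h1
      _ ≤ _ := by
          rw [nsmul_eq_mul]
          gcongr
  have hgoodle : (good.card : ℝ) ≤ (thinColorings (unitIdx r) (ptDeg (K := K) (d := d)) r d).card := by
    exact_mod_cast card_goodTuples_le hr e hsum hwt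
  have htot : ((monicTuples K r e).card : ℝ) ≤
      good.card + ((B'.biUnion fun p => (primesLE K d).biUnion (bad p)).card : ℕ) := by
    exact_mod_cast (Finset.card_le_card hcover).trans (Finset.card_union_le _ _)
  rw [← hcard] at htot
  linarith

open Classical in
-- Few indices carry the degrees, so that `B` stays small: `1` and `r - 1`, and also `2` in degree
-- `1` when `d` is odd and `r ≥ 5`. The constant comes from this last case, with five pairs and `q ≥
-- 6`: `1 - 5 (1/6 + 1/36) = 1/36`.
theorem card_thinColorings_ge_div (hr : 3 ≤ r) (hq : r + 1 ≤ Nat.card K) (hd : 3 ≤ d)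
    (hpar : Even r → Even d) :
    (Nat.card K : ℝ) ^ d / 36 ≤ (thinColorings (unitIdx r) (ptDeg (K := K) (d := d)) r d).card := by
  have h1U : 1 ∈ unitIdx r := mem_unitIdx.2 ⟨⟨le_rfl, by omega⟩, Nat.coprime_one_left r⟩
  have hrU : r - 1 ∈ unitIdx r := by
    refine mem_unitIdx.2 ⟨⟨by omega, by omega⟩, ?_⟩
    rw [Nat.coprime_comm]
    exact (Nat.coprime_self_sub_right (by omega)).2 (Nat.coprime_one_right r)
  set q : ℝ := (Nat.card K : ℝ) with hqdef
  have hinv : ∀ m : ℝ, 0 < m → m ≤ q → 1 / q + 1 / q ^ 2 ≤ 1 / m + 1 / m ^ 2 := by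
    intro m hm hmq
    gcongr
  have htwo : ∀ a b : ℕ, a + b = d → r ∣ a + (r - 1) * b →
      q ^ d / 36 ≤ (thinColorings (unitIdx r) (ptDeg (K := K) (d := d)) r d).card := by
    intro a b hab hw
    refine le_trans ?_ (card_thinColorings_ge (K := K) (r := r) (d := d) (by omega) (by omega)
      (fun i => (if i = 1 then a else 0) + (if i = r - 1 then b else 0)) ?_ ?_
      {(1, 1), (r - 1, r - 1), (1, r - 1)} ?_ ?_)
    · have hc : ((({(1, 1), (r - 1, r - 1), (1, r - 1)} : Finset (ℕ × ℕ)).card : ℕ) : ℝ) ≤ 3 := by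
        exact_mod_cast Finset.card_le_three
      have h4 := hinv 4 (by norm_num) (by rw [hqdef]; exact_mod_cast (by omega : 4 ≤ Nat.card K))
      have h0 : 0 ≤ 1 / q + 1 / q ^ 2 := by positivity
      rw [div_eq_mul_one_div]
      refine mul_le_mul_of_nonneg_left ?_ (by positivity)
      nlinarith
    · simp only [Finset.sum_add_distrib, Finset.sum_ite_eq', h1U, hrU, if_true]
      exact hab
    · simp only [mul_add, mul_ite, mul_zero, Finset.sum_add_distrib, Finset.sum_ite_eq', h1U, hrU,
        if_true, one_mul]
      exact hw
    · intro i _ hi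
      simp only [Finset.mem_insert, Finset.mem_singleton, Prod.mk.injEq]
      split_ifs at hi <;> omega
    · intro i _ j _ hij hi hj
      simp only [Finset.mem_insert, Finset.mem_singleton, Prod.mk.injEq]
      split_ifs at hi hj <;> omega
  rcases Nat.even_or_odd d with ⟨t, ht⟩ | hodd
  · refine htwo t t ht.symm ⟨t, ?_⟩
    obtain ⟨s, rfl⟩ := Nat.exists_eq_add_of_le' (by omega : 1 ≤ r)
    rw [Nat.add_sub_cancel]; ring
  · have hro : Odd r := by
      rw [← Nat.not_even_iff_odd] at hodd ⊢
      exact fun h => hodd (hpar h)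
    obtain ⟨t, ht⟩ : ∃ t, d = 2 * t + 3 := by
      obtain ⟨s, hs⟩ := hodd
      exact ⟨s - 1, by omega⟩
    rcases (by obtain ⟨s, hs⟩ := hro; omega : r = 3 ∨ 5 ≤ r) with rfl | hr5
    -- For `r = 3` the index `2` is `r - 1` itself. Making the two degrees differ by `3` keeps the
    -- weight divisible by `3`.
    · exact htwo t (t + 3) (by omega) ⟨t + 2, by ring⟩
    · have h2U : 2 ∈ unitIdx r := mem_unitIdx.2 ⟨⟨by omega, by omega⟩, Nat.coprime_two_left.2 hro⟩
      refine le_trans ?_ (card_thinColorings_ge (K := K) (r := r) (d := d) (by omega) (by omega)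
        (fun i => (if i = 1 then t else 0) + (if i = r - 1 then t + 2 else 0) +
          (if i = 2 then 1 else 0)) ?_ ?_
        {(1, 1), (r - 1, r - 1), (1, r - 1), (1, 2), (2, r - 1)} ?_ ?_)
      · have hc : ((({(1, 1), (r - 1, r - 1), (1, r - 1), (1, 2), (2, r - 1)} :
            Finset (ℕ × ℕ)).card : ℕ) : ℝ) ≤ 5 := by
          exact_mod_cast Finset.card_le_five
        have h6 := hinv 6 (by norm_num) (by rw [hqdef]; exact_mod_cast (by omega : 6 ≤ Nat.card K))
        have h0 : 0 ≤ 1 / q + 1 / q ^ 2 := by positivity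
        rw [div_eq_mul_one_div]
        refine mul_le_mul_of_nonneg_left ?_ (by positivity)
        nlinarith
      · simp only [Finset.sum_add_distrib, Finset.sum_ite_eq', h1U, hrU, h2U, if_true]
        omega
      · simp only [mul_add, mul_ite, mul_zero, Finset.sum_add_distrib, Finset.sum_ite_eq', h1U, hrU, h2U,
          if_true, one_mul]
        refine ⟨t + 2, ?_⟩
        obtain ⟨s, rfl⟩ := Nat.exists_eq_add_of_le' (by omega : 1 ≤ r)
        rw [Nat.add_sub_cancel]; ring
      · intro i _ hi
        simp only [Finset.mem_insert, Finset.mem_singleton, Prod.mk.injEq]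
        split_ifs at hi <;> omega
      · intro i _ j _ hij hi hj
        simp only [Finset.mem_insert, Finset.mem_singleton, Prod.mk.injEq]
        split_ifs at hi hj <;> omega

end LowerBound

/-! ### The roots of unity `±1` and parity. -/

section RootsOfUnity
variable {r : ℕ} {ζ : ℂ}

/-- Either `ζ = 1`, or `ζ = -1`, which forces `r` to be even and hence `k` to be odd. -/
theorem pow_eq_self_of_sq_eq_one (hζr : ζ ^ r = 1) (hζ : ζ ^ 2 = 1) {k : ℕ} (hk : k.Coprime r) :
    ζ ^ k = ζ := by
  rcases Nat.even_or_odd k with he | ⟨t, rfl⟩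
  · have hro : Odd r := by
      rw [← Nat.not_even_iff_odd]
      intro h
      have h2 := Nat.dvd_gcd he.two_dvd h.two_dvd
      rw [hk] at h2
      omega
    obtain ⟨t, rfl⟩ := hro
    rw [pow_succ, pow_mul, hζ, one_pow, one_mul] at hζr
    rw [hζr, one_pow]
  · rw [pow_succ, pow_mul, hζ, one_pow, one_mul]

theorem pow_eq_one_of_sq_eq_one (hζr : ζ ^ r = 1) (hζ : ζ ^ 2 = 1) {d : ℕ} (hd : Even r → Even d) :
    ζ ^ d = 1 := by
  rcases Nat.even_or_odd r with he | ⟨t, rfl⟩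
  · obtain ⟨t, ht⟩ := hd he
    rw [ht, ← two_mul, pow_mul, hζ, one_pow]
  · rw [pow_succ, pow_mul, hζ, one_pow, one_mul] at hζr
    rw [hζr, one_pow]

theorem even_of_genus {g d : ℕ} (hr : 2 ≤ r) (hd : (r - 1) * d = 2 * g + 2 * r - 2) (he : Even r) :
    Even d := by
  have h1 : Even ((r - 1) * d) := ⟨g + r - 1, by omega⟩
  rcases Nat.even_mul.1 h1 with h | h
  · obtain ⟨s, hs⟩ := he
    obtain ⟨t, ht⟩ := h
    omega
  · exact h

theorem one_div_le_of_genus {g d : ℕ} (hr : 2 ≤ r) (hg : 1 ≤ g)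
    (hd : (r - 1) * d = 2 * g + 2 * r - 2) : 1 / (d : ℝ) ≤ r / g := by
  have hd0 : 0 < d := by have := three_le_of_genus hr hg hd; omega
  rw [div_le_div_iff₀ (by exact_mod_cast hd0) (by exact_mod_cast hg)]
  have h1 : g ≤ r * d := by
    have : (r - 1) * d ≤ r * d := Nat.mul_le_mul_right _ (by omega)
    omega
  rw [one_mul]
  exact_mod_cast h1

end RootsOfUnity

/-! ### Coefficients normalized by powers of `q`. -/

section Normalized
variable {ι : Type*} [Fintype ι]

/-- The normalized coefficients of `colorSeries`. -/
noncomputable def normCoeff (U : Finset ℕ) (δ : ι → ℕ) (q : ℕ) (ζ : ℂ) (m : ℕ) : ℂ :=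
  (colorSeries U ζ δ).coeff m / (q : ℂ) ^ m

/-- The normalized coefficients of `colorSeriesAvoid`. -/
noncomputable def normCoeffAvoid [DecidableEq ι] (U : Finset ℕ) (δ : ι → ℕ) (q : ℕ) (P : ι) (ζ : ℂ) (m : ℕ) : ℂ :=
  (colorSeriesAvoid U ζ δ P).coeff m / (q : ℂ) ^ m

theorem normCoeff_eq_add [DecidableEq ι] {U : Finset ℕ} {δ : ι → ℕ} {q : ℕ} (hq : q ≠ 0) (P : ι) (ζ : ℂ) (m : ℕ) :
    normCoeff U δ q ζ m = normCoeffAvoid U δ q P ζ m + if δ P ≤ m then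
      (∑ i ∈ U, ζ ^ (i * δ P)) / (q : ℂ) ^ δ P * normCoeffAvoid U δ q P ζ (m - δ P) else 0 := by
  have hq' : (q : ℂ) ≠ 0 := by exact_mod_cast hq
  rw [normCoeff, coeff_colorSeries_eq U ζ δ P, add_div, normCoeffAvoid, normCoeffAvoid]
  congr 1
  split_ifs with h
  · conv_lhs => rw [← Nat.add_sub_cancel' h, pow_add, Nat.add_sub_cancel_left]
    field_simp
  · rw [zero_div]

theorem sum_normCoeff [DecidableEq ι] {U : Finset ℕ} (hU : 0 ∉ U) (δ : ι → ℕ) {r q : ℕ} (hr : 0 < r) (d : ℕ) :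
    ((r * (thinColorings U δ r d).card / (q : ℝ) ^ d : ℝ) : ℂ) =
      ∑ ζ ∈ nthRootsFinset r (1 : ℂ), normCoeff U δ q ζ d := by
  push_cast
  rw [card_thinColorings hU δ hr d, Finset.sum_div]
  rfl

theorem sum_normCoeffAvoid [DecidableEq ι] {U : Finset ℕ} (hU : 0 ∉ U) (δ : ι → ℕ) {r q : ℕ} (hr : 0 < r) (d : ℕ)
    (P : ι) :
    ((r * ((thinColorings U δ r d).filter fun c => c (some P) = 0).card / (q : ℝ) ^ d : ℝ) : ℂ) =
      ∑ ζ ∈ nthRootsFinset r (1 : ℂ), normCoeffAvoid U δ q P ζ d := by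
  push_cast
  rw [card_thinColorings_avoid hU δ hr d P, Finset.sum_div]
  refine Finset.sum_congr rfl fun ζ _ => ?_
  rw [normCoeffAvoid]

theorem normCoeff_of_sq_eq_one [DecidableEq ι] {r : ℕ} {δ : ι → ℕ} {q : ℕ} {d : ℕ} {ζ : ℂ} (hζr : ζ ^ r = 1)
    (hζ : ζ ^ 2 = 1) (hd : Even r → Even d) (P : ι) :
    normCoeff (unitIdx r) δ q ζ d = normCoeff (unitIdx r) δ q 1 d ∧
      normCoeffAvoid (unitIdx r) δ q P ζ d = normCoeffAvoid (unitIdx r) δ q P 1 d := by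
  have h1 : ∀ k ∈ unitIdx r, ζ ^ k = ζ := fun k hk =>
    pow_eq_self_of_sq_eq_one hζr hζ (mem_unitIdx.1 hk).2
  have h2 := pow_eq_one_of_sq_eq_one hζr hζ hd
  constructor
  · rw [normCoeff, normCoeff, coeff_colorSeries_of_sq_eq_one (zero_notMem_unitIdx r) δ h1 h2]
  · rw [normCoeffAvoid, normCoeffAvoid,
      coeff_colorSeriesAvoid_of_sq_eq_one (zero_notMem_unitIdx r) δ h1 h2]

end Normalized

/-! ### The estimate for `r ≥ 3`. -/

section HigherDegree

/-- The constant of the main theorem for covers of degree at least `3`. -/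
noncomputable def thinBound (r : ℕ) : ℝ :=
  ratioBound (r.totient - 1) ((r - 1) / (r + 1))
    (r * (2 * regBound r.totient * r + mainBound (r.totient - 1) / (r.totient - 1).factorial))
    (Real.exp (-((r.totient : ℝ) ^ 2 / (1 - ((r - 1) / (r + 1)) ^ 2))) / (r.totient - 1).factorial)
    (r / 36) * r.totient * r

theorem ratioBound_nonneg {k : ℕ} {θ D A₀ c : ℝ} (hθ : θ < 1) (hD : 0 ≤ D) (hA : 0 < A₀) (hc : 0 < c) :
    0 ≤ ratioBound k θ D A₀ c := by
  have : 0 < 1 - θ := by linarith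
  unfold ratioBound
  positivity

theorem mainBound_nonneg (k : ℕ) : 0 ≤ mainBound k := by
  have := regBound_pos (k + 1)
  unfold mainBound
  positivity

variable {K : Type*} [Field K] [Finite K] {r g d : ℕ}

open Classical in
theorem abs_card_div_sub_mainSum_le (hr : 3 ≤ r) (hg : 1 ≤ g) (hd : (r - 1) * d = 2 * g + 2 * r - 2)
    (hq : r + 1 ≤ Nat.card K) (P : Points K d) :
    |(((thinColorings (unitIdx r) (ptDeg (K := K) (d := d)) r d).filter
          fun c => c (some P) = 0).card : ℝ) /
        ((thinColorings (unitIdx r) (ptDeg (K := K) (d := d)) r d).card : ℝ) -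
        mainSum (r.totient / (Nat.card K : ℝ) ^ ptDeg P) (ptDeg P) d (r.totient - 1)| ≤
      thinBound r / (g * (Nat.card K : ℝ) ^ ptDeg P) := by
  set q := Nat.card K with hqdef
  set U := unitIdx r with hUdef
  set δ : Points K d → ℕ := ptDeg with hδ
  set k := r.totient - 1 with hk
  have hline : IsLineUpTo δ q d := isLineUpTo_ptDeg
  have hr2 : 2 ≤ r := by omega
  have hU : U.card = r.totient := card_unitIdx hr2
  have h1U : 1 ∈ U := mem_unitIdx.2 ⟨⟨le_rfl, by omega⟩, Nat.coprime_one_left r⟩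
  have hrU : r - 1 ∈ U := by
    refine mem_unitIdx.2 ⟨⟨by omega, by omega⟩, ?_⟩
    rw [Nat.coprime_comm]
    exact (Nat.coprime_self_sub_right (by omega)).2 (Nat.coprime_one_right r)
  have hφ2 : 2 ≤ r.totient := by
    rw [← hU]
    exact Finset.one_lt_card.2 ⟨1, h1U, r - 1, hrU, by omega⟩
  have hk1 : 1 ≤ k := by omega
  have hUk : U.card = k + 1 := by omega
  have hpar : Even r → Even d := even_of_genus hr2 hd
  have hd3 := three_le_of_genus hr2 hg hd
  have hrR : (3 : ℝ) ≤ r := by exact_mod_cast hr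
  have hqR : (r : ℝ) + 1 ≤ q := by exact_mod_cast hq
  have hq0 : (0 : ℝ) < q := by linarith
  -- Since `φ(r) ≤ r - 1` and `q ≥ r + 1`, this bounds `φ(r)/q` away from `1` by a quantity
  -- depending only on `r`.
  set θ : ℝ := (r - 1) / (r + 1) with hθdef
  have hθ : θ < 1 := by rw [hθdef, div_lt_one (by linarith)]; linarith
  have hθ0 : 0 ≤ θ := div_nonneg (by linarith) (by linarith)
  have hφr : (r.totient : ℝ) ≤ r - 1 := by
    have := Nat.totient_lt r (by omega)
    have h2 : ((r.totient + 1 : ℕ) : ℝ) ≤ r := by exact_mod_cast this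
    push_cast at h2
    linarith
  have hφq : (r.totient : ℝ) ≤ θ * q := by
    calc (r.totient : ℝ) ≤ r - 1 := hφr
      _ = θ * (r + 1) := by rw [hθdef]; field_simp
      _ ≤ θ * q := by gcongr
  have hn1 : 1 ≤ δ P := hline.pos P
  set x : ℝ := r.totient / (q : ℝ) ^ δ P with hx
  have hx0 : 0 ≤ x := by positivity
  have hxθ : x ≤ θ := by
    rw [hx, div_le_iff₀ (by positivity)]
    refine hφq.trans (mul_le_mul_of_nonneg_left ?_ hθ0)
    calc (q : ℝ) = (q : ℝ) ^ 1 := (pow_one _).symm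
      _ ≤ (q : ℝ) ^ δ P := pow_le_pow_right₀ (by linarith) hn1
  set fk : ℝ := (k.factorial : ℝ) with hfk
  have hfk0 : 0 < fk := by rw [hfk]; exact_mod_cast k.factorial_pos
  set C₁ : ℝ := 2 * regBound r.totient * r with hC₁
  set C₂ : ℝ := mainBound k / fk with hC₂
  have hC₁0 : 0 ≤ C₁ := by have := regBound_pos r.totient; positivity
  have hC₂0 : 0 ≤ C₂ := div_nonneg (mainBound_nonneg k) hfk0.le
  obtain ⟨A, hA, hAeq⟩ := exists_eval_regSeries_one (by omega : 3 ≤ q) hline hθ (U := U) (by rw [hU]; exact hφq)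
  rw [hU] at hA
  set A₀ : ℝ := Real.exp (-((r.totient : ℝ) ^ 2 / (1 - θ ^ 2))) / fk with hA₀
  have hroots : ∀ ζ ∈ nthRootsFinset r (1 : ℂ), ζ ^ r = 1 := fun ζ hζ =>
    (mem_nthRootsFinset (by omega) _).1 hζ
  have hcardZ : (nthRootsFinset r (1 : ℂ)).card = r :=
    (Complex.isPrimitiveRoot_exp r (by omega)).card_nthRootsFinset
  set N : ℝ := r * (thinColorings U δ r d).card / (q : ℝ) ^ d with hN
  set N' : ℝ := r * ((thinColorings U δ r d).filter fun c => c (some P) = 0).card / (q : ℝ) ^ d with hN'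
  have hlow : (r : ℝ) / 36 ≤ N := by
    have := card_thinColorings_ge_div (K := K) (r := r) (d := d) hr hq hd3 hpar
    rw [hN, le_div_iff₀ (by positivity)]
    calc (r : ℝ) / 36 * (q : ℝ) ^ d = r * ((q : ℝ) ^ d / 36) := by ring
      _ ≤ _ := by gcongr
  have hμ : ∀ ζ ∈ nthRootsFinset r (1 : ℂ), ‖(∑ i ∈ U, ζ ^ (i * δ P)) / (q : ℂ) ^ δ P‖ ≤ x := by
    intro ζ hζ
    rw [norm_div, norm_pow, Complex.norm_natCast, hx]
    gcongr
    refine (norm_sum_le _ _).trans ?_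
    have hn : ‖ζ‖ = 1 := Complex.norm_eq_one_of_pow_eq_one (hroots ζ hζ) (by omega)
    simp only [norm_pow, hn, one_pow, Finset.sum_const, nsmul_eq_mul, mul_one]
    rw [hU]
  have hμ1 : (∑ i ∈ U, (1 : ℂ) ^ (i * δ P)) / (q : ℂ) ^ δ P = (x : ℂ) := by
    simp only [one_pow, Finset.sum_const, nsmul_eq_mul, mul_one]
    rw [hx, hU, Complex.ofReal_div, Complex.ofReal_pow, Complex.ofReal_natCast, Complex.ofReal_natCast]
  have hsmall : ∀ ζ ∈ nthRootsFinset r (1 : ℂ), ζ ^ 2 ≠ 1 → ∀ m ≤ d,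
      ‖normCoeff U δ q ζ m‖ ≤ C₁ * (m + 1) ^ (k - 1) := by
    intro ζ hζ h m hm
    -- The indices `1` and `r - 1` give the ratios `ζ` and `ζ ^ (-1)`, which agree only if `ζ ^ 2 =
    -- 1`.
    have hne : ζ ^ 1 ≠ ζ ^ (r - 1) := by
      intro he
      apply h
      rw [pow_one] at he
      calc ζ ^ 2 = ζ * ζ := sq ζ
        _ = ζ ^ (r - 1) * ζ := by rw [← he]
        _ = ζ ^ r := by rw [← pow_succ]; congr 1; omega
        _ = 1 := hroots ζ hζ
    have := norm_coeff_colorSeries_div_le (by omega : 3 ≤ q) hline h1U hrU (by omega : 1 ≠ r - 1)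
      (by omega : 0 < r) (hroots ζ hζ) hne hm
    rw [show U.card - 2 = k - 1 by omega, hU] at this
    exact this
  have hmain : ∀ m ≤ d, ‖normCoeff U δ q 1 m - ((A / fk : ℝ) : ℂ) * (m : ℂ) ^ k‖ ≤
      C₂ * (m + 1) ^ (k - 1) := by
    intro m hm
    have := norm_coeff_colorSeries_one_sub_le (by omega : 3 ≤ q) hline hk1 hUk hm
    rw [hAeq] at this
    have hfkC : (fk : ℂ) ≠ 0 := by exact_mod_cast hfk0.ne'
    have heq : normCoeff U δ q 1 m - ((A / fk : ℝ) : ℂ) * (m : ℂ) ^ k =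
        ((k.factorial : ℂ) * ((colorSeries U 1 δ).coeff m / (q : ℂ) ^ m) - (A : ℂ) * (m : ℂ) ^ k) / fk := by
      have : (k.factorial : ℂ) = (fk : ℂ) := by rw [hfk, Complex.ofReal_natCast]
      rw [normCoeff, this, Complex.ofReal_div]
      field_simp
    rw [heq, norm_div, Complex.norm_real, Real.norm_of_nonneg hfk0.le, hC₂, div_mul_eq_mul_div]
    gcongr
  have hA₀0 : 0 < A₀ := div_pos (Real.exp_pos _) hfk0
  have hA₀A : A₀ ≤ A / fk := div_le_div_of_nonneg_right hA hfk0.le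
  have hfinal := abs_div_sub_mainSum_le (Z := nthRootsFinset r (1 : ℂ)) (v := normCoeff U δ q)
    (w := normCoeffAvoid U δ q P) (μ := fun ζ => (∑ i ∈ U, ζ ^ (i * δ P)) / (q : ℂ) ^ δ P)
    (N := N) (N' := N') hn1 (hline.le P) hk1 hx0 hxθ hθ hC₁0 hC₂0 hA₀0 hA₀A
    (by positivity : (0 : ℝ) < r / 36) ((mem_nthRootsFinset (by omega) _).2 (one_pow r))
    (fun ζ _ m _ => normCoeff_eq_add (by omega) P ζ m) hμ hμ1
    (fun ζ hζ h => normCoeff_of_sq_eq_one (hroots ζ hζ) h hpar P) hsmall hmain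
    (sum_normCoeff (zero_notMem_unitIdx r) δ (by omega) d)
    (sum_normCoeffAvoid (zero_notMem_unitIdx r) δ (by omega) d P) hlow
  have hratio : N' / N = (((thinColorings U δ r d).filter fun c => c (some P) = 0).card : ℝ) /
      ((thinColorings U δ r d).card : ℝ) := by
    rw [hN, hN', div_div_div_cancel_right₀ (by positivity), mul_div_mul_left _ _ (by positivity)]
  rw [hratio, hcardZ] at hfinal
  refine hfinal.trans ?_
  have hR := ratioBound_nonneg (k := k) (θ := θ) (D := r * (C₁ + C₂)) (A₀ := A₀) (c := (r : ℝ) / 36) hθ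
    (by positivity) hA₀0 (by positivity)
  have hdg := one_div_le_of_genus hr2 hg hd
  have hB : thinBound r = ratioBound k θ (r * (C₁ + C₂)) A₀ (r / 36) * r.totient * r := by
    rw [thinBound]
  rw [hB]
  generalize ratioBound k θ (r * (C₁ + C₂)) A₀ (r / 36) = R at hR ⊢
  calc R * x / d = R * x * (1 / d) := by ring
    _ ≤ R * x * (r / g) := by gcongr
    _ = R * r.totient * r / (g * (q : ℝ) ^ δ P) := by rw [hx]; ring

end HigherDegree

/-! ### The case `r = 2`: the exact generating function. -/

section Quadratic
variable {ι : Type*} [Fintype ι] {δ : ι → ℕ} {q d : ℕ}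

theorem unitIdx_two : unitIdx 2 = {1} := by decide

/-- The product is the inverse of `A`, and `A` agrees with `1 / (1 - q t)` up to degree `d`. -/
theorem coeff_prod_one_sub_X_pow (h : IsLineUpTo δ q d) : ∀ m ≤ d,
    (∏ Q, (1 - X ^ δ Q) : ℂ[X]).coeff m = (1 - C (q : ℂ) * X).coeff m := by
  obtain ⟨A, hA, hAq⟩ := h.zeta
  set Z : ℂ[X] := ∏ Q, (1 - X ^ δ Q) with hZ
  have hZA : (Z : PowerSeries ℂ) * A = 1 := by
    rw [mul_comm, ← hA, hZ, ← Polynomial.coeToPowerSeries.ringHom_apply, map_prod]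
    congr 1
    refine Finset.prod_congr rfl fun Q _ => ?_
    rw [map_sub, map_one, map_pow, Polynomial.coeToPowerSeries.ringHom_apply, Polynomial.coe_X]
  have hA1 : ∀ m ≤ d, PowerSeries.coeff m (A * ((1 - C (q : ℂ) * X : ℂ[X]) : PowerSeries ℂ)) =
      PowerSeries.coeff m (1 : PowerSeries ℂ) := by
    intro m hm
    have hcoe : ((1 - C (q : ℂ) * X : ℂ[X]) : PowerSeries ℂ) =
        1 - PowerSeries.C (q : ℂ) * PowerSeries.X := by
      rw [← Polynomial.coeToPowerSeries.ringHom_apply, map_sub, map_one, map_mul,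
        Polynomial.coeToPowerSeries.ringHom_apply, Polynomial.coeToPowerSeries.ringHom_apply,
        Polynomial.coe_C, Polynomial.coe_X]
    rw [hcoe, mul_sub, mul_one, mul_left_comm, map_sub, PowerSeries.coeff_C_mul, hAq m hm]
    rcases m with _ | m
    · simp
    · rw [PowerSeries.coeff_succ_mul_X, hAq m (by omega), PowerSeries.coeff_one,
        if_neg (Nat.succ_ne_zero m)]
      ring
  intro m hm
  rw [← Polynomial.coeff_coe, ← Polynomial.coeff_coe, ← mul_one (Z : PowerSeries ℂ),
    ← coeff_mul_congr (fun _ _ => rfl) hA1 m hm, ← mul_assoc, hZA, one_mul]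

theorem coeff_expand_prod (h : IsLineUpTo δ q d) : ∀ m ≤ d,
    (∏ Q, (1 - X ^ (2 * δ Q)) : ℂ[X]).coeff m = (1 - C (q : ℂ) * X ^ 2).coeff m := by
  intro m hm
  have h1 : (∏ Q, (1 - X ^ (2 * δ Q)) : ℂ[X]) = expand ℂ 2 (∏ Q, (1 - X ^ δ Q)) := by
    rw [map_prod]
    refine Finset.prod_congr rfl fun Q _ => ?_
    rw [map_sub, map_one, map_pow, expand_X, pow_mul]
  have h2 : (1 - C (q : ℂ) * X ^ 2 : ℂ[X]) = expand ℂ 2 (1 - C (q : ℂ) * X) := by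
    rw [map_sub, map_one, map_mul, expand_C, expand_X]
  rw [h1, h2, coeff_expand two_pos, coeff_expand two_pos]
  split_ifs
  · exact coeff_prod_one_sub_X_pow h _ ((Nat.div_le_self m 2).trans hm)
  · rfl

/-- For `r = 2` the generating function is `(1 + t)(1 - q t ^ 2) / (1 - q t)` up to degree `d`. -/
theorem coeff_colorSeries_two (h : IsLineUpTo δ q d) : ∀ m ≤ d,
    (colorSeries {1} 1 δ).coeff m = (q : ℂ) ^ m + (if 1 ≤ m then (q : ℂ) ^ (m - 1) else 0) -
      q * ((if 2 ≤ m then (q : ℂ) ^ (m - 2) else 0) + if 3 ≤ m then (q : ℂ) ^ (m - 3) else 0) := by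
  intro m hm
  obtain ⟨A, hA, hAq⟩ := h.zeta
  have hreg : regSeries {1} 1 δ = (1 + X) * ∏ Q, (1 - X ^ (2 * δ Q)) := by
    rw [regSeries, locFactor]
    congr 1
    · simp
    · refine Finset.prod_congr rfl fun Q _ => ?_
      rw [expand_regFactor, locFactor]
      simp only [Finset.sum_singleton, Finset.prod_singleton, one_pow, map_one]
      ring
  have hloc : ∀ l ≤ d, PowerSeries.coeff l (regSeries {1} 1 δ : PowerSeries ℂ) =
      PowerSeries.coeff l (((1 + X) * (1 - C (q : ℂ) * X ^ 2) : ℂ[X]) : PowerSeries ℂ) := by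
    rw [hreg, Polynomial.coe_mul, Polynomial.coe_mul]
    refine coeff_mul_congr (fun _ _ => rfl) fun l hl => ?_
    rw [Polynomial.coeff_coe, Polynomial.coeff_coe, coeff_expand_prod h l hl]
  have hcoe : (((1 + X) * (1 - C (q : ℂ) * X ^ 2) : ℂ[X]) : PowerSeries ℂ) * A =
      A + A * PowerSeries.X ^ 1 - PowerSeries.C (q : ℂ) * (A * PowerSeries.X ^ 2 + A * PowerSeries.X ^ 3) := by
    rw [← Polynomial.coeToPowerSeries.ringHom_apply, map_mul, map_add, map_sub, map_one, map_mul, map_pow,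
        Polynomial.coeToPowerSeries.ringHom_apply, Polynomial.coeToPowerSeries.ringHom_apply,
        Polynomial.coe_C, Polynomial.coe_X]
    ring
  rw [← Polynomial.coeff_coe, colorSeries_eq_mul {1} hA, Finset.prod_singleton, pow_one,
    PowerSeries.rescale_one, RingHom.id_apply, coeff_mul_congr hloc (fun _ _ => rfl) m hm, hcoe]
  simp only [map_sub, map_add, PowerSeries.coeff_C_mul, PowerSeries.coeff_mul_X_pow']
  rw [hAq m hm]
  congr 2
  · split_ifs
    · rw [hAq _ (by omega)]
    · rfl
  · congr 1
    · split_ifs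
      · rw [hAq _ (by omega)]
      · rfl
    · split_ifs
      · rw [hAq _ (by omega)]
      · rfl

/-- From index `3` on all four terms of `coeff_colorSeries_two` are present, the two middle ones
cancel, and `q ^ m - q ^ (m - 2)` remains. -/
theorem normCoeff_two_eq (hq : q ≠ 0) (h : IsLineUpTo δ q d) {m : ℕ} (hm : m ≤ d) (h3 : 3 ≤ m) :
    normCoeff {1} δ q 1 m = ((1 - 1 / (q : ℝ) ^ 2 : ℝ) : ℂ) := by
  have hq' : (q : ℂ) ≠ 0 := by exact_mod_cast hq
  rw [normCoeff, coeff_colorSeries_two h m hm, if_pos (by omega), if_pos (by omega), if_pos h3]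
  obtain ⟨m, rfl⟩ := Nat.exists_eq_add_of_le' h3
  rw [show m + 3 - 1 = m + 2 by omega, show m + 3 - 2 = m + 1 by omega, Nat.add_sub_cancel]
  push_cast
  field_simp
  ring

theorem norm_normCoeff_two_sub_le (hq : 2 ≤ q) (h : IsLineUpTo δ q d) {m : ℕ} (hm : m ≤ d)
    (h3 : m < 3) : ‖normCoeff {1} δ q 1 m - ((1 - 1 / (q : ℝ) ^ 2 : ℝ) : ℂ)‖ ≤ 1 := by
  have hq' : (q : ℂ) ≠ 0 := by exact_mod_cast (by omega : q ≠ 0)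
  have hqR : (2 : ℝ) ≤ q := by exact_mod_cast hq
  have h1 : 1 / (q : ℝ) ≤ 1 / 2 := by gcongr
  have h2 : 1 / (q : ℝ) ^ 2 ≤ 1 / 2 ^ 2 := by gcongr
  have h0 : 0 ≤ 1 / (q : ℝ) := by positivity
  have h00 : 0 ≤ 1 / (q : ℝ) ^ 2 := by positivity
  have key : ∃ y : ℝ, normCoeff {1} δ q 1 m = (y : ℂ) ∧ 1 ≤ y ∧ y ≤ 1 + 1 / q := by
    rw [normCoeff, coeff_colorSeries_two h m hm]
    interval_cases m
    · exact ⟨1, by simp, le_rfl, by linarith⟩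
    · refine ⟨1 + 1 / q, ?_, by linarith, le_rfl⟩
      norm_num
      field_simp
    · refine ⟨1, ?_, le_rfl, by linarith⟩
      norm_num
      omega
  obtain ⟨y, hy, hy1, hy2⟩ := key
  rw [hy, ← Complex.ofReal_sub, Complex.norm_real, Real.norm_eq_abs, abs_le]
  constructor <;> linarith

theorem sq_le_three_pow (g : ℕ) : g ^ 2 ≤ 3 ^ g := by
  induction g with
  | zero => simp
  | succ g ih =>
    rcases Nat.lt_or_ge g 2 with h | h
    · interval_cases g <;> norm_num
    · rw [pow_succ 3]
      nlinarith

theorem pow_le_of_two_le {g n a : ℕ} (hq : 3 ≤ q) (ha : 2 ≤ a) (h : 2 * g ≤ a * n) :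
    (1 / (q : ℝ) ^ n) ^ a ≤ 1 / (q : ℝ) ^ n * (1 / 3 ^ g) := by
  have hqR : (3 : ℝ) ≤ q := by exact_mod_cast hq
  obtain ⟨b, rfl⟩ := Nat.exists_eq_add_of_le' (by omega : 1 ≤ a)
  rw [pow_succ', one_div_pow (_ ^ n) b, ← pow_mul]
  gcongr
  calc (3 : ℝ) ^ g ≤ 3 ^ (n * b) := by
        gcongr
        · norm_num
        · have : n ≤ n * b := Nat.le_mul_of_pos_right n (by omega)
          have h2 : (b + 1) * n = n * b + n := by ring
          omega
    _ ≤ (q : ℝ) ^ (n * b) := by gcongr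

/-- Only terms with `d - a n ≤ 2` deviate from the constant coefficient. They have `a ≥ 2` and `a n
≥ 2 g`, so each is at most `x 3 ^ (-g)`. There are at most `5 g` terms, and `g ^ 2 ≤ 3 ^ g`. -/
theorem norm_normCoeffAvoid_two_sub_le [DecidableEq ι] {g : ℕ} (hq : 3 ≤ q) (h : IsLineUpTo δ q d)
    (hg : 1 ≤ g) (hd : d = 2 * g + 2) (P : ι) (hP : δ P < 2 * g) :
    ‖normCoeffAvoid {1} δ q P 1 d - normCoeff {1} δ q 1 d *
      mainSum (1 / (q : ℝ) ^ δ P) (δ P) d 0‖ ≤ 5 / g * (1 / (q : ℝ) ^ δ P) := by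
  set x : ℝ := 1 / (q : ℝ) ^ δ P with hx
  have hqR : (3 : ℝ) ≤ q := by exact_mod_cast hq
  have hx0 : 0 ≤ x := by positivity
  have hrec : ∀ m ≤ d, normCoeff {1} δ q 1 m = normCoeffAvoid {1} δ q P 1 m +
      if δ P ≤ m then (x : ℂ) * normCoeffAvoid {1} δ q P 1 (m - δ P) else 0 := by
    intro m _
    rw [normCoeff_eq_add (by omega) P 1 m, hx]
    simp
  rw [eq_sum_of_eq_add_shift (h.pos P) hrec d le_rfl, mainSum, Complex.ofReal_sum, Finset.mul_sum,
    ← Finset.sum_sub_distrib]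
  have hterm : ∀ a ∈ Finset.range (d / δ P + 1),
      ‖(-(x : ℂ)) ^ a * normCoeff {1} δ q 1 (d - a * δ P) - normCoeff {1} δ q 1 d *
        (((-x) ^ a * (1 - (a : ℝ) * (δ P : ℝ) / (d : ℝ)) ^ 0 : ℝ) : ℂ)‖ ≤ x * (1 / 3 ^ g) := by
    intro a ha
    have had : a * δ P ≤ d :=
      (Nat.mul_le_mul_right _ (Nat.lt_succ_iff.1 (Finset.mem_range.1 ha))).trans (Nat.div_mul_le_self d _)
    have heq : (-(x : ℂ)) ^ a * normCoeff {1} δ q 1 (d - a * δ P) - normCoeff {1} δ q 1 d *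
        (((-x) ^ a * (1 - (a : ℝ) * (δ P : ℝ) / (d : ℝ)) ^ 0 : ℝ) : ℂ) =
        (-(x : ℂ)) ^ a * (normCoeff {1} δ q 1 (d - a * δ P) - ((1 - 1 / (q : ℝ) ^ 2 : ℝ) : ℂ)) := by
      rw [normCoeff_two_eq (by omega) h le_rfl (by omega), pow_zero, mul_one, Complex.ofReal_pow,
        Complex.ofReal_neg]
      ring
    rw [heq, norm_mul, norm_pow, norm_neg, Complex.norm_real, Real.norm_of_nonneg hx0]
    rcases Nat.lt_or_ge (d - a * δ P) 3 with h3 | h3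
    · have ha2 : 2 ≤ a := by
        by_contra! hlt
        interval_cases a <;> omega
      refine (mul_le_of_le_one_right (by positivity)
        (norm_normCoeff_two_sub_le (by omega) h (Nat.sub_le _ _) h3)).trans ?_
      exact pow_le_of_two_le hq ha2 (by omega)
    · rw [normCoeff_two_eq (by omega) h (Nat.sub_le _ _) h3, sub_self, norm_zero, mul_zero]
      positivity
  refine (norm_sum_le _ _).trans ((Finset.sum_le_card_nsmul _ _ _ hterm).trans ?_)
  rw [Finset.card_range, nsmul_eq_mul]
  have h1 : ((d / δ P + 1 : ℕ) : ℝ) ≤ 5 * g := by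
    have : d / δ P ≤ d := Nat.div_le_self _ _
    exact_mod_cast (by omega : d / δ P + 1 ≤ 5 * g)
  have hgR : (0 : ℝ) < g := by exact_mod_cast hg
  have h2 : (g : ℝ) * (1 / 3 ^ g) ≤ 1 / g := by
    rw [mul_one_div, div_le_div_iff₀ (by positivity) hgR, one_mul, ← sq]
    exact_mod_cast sq_le_three_pow g
  calc ((d / δ P + 1 : ℕ) : ℝ) * (x * (1 / 3 ^ g)) ≤ 5 * g * (x * (1 / 3 ^ g)) := by gcongr
    _ = 5 * x * (g * (1 / 3 ^ g)) := by ring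
    _ ≤ 5 * x * (1 / g) := by gcongr
    _ = 5 / g * x := by ring

end Quadratic

/-! ### The estimate for `r = 2`. -/

section QuadraticFamily
variable {K : Type*} [Field K] [Finite K] {g d : ℕ}

open Classical in
theorem card_thinColorings_two (hq : 3 ≤ Nat.card K) (hg : 1 ≤ g) (hd : d = 2 * g + 2) :
    ((thinColorings (unitIdx 2) (ptDeg (K := K) (d := d)) 2 d).card : ℝ) =
      (Nat.card K : ℝ) ^ d * (1 - 1 / (Nat.card K : ℝ) ^ 2) ∧
    ∀ P : Points K d, (((thinColorings (unitIdx 2) (ptDeg (K := K) (d := d)) 2 d).filter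
      fun c => c (some P) = 0).card : ℂ) =
      (Nat.card K : ℂ) ^ d * normCoeffAvoid {1} ptDeg (Nat.card K) P 1 d := by
  have hline : IsLineUpTo (ptDeg (K := K) (d := d)) (Nat.card K) d := isLineUpTo_ptDeg
  have hroots : ∀ ζ ∈ nthRootsFinset 2 (1 : ℂ), ζ ^ 2 = 1 := fun ζ hζ =>
    (mem_nthRootsFinset two_pos _).1 hζ
  have hcardZ : (nthRootsFinset 2 (1 : ℂ)).card = 2 :=
    (Complex.isPrimitiveRoot_exp 2 two_ne_zero).card_nthRootsFinset
  have hpar : Even 2 → Even d := fun _ => ⟨g + 1, by omega⟩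
  have hqC : (Nat.card K : ℂ) ≠ 0 := by exact_mod_cast (by omega : Nat.card K ≠ 0)
  constructor
  · have h1 : ∀ ζ ∈ nthRootsFinset 2 (1 : ℂ), (colorSeries (unitIdx 2) ζ (ptDeg (K := K) (d := d))).coeff d =
        (colorSeries {1} 1 (ptDeg (K := K) (d := d))).coeff d := fun ζ hζ => by
      rw [coeff_colorSeries_of_sq_eq_one (zero_notMem_unitIdx 2) _ (fun k hk =>
        pow_eq_self_of_sq_eq_one (hroots ζ hζ) (hroots ζ hζ) (mem_unitIdx.1 hk).2)
        (pow_eq_one_of_sq_eq_one (hroots ζ hζ) (hroots ζ hζ) hpar), unitIdx_two]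
    have h2 := card_thinColorings (zero_notMem_unitIdx 2) (ptDeg (K := K) (d := d)) two_pos d
    rw [Finset.sum_congr rfl h1, Finset.sum_const, hcardZ, nsmul_eq_mul] at h2
    have h3 := mul_left_cancel₀ (by norm_num) h2
    have h4 := normCoeff_two_eq (by omega) hline le_rfl (by omega : 3 ≤ d)
    rw [normCoeff, div_eq_iff (pow_ne_zero _ hqC), ← h3] at h4
    rw [mul_comm]
    exact_mod_cast h4
  · intro P
    have h1 : ∀ ζ ∈ nthRootsFinset 2 (1 : ℂ),
        (colorSeriesAvoid (unitIdx 2) ζ (ptDeg (K := K) (d := d)) P).coeff d =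
        (colorSeriesAvoid {1} 1 (ptDeg (K := K) (d := d)) P).coeff d := fun ζ hζ => by
      rw [coeff_colorSeriesAvoid_of_sq_eq_one (zero_notMem_unitIdx 2) _ (fun k hk =>
        pow_eq_self_of_sq_eq_one (hroots ζ hζ) (hroots ζ hζ) (mem_unitIdx.1 hk).2)
        (pow_eq_one_of_sq_eq_one (hroots ζ hζ) (hroots ζ hζ) hpar), unitIdx_two]
    have h2 := card_thinColorings_avoid (zero_notMem_unitIdx 2) (ptDeg (K := K) (d := d)) two_pos d P
    rw [Finset.sum_congr rfl h1, Finset.sum_const, hcardZ, nsmul_eq_mul] at h2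
    rw [mul_left_cancel₀ (by norm_num) h2, normCoeffAvoid]
    field_simp

open Classical in
theorem abs_card_div_sub_mainSum_le_two (hg : 1 ≤ g) (hd : d = 2 * g + 2) (hq : 3 ≤ Nat.card K)
    (P : Points K d) (hP : ptDeg P < 2 * g) :
    |(((thinColorings (unitIdx 2) (ptDeg (K := K) (d := d)) 2 d).filter
          fun c => c (some P) = 0).card : ℝ) /
        ((thinColorings (unitIdx 2) (ptDeg (K := K) (d := d)) 2 d).card : ℝ) -
        mainSum (1 / (Nat.card K : ℝ) ^ ptDeg P) (ptDeg P) d 0| ≤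
      10 / (g * (Nat.card K : ℝ) ^ ptDeg P) := by
  have hline : IsLineUpTo (ptDeg (K := K) (d := d)) (Nat.card K) d := isLineUpTo_ptDeg
  obtain ⟨h1, h2⟩ := card_thinColorings_two (K := K) hq hg hd
  have h3 := norm_normCoeffAvoid_two_sub_le hq hline hg hd P hP
  rw [normCoeff_two_eq (by omega) hline le_rfl (by omega)] at h3
  set q : ℝ := (Nat.card K : ℝ) with hqdef
  have hqR : (3 : ℝ) ≤ q := by rw [hqdef]; exact_mod_cast hq
  have hq0 : (0 : ℝ) < q := by linarith
  set S := mainSum (1 / q ^ ptDeg P) (ptDeg P) d 0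
  set M : ℝ := (((thinColorings (unitIdx 2) (ptDeg (K := K) (d := d)) 2 d).filter
          fun c => c (some P) = 0).card : ℝ) with hM
  have hMC : normCoeffAvoid {1} ptDeg (Nat.card K) P 1 d = ((M / q ^ d : ℝ) : ℂ) := by
    have hqC : (Nat.card K : ℂ) ≠ 0 := by exact_mod_cast (by omega : Nat.card K ≠ 0)
    have := h2 P
    rw [hM, hqdef]
    push_cast
    rw [eq_div_iff (pow_ne_zero _ hqC), mul_comm, ← this]
  set κ : ℝ := 1 - 1 / q ^ 2 with hκ
  have hκ2 : 1 / 2 ≤ κ := by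
    have : 1 / q ^ 2 ≤ 1 / 3 ^ 2 := by gcongr
    rw [hκ]
    linarith
  rw [hMC, ← Complex.ofReal_mul, ← Complex.ofReal_sub, Complex.norm_real, Real.norm_eq_abs] at h3
  have h4 : M / (q ^ d * κ) - S = (M / q ^ d - κ * S) / κ := by
    have : κ ≠ 0 := by linarith
    field_simp
  rw [h1, h4, abs_div, abs_of_pos (by linarith : 0 < κ), div_le_iff₀ (by linarith)]
  refine h3.trans ?_
  have hgR : (0 : ℝ) < g := by exact_mod_cast hg
  calc 5 / (g : ℝ) * (1 / q ^ ptDeg P) = 10 / (g * q ^ ptDeg P) * (1 / 2) := by field_simp; norm_num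
    _ ≤ 10 / (g * q ^ ptDeg P) * κ := by gcongr

end QuadraticFamily

/-! ### Assembly of the cases. -/

section Assembly

theorem add_one_le_of_modEq_one {r q : ℕ} (hq : 2 ≤ q) (h : q ≡ 1 [MOD r]) : r + 1 ≤ q := by
  have h1 := (Nat.modEq_iff_dvd' (by omega)).1 h.symm
  have := Nat.le_of_dvd (by omega) h1
  omega

theorem thinBound_nonneg {r : ℕ} (hr : 2 ≤ r) : 0 ≤ thinBound r := by
  have hrR : (2 : ℝ) ≤ r := by exact_mod_cast hr
  have hθ : ((r : ℝ) - 1) / (r + 1) < 1 := by rw [div_lt_one (by linarith)]; linarith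
  have h1 := regBound_pos r.totient
  have h2 := mainBound_nonneg (r.totient - 1)
  have h3 := ratioBound_nonneg (k := r.totient - 1) hθ
    (D := r * (2 * regBound r.totient * r + mainBound (r.totient - 1) / (r.totient - 1).factorial))
    (A₀ := Real.exp (-((r.totient : ℝ) ^ 2 / (1 - ((r - 1) / (r + 1)) ^ 2))) / (r.totient - 1).factorial)
    (c := r / 36) (by positivity) (by positivity) (by positivity)
  unfold thinBound
  positivity

end Assembly
end ThinCover

theorem proposition4p2 (r : ℕ) (hr : 2 ≤ r) :
    ∃ B : ℝ, ∀ (K : Type*) [Field K] [Finite K], Nat.card K ≡ 1 [MOD r] →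
      ∀ g d : ℕ, 1 ≤ g → (r - 1) * d = 2 * g + 2 * r - 2 →
        (ThinCover.thinFamily K r g).Finite ∧ (ThinCover.thinFamily K r g).Nonempty ∧
        ∀ P : Polynomial K, Irreducible P →
          (r = 2 → P.natDegree < 2 * g ∨ 2 * g + 2 < P.natDegree) →
          |((ThinCover.thinFamilyCoprime K r g P).ncard : ℝ) /
                ((ThinCover.thinFamily K r g).ncard : ℝ) -
              ∑ a ∈ Finset.range (d / P.natDegree + 1),
                (-(Nat.totient r : ℝ) / (Nat.card K : ℝ) ^ P.natDegree) ^ a *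
                  (1 - (a : ℝ) * (P.natDegree : ℝ) / (d : ℝ)) ^ (Nat.totient r - 1)| ≤
            B / ((g : ℝ) * (Nat.card K : ℝ) ^ P.natDegree) := by
  classical
  -- `thinBound r` serves `r ≥ 3` and `10` serves `r = 2`. Both are nonnegative, so the sum covers
  -- each case.
  refine ⟨ThinCover.thinBound r + 10, ?_⟩
  intro K _ _ hK g d hg hd
  have hq : r + 1 ≤ Nat.card K := ThinCover.add_one_le_of_modEq_one Finite.one_lt_card hK
  have hqR : (0 : ℝ) < Nat.card K := by exact_mod_cast (by omega : 0 < Nat.card K)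
  have hfin := ThinCover.finite_thinFamily (K := K) hr hg hd
  have hL : (0 : ℝ) < Nat.card (ThinCover.LeadingClass K r) := by exact_mod_cast Nat.card_pos
  have hB := ThinCover.thinBound_nonneg hr
  have hd2 : r = 2 → d = 2 * g + 2 := by rintro rfl; omega
  have hcol : 0 < ((ThinCover.thinColorings (ThinCover.unitIdx r)
      (ThinCover.ptDeg (K := K) (d := d)) r d).card : ℝ) := by
    rcases (by omega : r = 2 ∨ 3 ≤ r) with rfl | hr3
    · rw [(ThinCover.card_thinColorings_two (by omega) hg (hd2 rfl)).1]
      have h3 : (3 : ℝ) ≤ Nat.card K := by exact_mod_cast hq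
      have : 1 / (Nat.card K : ℝ) ^ 2 ≤ 1 / 3 ^ 2 := by gcongr
      have h4 : 0 < 1 - 1 / (Nat.card K : ℝ) ^ 2 := by linarith
      positivity
    · refine lt_of_lt_of_le ?_ (ThinCover.card_thinColorings_ge_div hr3 hq
        (ThinCover.three_le_of_genus hr hg hd) (ThinCover.even_of_genus hr hd))
      positivity
  have hncard : 0 < ((ThinCover.thinFamily K r g).ncard : ℝ) := by
    rw [ThinCover.ncard_thinFamily hr hg hd]
    push_cast
    positivity
  refine ⟨hfin, (Set.ncard_pos hfin).1 (by exact_mod_cast hncard), fun P hP hex => ?_⟩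
  rcases le_or_gt P.natDegree d with hPd | hPd
  -- Points are monic, so `P` is replaced by its monic associate, which has the same degree and the
  -- same coprimality relations.
  · have hmon := Polynomial.monic_normalize hP.ne_zero
    have hass : Associated P (normalize P) := (normalize_associated P).symm
    have hdeg : (normalize P).natDegree = P.natDegree := Polynomial.natDegree_eq_of_degree_eq Polynomial.degree_normalize
    have hmem : normalize P ∈ ThinCover.primesLE K d :=
      ThinCover.mem_primesLE.2 ⟨hmon, hass.irreducible hP, hdeg.le.trans hPd⟩
    set Q : ThinCover.Points K d := ⟨normalize P, hmem⟩ with hQ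
    have hQdeg : ThinCover.ptDeg Q = P.natDegree := hdeg
    rw [ThinCover.ncard_thinFamily hr hg hd, ThinCover.ncard_thinFamilyCoprime hr hg hd Q hass,
      Nat.cast_mul, Nat.cast_mul, mul_div_mul_left _ _ hL.ne']
    have hsum : ∑ a ∈ Finset.range (d / P.natDegree + 1),
        (-(Nat.totient r : ℝ) / (Nat.card K : ℝ) ^ P.natDegree) ^ a *
          (1 - (a : ℝ) * (P.natDegree : ℝ) / (d : ℝ)) ^ (Nat.totient r - 1) =
        ThinCover.mainSum (r.totient / (Nat.card K : ℝ) ^ P.natDegree) P.natDegree d (r.totient - 1) := by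
      rw [ThinCover.mainSum]
      simp only [neg_div]
    rw [hsum]
    rcases (by omega : r = 2 ∨ 3 ≤ r) with rfl | hr3
    · have h := ThinCover.abs_card_div_sub_mainSum_le_two hg (hd2 rfl) (by omega) Q (by
        rw [hQdeg]
        have := hd2 rfl
        rcases hex rfl with h | h <;> omega)
      rw [hQdeg] at h
      rw [Nat.totient_two, Nat.cast_one]
      refine h.trans ?_
      gcongr
      linarith
    · have h := ThinCover.abs_card_div_sub_mainSum_le hr3 hg hd hq Q
      rw [hQdeg] at h
      refine h.trans ?_
      gcongr
      linarith
  -- Every prime factor of a member has degree at most `d < deg P`, so the ratio is `1`, and the sum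
  -- consists of the term `a = 0`.
  · rw [ThinCover.thinFamilyCoprime_eq_of_lt hr hg hd hP hPd, div_self hncard.ne',
      Nat.div_eq_of_lt hPd]
    simp only [zero_add, Finset.range_one, Finset.sum_singleton, pow_zero, Nat.cast_zero, zero_mul,
      zero_div, sub_zero, one_pow, mul_one, sub_self, abs_zero]
    positivity
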